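/- Let $\mathcal V:(0,\infty)\setminus\{1\}\to\mathbb R$ be $\mathcal V=R+S$, where for $0<p<1$ $$R(p)=\frac{2\log p}{1+p^2}-\frac{2}{p\sqrt{1+p^2}}\,\mathrm{artanh}\frac{p}{\sqrt{1+p^2}},\qquad S(p)=-\frac{2\log p}{1-p^2}+\frac{2}{p\sqrt{1-p^2}}\arctan\frac{p}{\sqrt{1-p^2}},$$ and for $p>1$ $$R(p)=-\frac{2\log p}{p(1+p^2)}-\frac{2}{p\sqrt{1+p^2}}\,\mathrm{artanh}\frac{1}{\sqrt{1+p^2}},\qquad S(p)=\frac{2\log p}{p(p^2-1)}+\frac{2}{p\sqrt{p^2-1}}\arctan\frac{1}{\sqrt{p^2-1}}.$$ Let $n^0(p)=p^{-2}$ and $$\gamma_N=\iint_{p_3,p_4>0,\;p_3^2+p_4^2>1}\min\{1,p_2,p_3,p_4\}\big(n^0_3n^0_4-n^0_2n^0_3-n^0_2n^0_4\big)\,p_3p_4\,dp_3\,dp_4,\qquad p_2=\sqrt{p_3^2+p_4^2-1},$$ with $n^0_i=n^0(p_i)$. Consider the linearization around $n^0$ (with $n=n^0(1+A)$) of the isotropic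 wave kinetic equation of the three dimensional cubic Schrödinger equation, $$\partial_tA(t,p)=\gamma_NA(t,p)+\int_0^\infty\mathcal V\Big(\frac p{p'}\Big)A(t,p')\frac{dp'}{p'},\qquad A(0)=A_0.\tag{E}$$ For real $q\ge1$ and $\theta$, let $L^q_\theta$ be the space of measurable $f$ on $(0,\infty)$ with $\|f\|_{L^q_\theta}=\big(\int_0^\infty|f|^qp^{2\theta-1}dp\big)^{1/q}<\infty$, and for real $a,b$ let $\mathscr Y_{a,b}$ be the space of measurable $g$ on $(0,\infty)$ with $\|g\|_{a,b}=\operatorname{ess\,sup}_{0<p<1}p^{-2a}|g(p)|+\operatorname{ess\,sup}_{p>1}p^{-2b}|g(p)|<\infty$. A solution in a space $X$ is a function $A\in C([0,\infty);X)\cap C^1((0,\infty);X)$ with $A(0)=A_0$ that satisfies (E) in $X$ for all $t>0$. Equalities and inequalities of functions of $p$ hold almost everywhere. 1. (Well-posedness.) (i) Let $q\ge1$ and $\theta\in(-1,5/2)$. For every nonnegative $A_0\in L^q_\theta$ there is a unique solution $A$ in $L^q_\theta$, and $A(t)\ge0$ for all $t\ge 0$. For every $T>0$ there is a constant $C_T>0$,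 independent of $A_0$, with $\|A(t)\|_{L^q_\theta}\le C_T\|A_0\|_{L^q_\theta}$ for all $t\in[0,T]$. Moreover $\mathcal V\in L^1_0$ and, when $\theta=0$, $$\|A(t)\|_{L^q_0}\le e^{\gamma_Nt}\Big(1+\|\mathcal V\|_{L^1_0}\big(e^{\|\mathcal V\|_{L^1_0}t}-1\big)\Big)\|A_0\|_{L^q_0}\qquad\text{for all }t\ge0.$$ (ii) Let $-\frac52<b<-\frac34$ and $\frac12<a<1$. For every nonnegative $A_0\in\mathscr Y_{a,b}$ there is a unique solution $A$ in $\mathscr Y_{a,b}$, and $A(t)\ge0$ for all $t\ge0$. For every $T>0$ there is a constant $C_T>0$, independent of $A_0$, with $\|A(t)\|_{a,b}\le C_T\|A_0\|_{a,b}$ for all $t\in[0,T]$. 2. (Conservation of wave action.) If $A$ is a solution in one of the spaces of 1 and $A_0\in L^1(0,\infty)$, then for all $t\ge0$, $A(t)\in L^1(0,\infty)$ and $\int_0^\infty A(t,p)\,dp=\int_0^\infty A_0(p)\,dp$. 3. (Growth of energy.) There is $\kappa>0$ such that, if $A$ is a solution in one of the spaces of 1 and $A_0\in L^1((0,\infty);p^2dp)$,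 then for all $t\ge0$, $A(t)\in L^1((0,\infty);p^2dp)$ and $\int_0^\infty A(t,p)p^2\,dp=e^{\kappa t}\int_0^\infty A_0(p)p^2\,dp$. 4. (Long time behaviour.) Let $-\frac52<b<-\frac34$, $\frac12<a<1$, let $A_0\in\mathscr Y_{a,b}$ be nonnegative and $A$ its solution in $\mathscr Y_{a,b}$. Then $A_0\in L^1(0,\infty)$, and for every bounded continuous $\varphi:[0,\infty)\to\mathbb R$ the integrals $\int_0^\infty A(t,p)\varphi(p)\,dp$ converge absolutely and $$\lim_{t\to\infty}\int_0^\infty A(t,p)\varphi(p)\,dp=\varphi(0)\int_0^\infty A_0(p)\,dp.$$ -/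

import Mathlib

open MeasureTheory Filter Topology Set
open scoped ENNReal

namespace LinearWKE

noncomputable section

/-- Lebesgue measure on the half line `(0, ∞)`. -/
def halfLine : Measure ℝ := volume.restrict (Ioi 0)

/-! ### The equation -/

/-- The singular Rayleigh-Jeans equilibrium `n⁰(p) = p⁻²`. -/
def n0 (p : ℝ) : ℝ := 1 / p ^ 2

/-- The momentum `p₂` fixed by energy conservation `p₁² + p₂² = p₃² + p₄²`, for `p₁ = 1`. -/
def pTwo (p₃ p₄ : ℝ) : ℝ := √(p₃ ^ 2 + p₄ ^ 2 - 1)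

/-- The constant `γ_N`: the coefficient of `A(p₁)` in the linearization of the collision integral
around `n⁰`,
`∬ (min {p₁, p₂, p₃, p₄} / p₁) (n⁰₃ n⁰₄ - n⁰₂ n⁰₃ - n⁰₂ n⁰₄) p₃ p₄ dp₃ dp₄`,
over `p₃, p₄ > 0`, `p₃² + p₄² > p₁²`. By homogeneity it does not depend on `p₁`, which is set
to `1`. -/
def gammaN : ℝ :=
  ∫ z in {z : ℝ × ℝ | 0 < z.1 ∧ 0 < z.2 ∧ 1 < z.1 ^ 2 + z.2 ^ 2},
    min 1 (min (pTwo z.1 z.2) (min z.1 z.2)) *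
      (n0 z.1 * n0 z.2 - n0 (pTwo z.1 z.2) * n0 z.1 - n0 (pTwo z.1 z.2) * n0 z.2) *
      (z.1 * z.2)

/-- The part of the kernel produced by the `A(p₂)` term. -/
def kernelR (p : ℝ) : ℝ :=
  if p < 1 then
    2 * Real.log p / (1 + p ^ 2)
      - 2 / (p * √(1 + p ^ 2)) * Real.artanh (p / √(1 + p ^ 2))
  else
    -(2 * Real.log p / (p * (1 + p ^ 2))
      + 2 / (p * √(1 + p ^ 2)) * Real.artanh (1 / √(1 + p ^ 2)))

/-- The part of the kernel produced by the `A(p₃)` and `A(p₄)` terms. -/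
def kernelS (p : ℝ) : ℝ :=
  if p < 1 then
    -(2 * Real.log p) / (1 - p ^ 2)
      + 2 / (p * √(1 - p ^ 2)) * Real.arctan (p / √(1 - p ^ 2))
  else
    2 * Real.log p / (p * (p ^ 2 - 1))
      + 2 / (p * √(p ^ 2 - 1)) * Real.arctan (1 / √(p ^ 2 - 1))

/-- The kernel `𝒱 = R + S` (its value at the singular point `p = 1` is irrelevant). -/
def kernelV (p : ℝ) : ℝ := kernelR p + kernelS p

/-! ### The function spaces -/

/-- The norm `(∫₀^∞ |f|^q p^(2θ-1) dp)^(1/q)` of `L^q_θ(0, ∞)`, with values in `[0, ∞]`. -/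
def normLq (q θ : ℝ) (f : ℝ → ℝ) : ℝ≥0∞ :=
  eLpNorm f (ENNReal.ofReal q)
    (halfLine.withDensity fun p => ENNReal.ofReal (p ^ (2 * θ - 1)))

/-- The norm `ess sup_{0<p<1} p^(-2a) |g(p)| + ess sup_{p>1} p^(-2b) |g(p)|` of `𝒴_{a,b}`,
with values in `[0, ∞]`. -/
def normY (a b : ℝ) (g : ℝ → ℝ) : ℝ≥0∞ :=
  eLpNorm (fun p => p ^ (-2 * a) * g p) ∞ (volume.restrict (Ioo 0 1)) +
    eLpNorm (fun p => p ^ (-2 * b) * g p) ∞ (volume.restrict (Ioi 1))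

/-- Membership in the space of measurable functions on `(0, ∞)` with finite norm `N`. -/
def MemSpace (N : (ℝ → ℝ) → ℝ≥0∞) (f : ℝ → ℝ) : Prop :=
  AEStronglyMeasurable f halfLine ∧ N f < ∞

/-- The admissible exponents of the spaces `𝒴_{a,b}`. -/
def AdmissibleY (a b : ℝ) : Prop :=
  -(5 / 2) < b ∧ b < -(3 / 4) ∧ 1 / 2 < a ∧ a < 1

/-- Nonnegativity almost everywhere on `(0, ∞)`. -/
def Nonneg (f : ℝ → ℝ) : Prop := ∀ᵐ p ∂halfLine, 0 ≤ f p

/-! ### Solutions -/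

/-- `A ∈ C([0, ∞); X) ∩ C¹((0, ∞); X)`, where `X` is the space with norm `N`, has `A(0) = A₀` and
satisfies `∂ₜ A(t, p) = γ_N A(t, p) + ∫₀^∞ 𝒱(p / p') A(t, p') dp' / p'` in `X` for all `t > 0`,
the integral being absolutely convergent for almost every `p`. -/
structure IsSolution (N : (ℝ → ℝ) → ℝ≥0∞) (A₀ : ℝ → ℝ) (A : ℝ → ℝ → ℝ) : Prop where
  mem : ∀ t, 0 ≤ t → MemSpace N (A t)
  init : A 0 =ᵐ[halfLine] A₀
  continuous : ∀ t, 0 ≤ t → Tendsto (fun s => N (A s - A t)) (𝓝[Ici 0] t) (𝓝 0)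
  equation : ∃ D : ℝ → ℝ → ℝ, ∀ t, 0 < t →
    MemSpace N (D t) ∧
    Tendsto (fun s => N ((s - t)⁻¹ • (A s - A t) - D t)) (𝓝[≠] t) (𝓝 0) ∧
    Tendsto (fun s => N (D s - D t)) (𝓝 t) (𝓝 0) ∧
    ∀ᵐ p ∂halfLine,
      Integrable (fun p' => kernelV (p / p') * A t p' / p') halfLine ∧
      D t p = gammaN * A t p + ∫ p', kernelV (p / p') * A t p' / p' ∂halfLine

/-- A solution in one of the spaces `L^q_θ` or `𝒴_{a,b}`. -/
def IsSolutionInSomeSpace (A₀ : ℝ → ℝ) (A : ℝ → ℝ → ℝ) : Prop :=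
  (∃ q θ : ℝ, 1 ≤ q ∧ θ ∈ Ioo (-1 : ℝ) (5 / 2) ∧ IsSolution (normLq q θ) A₀ A) ∨
  (∃ a b : ℝ, AdmissibleY a b ∧ IsSolution (normY a b) A₀ A)

/-- For every nonnegative initial datum in the space with norm `N` there is a nonnegative solution,
it is the only solution in that space, and on bounded time intervals it is bounded by the datum. -/
def WellPosed (N : (ℝ → ℝ) → ℝ≥0∞) : Prop :=
  (∀ A₀ : ℝ → ℝ, MemSpace N A₀ → Nonneg A₀ →
    ∃ A : ℝ → ℝ → ℝ, IsSolution N A₀ A ∧ (∀ t, 0 ≤ t → Nonneg (A t)) ∧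
      ∀ B : ℝ → ℝ → ℝ, IsSolution N A₀ B → ∀ t, 0 ≤ t → B t =ᵐ[halfLine] A t) ∧
  (∀ T : ℝ, 0 < T → ∃ C : ℝ, 0 < C ∧
    ∀ (A₀ : ℝ → ℝ) (A : ℝ → ℝ → ℝ), Nonneg A₀ → IsSolution N A₀ A →
      ∀ t ∈ Icc 0 T, N (A t) ≤ ENNReal.ofReal C * N A₀)

end

end LinearWKE

open LinearWKE

namespace LinearWKE

noncomputable section

/-! ### Pointwise properties of the kernel -/

/-! Write `U f(p) = ∫ 𝒱(p/q) f(q) dq/q`. This operator commutes with dilations, so everything is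
governed by the Mellin moments `m(c) = ∫ 𝒱(s) s^(c-1) ds` (`kernelMoment`). Three facts about the
kernel carry the argument: `𝒱 > 0` away from `1`; `𝒱(p) = O(p^(2-ε))` at the origin, with only an
inverse square root singularity at `1`; and `𝒱(p) = p⁻³ 𝒱(1/p)`. Hence `m(c)` is finite for `-2 < c
< 5` and `m(3 - c) = m(c)`.

In these terms `U` sends `p^r` to `m(-r) p^r`, and it multiplies the moment `∫ f p^(c-1) dp` by
`m(c)`. A Schur test with power weights bounds `U` on `L^q_θ` by `m(2θ/q)`, and comparison with
powers bounds it on `𝒴_{a,b}` (`functionNorm_lq`, `functionNorm_y`). So (E) is a linear ODE with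
bounded generator `γ_N + U`. Its solution is `e^(γ_N t) ∑ tⁿ/n! Uⁿ A₀`, which is nonnegative for
nonnegative data. A Grönwall argument gives the growth bound `e^((γ_N + C) t)` and uniqueness. These
steps use only the properties collected in `FunctionNorm`.

The series does not depend on the function space, so a finite moment of order `c` evolves by the
factor `e^((γ_N + m(c)) t)` (`moment_isSolution`). The decisive identity is `γ_N = -m(1)`: the
integral defining `-γ_N` equals `½ ∫ S` when sliced along `p₃` and `-∫ R` when sliced along `p₂`,
hence it equals `∫ R + ∫ S = ∫ 𝒱`. The order `c = 1` is therefore conserved. Convexity of `c ↦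
s^(c-1)` together with the symmetry about `3/2` gives `m(3) > m(1) > m(3/2)`: the energy grows at
rate `m(3) - m(1)`, while the moment of order `3/2` decays. Constant mass and a vanishing moment of
order `3/2` force the mass to concentrate at `p = 0`. -/

theorem measurable_artanh : Measurable Real.artanh := by
  unfold Real.artanh
  fun_prop

theorem measurable_kernelR : Measurable kernelR := by
  have := measurable_artanh
  unfold kernelR
  refine Measurable.ite measurableSet_Iio ?_ ?_
  · exact Measurable.sub (by fun_prop)
      (Measurable.mul (by fun_prop) (measurable_artanh.comp (by fun_prop)))
  · exact Measurable.neg (Measurable.add (by fun_prop)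
      (Measurable.mul (by fun_prop) (measurable_artanh.comp (by fun_prop))))

theorem measurable_kernelS : Measurable kernelS := by
  unfold kernelS
  refine Measurable.ite measurableSet_Iio ?_ ?_ <;> fun_prop

theorem measurable_kernelV : Measurable kernelV := measurable_kernelR.add measurable_kernelS

theorem sqrt_one_add_inv_sq {p : ℝ} (hp : 0 < p) : √(1 + p⁻¹ ^ 2) = √(1 + p ^ 2) / p := by
  rw [Real.sqrt_eq_iff_mul_self_eq (by positivity) (by positivity), div_mul_div_comm,
    Real.mul_self_sqrt (by positivity)]
  field_simp
  ring

theorem sqrt_one_sub_inv_sq {p : ℝ} (hp : 1 < p) : √(1 - p⁻¹ ^ 2) = √(p ^ 2 - 1) / p := by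
  have h1 : p⁻¹ < 1 := inv_lt_one_of_one_lt₀ hp
  have h0 : 0 < p⁻¹ := by positivity
  rw [Real.sqrt_eq_iff_mul_self_eq (by nlinarith) (by positivity), div_mul_div_comm,
    Real.mul_self_sqrt (by nlinarith)]
  field_simp

theorem kernelR_eq_inv {p : ℝ} (hp : 1 < p) : kernelR p = p ^ (-3 : ℝ) * kernelR p⁻¹ := by
  have h0 : 0 < p := by linarith
  have h1 : p⁻¹ < 1 := inv_lt_one_of_one_lt₀ hp
  have hs : 0 < √(1 + p ^ 2) := by positivity
  rw [kernelR, kernelR, if_neg (by linarith), if_pos h1, sqrt_one_add_inv_sq h0, Real.log_inv,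
    show p⁻¹ / (√(1 + p ^ 2) / p) = 1 / √(1 + p ^ 2) by field_simp,
    show (-3 : ℝ) = ((-3 : ℤ) : ℝ) by norm_num, Real.rpow_intCast]
  have : 1 + p⁻¹ ^ 2 = (1 + p ^ 2) / p ^ 2 := by field_simp; ring
  rw [this]
  field_simp
  ring

theorem kernelS_eq_inv {p : ℝ} (hp : 1 < p) : kernelS p = p ^ (-3 : ℝ) * kernelS p⁻¹ := by
  have h0 : 0 < p := by linarith
  have h1 : p⁻¹ < 1 := inv_lt_one_of_one_lt₀ hp
  have h2 : 0 < p ^ 2 - 1 := by nlinarith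
  have hs : 0 < √(p ^ 2 - 1) := by positivity
  rw [kernelS, kernelS, if_neg (by linarith), if_pos h1, sqrt_one_sub_inv_sq hp, Real.log_inv,
    show p⁻¹ / (√(p ^ 2 - 1) / p) = 1 / √(p ^ 2 - 1) by field_simp,
    show (-3 : ℝ) = ((-3 : ℤ) : ℝ) by norm_num, Real.rpow_intCast]
  have : 1 - p⁻¹ ^ 2 = (p ^ 2 - 1) / p ^ 2 := by field_simp
  rw [this]
  field_simp

/-- Reduces every estimate to `(0, 1)` and is the source of the symmetry `c ↔ 3 - c` of the moments.
-/
theorem kernelV_eq_inv {p : ℝ} (hp : 1 < p) : kernelV p = p ^ (-3 : ℝ) * kernelV p⁻¹ := by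
  rw [kernelV, kernelV, kernelR_eq_inv hp, kernelS_eq_inv hp]
  ring

theorem artanh_div_sqrt_eq_arsinh (p : ℝ) :
    Real.artanh (p / √(1 + p ^ 2)) = Real.arsinh p := by
  have h : Real.tanh (Real.arsinh p) = p / √(1 + p ^ 2) := by
    rw [Real.tanh_eq_sinh_div_cosh, Real.sinh_arsinh, Real.cosh_arsinh]
  rw [← h, Real.artanh_tanh]

theorem arsinh_le_self {p : ℝ} (hp : 0 ≤ p) : Real.arsinh p ≤ p := by
  rw [← Real.sinh_le_sinh, Real.sinh_arsinh]
  exact Real.self_le_sinh_iff.2 hp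

/-- On `(0, 1)` the kernel is the sum of two manifestly nonnegative terms. -/
theorem kernelV_eq_of_lt_one {p : ℝ} (hp : 0 < p) (hp1 : p < 1) :
    kernelV p = 4 * p ^ 2 * (-Real.log p / (1 - p ^ 4)) +
      2 / p * (Real.arcsin p / √(1 - p ^ 2) - Real.arsinh p / √(1 + p ^ 2)) := by
  have h2 : 0 < 1 - p ^ 2 := by nlinarith
  have hs : 0 < √(1 - p ^ 2) := by positivity
  have hs' : 0 < √(1 + p ^ 2) := by positivity
  rw [kernelV, kernelR, kernelS, if_pos hp1, if_pos hp1, artanh_div_sqrt_eq_arsinh,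
    Real.arcsin_eq_arctan ⟨by linarith, hp1⟩,
    show 1 - p ^ 4 = (1 - p ^ 2) * (1 + p ^ 2) by ring]
  field_simp
  ring

theorem one_add_half_sq_le_inv_sqrt {p : ℝ} (hp : 0 < p) (hp1 : p < 1) :
    1 + p ^ 2 / 2 ≤ (√(1 - p ^ 2))⁻¹ := by
  have h2 : 0 < 1 - p ^ 2 := by nlinarith
  rw [le_inv_comm₀ (by positivity) (by positivity)]
  refine Real.sqrt_le_sqrt_iff (by positivity) |>.2 ?_ |>.trans (Real.sqrt_sq (by positivity)).le
  rw [inv_pow, le_inv_comm₀ h2 (by positivity), ← one_div, le_div_iff₀ h2]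
  -- With `x = p²`, `(1 - x)(1 + x/2)² = 1 - 3x²/4 - x³/4`.
  nlinarith [pow_pos hp 4, pow_pos hp 6]

/-- Each of the two terms of the decomposition contributes `p²`: the first since `-log p ≥ 1 - p ≥
(1 - p⁴)/4`, the second since the arcsine quotient is at least `p + p³/2` and the arsinh quotient at
most `p`. Besides positivity, the constant `2` matters: it yields `m(0) ≥ 1`. -/
theorem le_kernelV {p : ℝ} (hp : 0 < p) (hp1 : p < 1) : 2 * p ^ 2 ≤ kernelV p := by
  have h2 : 0 < 1 - p ^ 2 := by nlinarith
  have h4 : 0 < 1 - p ^ 4 := by nlinarith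
  have hs : 0 < √(1 - p ^ 2) := by positivity
  have hs' : 1 ≤ √(1 + p ^ 2) := by rw [Real.one_le_sqrt]; nlinarith
  have hlog : 1 / 4 ≤ -Real.log p / (1 - p ^ 4) := by
    rw [le_div_iff₀ h4]
    have := Real.log_le_sub_one_of_pos hp
    nlinarith [pow_pos hp 3, mul_pos hp hp, pow_pos hp 2, mul_pos (pow_pos hp 3) (sub_pos.2 hp1),
      mul_pos (pow_pos hp 2) (sub_pos.2 hp1), mul_pos (pow_pos hp 1) (sub_pos.2 hp1)]
  have harc : p * (1 + p ^ 2 / 2) ≤ Real.arcsin p / √(1 - p ^ 2) := by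
    rw [div_eq_mul_inv]
    refine mul_le_mul ?_ (one_add_half_sq_le_inv_sqrt hp hp1) (by positivity)
      (Real.arcsin_nonneg.2 hp.le)
    have := Real.sin_le (Real.arcsin_nonneg.2 hp.le)
    rwa [Real.sin_arcsin (by linarith) hp1.le] at this
  have hars : Real.arsinh p / √(1 + p ^ 2) ≤ p :=
    (div_le_self (Real.arsinh_nonneg_iff.2 hp.le) hs').trans (arsinh_le_self hp.le)
  rw [kernelV_eq_of_lt_one hp hp1]
  have : p ^ 2 ≤ 2 / p * (Real.arcsin p / √(1 - p ^ 2) - Real.arsinh p / √(1 + p ^ 2)) := by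
    calc p ^ 2 = 2 / p * (p * (1 + p ^ 2 / 2) - p) := by field_simp; ring
      _ ≤ _ := by gcongr
  nlinarith [mul_le_mul_of_nonneg_left hlog (show 0 ≤ 4 * p ^ 2 by positivity)]

theorem kernelV_pos {p : ℝ} (hp : 0 < p) (hp1 : p ≠ 1) : 0 < kernelV p := by
  rcases lt_or_gt_of_ne hp1 with h | h
  · exact lt_of_lt_of_le (by positivity) (le_kernelV hp h)
  · rw [kernelV_eq_inv h]
    have := le_kernelV (inv_pos.2 hp) (inv_lt_one_of_one_lt₀ h)
    have h3 : 0 < 2 * p⁻¹ ^ 2 := by positivity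
    have h4 : 0 < kernelV p⁻¹ := by linarith
    positivity

theorem le_artanh {x : ℝ} (h0 : 0 ≤ x) (h1 : x < 1) : x ≤ Real.artanh x := by
  have h := Real.hasSum_log_sub_log_of_abs_lt_one (x := x) (by rw [abs_lt]; constructor <;> linarith)
  -- All terms of the power series of `log (1 + x) - log (1 - x)` are nonnegative; only the first is
  -- kept.
  have h2 := sum_le_hasSum {0} (fun i _ => by positivity) h
  rw [Real.artanh_eq_half_log ⟨by linarith, h1.le⟩, Real.log_div (by linarith) (by linarith)]
  simp at h2
  linarith

theorem div_one_add_sq_le_arsinh_div {p : ℝ} (hp : 0 ≤ p) :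
    p / (1 + p ^ 2) ≤ Real.arsinh p / √(1 + p ^ 2) := by
  have hs : 0 < √(1 + p ^ 2) := by positivity
  have h : p / √(1 + p ^ 2) ≤ Real.arsinh p := by
    rw [← artanh_div_sqrt_eq_arsinh]
    refine le_artanh (by positivity) ?_
    rw [div_lt_one hs]
    exact Real.lt_sqrt_of_sq_lt (by linarith)
  calc p / (1 + p ^ 2) = p / √(1 + p ^ 2) / √(1 + p ^ 2) := by
        rw [div_div, Real.mul_self_sqrt (by positivity)]
    _ ≤ _ := by gcongr

theorem arctan_le_self {x : ℝ} (hx : 0 ≤ x) : Real.arctan x ≤ x := by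
  have := Real.le_tan (Real.arctan_nonneg.2 hx) (Real.arctan_lt_pi_div_two x)
  rwa [Real.tan_arctan] at this

/-- The arcsine and arsinh quotients agree to first order in `p`, so their difference is `O(p³)` and
the whole kernel is `O(p² |log p|)`. The logarithm is absorbed into `p^(-ε)`. -/
theorem kernelV_le_of_le_half {p ε : ℝ} (hp : 0 < p) (hp1 : p ≤ 1 / 2) (hε : 0 < ε) :
    kernelV p ≤ (8 / ε + 8) * p ^ (2 - ε) := by
  have h2 : 0 < 1 - p ^ 2 := by nlinarith
  have h4 : 1 / 2 ≤ 1 - p ^ 4 := by nlinarith [sq_nonneg p]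
  have hlog : -Real.log p ≤ p ^ (-ε) / ε := by
    have := Real.log_le_rpow_div (inv_nonneg.2 hp.le) hε
    rwa [Real.log_inv, Real.inv_rpow hp.le, ← Real.rpow_neg hp.le] at this
  have hpe : p ^ (2 - ε) = p ^ 2 * p ^ (-ε) := by
    rw [sub_eq_add_neg, Real.rpow_add hp, Real.rpow_ofNat]
  have hp2 : p ^ 2 ≤ p ^ (2 - ε) := by
    rw [← Real.rpow_ofNat]
    exact Real.rpow_le_rpow_of_exponent_ge hp (by linarith) (by linarith)
  have h1 : 4 * p ^ 2 * (-Real.log p / (1 - p ^ 4)) ≤ 8 / ε * p ^ (2 - ε) := by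
    have hl : 0 ≤ -Real.log p := neg_nonneg.2 (Real.log_nonpos hp.le (by linarith))
    calc 4 * p ^ 2 * (-Real.log p / (1 - p ^ 4)) ≤ 4 * p ^ 2 * (p ^ (-ε) / ε / (1 / 2)) := by
          gcongr
      _ = 8 / ε * p ^ (2 - ε) := by rw [hpe]; ring
  have harc : Real.arcsin p / √(1 - p ^ 2) ≤ p / (1 - p ^ 2) := by
    calc Real.arcsin p / √(1 - p ^ 2) ≤ p / √(1 - p ^ 2) / √(1 - p ^ 2) := by
          gcongr
          rw [Real.arcsin_eq_arctan ⟨by linarith, by linarith⟩]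
          exact arctan_le_self (by positivity)
      _ = _ := by rw [div_div, Real.mul_self_sqrt h2.le]
  have h3 : 2 / p * (Real.arcsin p / √(1 - p ^ 2) - Real.arsinh p / √(1 + p ^ 2)) ≤ 8 * p ^ 2 := by
    calc _ ≤ 2 / p * (p / (1 - p ^ 2) - p / (1 + p ^ 2)) := by
          refine mul_le_mul_of_nonneg_left (sub_le_sub harc ?_) (by positivity)
          exact div_one_add_sq_le_arsinh_div hp.le
      _ = 4 * p ^ 2 / (1 - p ^ 4) := by
          rw [show 1 - p ^ 4 = (1 - p ^ 2) * (1 + p ^ 2) by ring]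
          field_simp
          ring
      _ ≤ 4 * p ^ 2 / (1 / 2) := by gcongr
      _ = _ := by ring
  rw [kernelV_eq_of_lt_one hp (by linarith)]
  linarith

/-- Near `1` the quotient `-log p / (1 - p⁴)` stays bounded; the singularity comes only from the
factor `1/√(1 - p²)`. -/
theorem kernelV_le_of_half_le {p : ℝ} (hp : 1 / 2 ≤ p) (hp1 : p < 1) :
    kernelV p ≤ 16 * (1 - p) ^ (-(1 / 2) : ℝ) := by
  have h0 : 0 < p := by linarith
  have h2 : 1 - p ≤ 1 - p ^ 2 := by nlinarith
  have h4 : 1 - p ≤ 1 - p ^ 4 := by nlinarith [mul_pos h0 h0, pow_pos h0 3]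
  have hp' : 0 < 1 - p := by linarith
  have hone : 1 ≤ (1 - p) ^ (-(1 / 2) : ℝ) :=
    Real.one_le_rpow_of_pos_of_le_one_of_nonpos hp' (by linarith) (by norm_num)
  have hlog : -Real.log p / (1 - p ^ 4) ≤ 2 := by
    rw [div_le_iff₀ (by linarith)]
    have := Real.log_le_sub_one_of_pos (inv_pos.2 h0)
    rw [Real.log_inv] at this
    have h5 : p⁻¹ - 1 ≤ 2 * (1 - p) := by
      rw [sub_le_iff_le_add, inv_le_iff_one_le_mul₀ h0]
      nlinarith
    linarith
  have h1 : 4 * p ^ 2 * (-Real.log p / (1 - p ^ 4)) ≤ 8 := by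
    calc _ ≤ 4 * p ^ 2 * 2 := by gcongr
      _ ≤ 8 := by nlinarith
  have h3 : 2 / p * (Real.arcsin p / √(1 - p ^ 2) - Real.arsinh p / √(1 + p ^ 2))
      ≤ 8 * (1 - p) ^ (-(1 / 2) : ℝ) := by
    have ha : Real.arcsin p ≤ 2 := (Real.arcsin_le_pi_div_two p).trans (by
      have := Real.pi_le_four; linarith)
    calc _ ≤ 2 / (1 / 2) * (2 / √(1 - p) - 0) := by
          have : 0 ≤ Real.arsinh p / √(1 + p ^ 2) :=
            div_nonneg (Real.arsinh_nonneg_iff.2 h0.le) (by positivity)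
          have h6 : Real.arcsin p / √(1 - p ^ 2) ≤ 2 / √(1 - p) := by gcongr
          refine (mul_le_mul_of_nonneg_left (sub_le_sub h6 this) (by positivity)).trans ?_
          gcongr
          rw [sub_zero]
          positivity
      _ = _ := by
          rw [Real.rpow_neg hp'.le, ← Real.sqrt_eq_rpow]
          ring
  rw [kernelV_eq_of_lt_one h0 hp1]
  linarith

theorem neg_kernelR_nonneg {p : ℝ} (hp : 0 < p) : 0 ≤ -kernelR p := by
  rw [kernelR]
  split_ifs with h
  · have h1 : Real.log p ≤ 0 := Real.log_nonpos hp.le h.le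
    have h2 : 0 ≤ Real.artanh (p / √(1 + p ^ 2)) := Real.artanh_nonneg (by positivity)
    have h3 : 2 * Real.log p / (1 + p ^ 2) ≤ 0 :=
      div_nonpos_of_nonpos_of_nonneg (by linarith) (by positivity)
    have : 0 ≤ 2 / (p * √(1 + p ^ 2)) * Real.artanh (p / √(1 + p ^ 2)) := by positivity
    linarith
  · have h1 : 0 ≤ Real.log p := Real.log_nonneg (by linarith)
    have h2 : 0 ≤ Real.artanh (1 / √(1 + p ^ 2)) := Real.artanh_nonneg (by positivity)
    rw [neg_neg]
    positivity

/-- Taken alone, `R` loses the cancellation with `S` and is logarithmically large at the origin. An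
integrable power is all that is needed to split `∫ 𝒱` as `∫ R + ∫ S`. -/
theorem neg_kernelR_le {p : ℝ} (hp : 0 < p) (hp1 : p < 1) :
    -kernelR p ≤ 6 * p ^ (-(1 / 2) : ℝ) := by
  have hlog : -Real.log p ≤ 2 * p ^ (-(1 / 2) : ℝ) := by
    have := Real.log_le_rpow_div (inv_nonneg.2 hp.le) (ε := 1 / 2) (by norm_num)
    rw [Real.log_inv, Real.inv_rpow hp.le, ← Real.rpow_neg hp.le] at this
    linarith
  have hone : 1 ≤ p ^ (-(1 / 2) : ℝ) :=
    Real.one_le_rpow_of_pos_of_le_one_of_nonpos hp hp1.le (by norm_num)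
  have hs' : 1 ≤ √(1 + p ^ 2) := by rw [Real.one_le_sqrt]; nlinarith
  have hl : 0 ≤ -Real.log p := neg_nonneg.2 (Real.log_nonpos hp.le hp1.le)
  rw [kernelR, if_pos hp1, artanh_div_sqrt_eq_arsinh]
  have h1 : 2 * -Real.log p / (1 + p ^ 2) ≤ 2 * -Real.log p :=
    div_le_self (by positivity) (by nlinarith)
  have h2 : 2 / (p * √(1 + p ^ 2)) * Real.arsinh p ≤ 2 := by
    calc _ ≤ 2 / (p * 1) * p := by
          have := arsinh_le_self hp.le
          have := Real.arsinh_nonneg_iff.2 hp.le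
          gcongr
      _ = 2 := by field_simp
  rw [mul_neg, neg_div] at h1
  linarith

/-! ### Changes of variables on the half line -/

theorem lintegral_halfLine_div {a : ℝ} (ha : 0 < a) (f : ℝ → ℝ≥0∞) :
    ∫⁻ x, f (x / a) ∂halfLine = ENNReal.ofReal a * ∫⁻ x, f x ∂halfLine := by
  have himg : (fun x : ℝ => a * x) '' Ioi 0 = Ioi 0 := by
    rw [image_mul_left_Ioi ha, mul_zero]
  have h := lintegral_image_eq_lintegral_abs_deriv_mul (f := fun x : ℝ => a * x) (f' := fun _ => a)
    (s := Ioi 0) measurableSet_Ioi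
    (fun x _ => by simpa using ((hasDerivAt_id x).const_mul a).hasDerivWithinAt)
    (fun x _ y _ hxy => mul_left_cancel₀ ha.ne' hxy) (fun x => f (x / a))
  rw [himg] at h
  rw [halfLine, h, ← lintegral_const_mul' _ _ ENNReal.ofReal_ne_top]
  refine lintegral_congr fun x => ?_
  rw [abs_of_pos ha, mul_div_cancel_left₀ _ ha.ne']

theorem setLIntegral_inv {s : Set ℝ} (hs : MeasurableSet s) (h0 : s ⊆ Ioi 0) (f : ℝ → ℝ≥0∞) :
    ∫⁻ x in s⁻¹, f x = ∫⁻ x in s, ENNReal.ofReal (x ^ (-2 : ℝ)) * f x⁻¹ := by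
  have h := lintegral_image_eq_lintegral_abs_deriv_mul (f := fun x : ℝ => x⁻¹)
    (f' := fun x => -(x ^ 2)⁻¹) hs
    (fun x hx => (hasDerivAt_inv (ne_of_gt (h0 hx))).hasDerivWithinAt)
    (fun x _ y _ hxy => inv_injective hxy) f
  rw [image_inv_eq_inv] at h
  rw [h]
  refine setLIntegral_congr_fun hs fun x hx => ?_
  have : (0 : ℝ) < x := h0 hx
  rw [abs_neg, abs_of_pos (by positivity), Real.rpow_neg this.le, Real.rpow_ofNat]

theorem inv_Ioi_zero : (Ioi (0 : ℝ))⁻¹ = Ioi 0 := by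
  ext x
  simp

theorem inv_Ioo_zero_one : (Ioo (0 : ℝ) 1)⁻¹ = Ioi 1 := by
  ext x
  simp only [Set.mem_inv, mem_Ioo, inv_pos, mem_Ioi]
  refine ⟨fun h => (inv_lt_one₀ h.1).1 h.2, fun h => ?_⟩
  have h0 : 0 < x := by linarith
  exact ⟨h0, (inv_lt_one₀ h0).2 h⟩

/-- The measure `dx/x` is invariant under `x ↦ p/x`, an inversion followed by a dilation. This makes
the integral operator a multiplicative convolution. -/
theorem lintegral_halfLine_const_div {p : ℝ} (hp : 0 < p) (f : ℝ → ℝ≥0∞) :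
    ∫⁻ x, ENNReal.ofReal x⁻¹ * f (p / x) ∂halfLine
      = ∫⁻ x, ENNReal.ofReal x⁻¹ * f x ∂halfLine := by
  have h1 : ∫⁻ x, ENNReal.ofReal x⁻¹ * f (p / x) ∂halfLine
      = ∫⁻ x, ENNReal.ofReal x⁻¹ * f (x / p⁻¹) ∂halfLine := by
    have := setLIntegral_inv measurableSet_Ioi (le_refl (Ioi (0 : ℝ)))
      (fun x => ENNReal.ofReal x⁻¹ * f (p / x))
    rw [inv_Ioi_zero] at this
    rw [halfLine, this]
    refine setLIntegral_congr_fun measurableSet_Ioi fun x (hx : 0 < x) => ?_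
    simp only [div_inv_eq_mul, inv_inv]
    rw [← mul_assoc, ← ENNReal.ofReal_mul (by positivity), Real.rpow_neg hx.le, Real.rpow_ofNat,
      mul_comm p x]
    congr 2
    field_simp
  have h2 := lintegral_halfLine_div (inv_pos.2 hp) (fun x => ENNReal.ofReal (x * p⁻¹)⁻¹ * f x)
  rw [h1]
  calc _ = _ := ?_
    _ = _ := h2
    _ = _ := ?_
  · refine lintegral_congr fun x => ?_
    rw [div_mul_cancel₀ _ (by positivity)]
  · rw [← lintegral_const_mul' _ _ ENNReal.ofReal_ne_top]
    refine lintegral_congr fun x => ?_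
    rw [← mul_assoc, ← ENNReal.ofReal_mul (by positivity)]
    congr 2
    field_simp

/-! ### Mellin moments of the kernel -/

theorem setLIntegral_Ioi_one_eq {f : ℝ → ℝ} (hf : ∀ p, 1 < p → f p = p ^ (-3 : ℝ) * f p⁻¹) (c : ℝ) :
    ∫⁻ s in Ioi 1, ‖f s * s ^ (c - 1)‖ₑ = ∫⁻ s in Ioo 0 1, ‖f s * s ^ (3 - c - 1)‖ₑ := by
  rw [← inv_Ioo_zero_one, setLIntegral_inv measurableSet_Ioo fun x hx => hx.1]
  refine setLIntegral_congr_fun measurableSet_Ioo fun x hx => ?_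
  obtain ⟨h0, h1⟩ := hx
  -- The exponents `-2`, `3` and `-(c - 1)` come from the Jacobian, the inversion law and the
  -- weight.
  rw [hf x⁻¹ ((one_lt_inv₀ h0).2 h1), inv_inv, ← Real.enorm_of_nonneg (by positivity), ← enorm_mul,
    Real.inv_rpow h0.le, Real.inv_rpow h0.le, ← Real.rpow_neg h0.le, ← Real.rpow_neg h0.le,
    show 3 - c - 1 = -2 + - -3 + -(c - 1) by ring, Real.rpow_add h0, Real.rpow_add h0]
  congr 1
  ring

theorem lintegral_halfLine_eq_add (f : ℝ → ℝ≥0∞) :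
    ∫⁻ s, f s ∂halfLine = (∫⁻ s in Ioo 0 1, f s) + ∫⁻ s in Ioi 1, f s := by
  have h1 : (Ioi (0 : ℝ)) = Ioc 0 1 ∪ Ioi 1 := (Ioc_union_Ioi_eq_Ioi zero_le_one).symm
  rw [halfLine, h1, lintegral_union measurableSet_Ioi
    (Set.disjoint_left.2 fun x hx hx' => not_lt.2 hx.2 hx'), setLIntegral_congr Ioo_ae_eq_Ioc.symm]

theorem lintegral_halfLine_mellin_eq {f : ℝ → ℝ}
    (hf : ∀ p, 1 < p → f p = p ^ (-3 : ℝ) * f p⁻¹) (c : ℝ) :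
    ∫⁻ s, ‖f s * s ^ (c - 1)‖ₑ ∂halfLine = (∫⁻ s in Ioo 0 1, ‖f s * s ^ (c - 1)‖ₑ) +
      ∫⁻ s in Ioo 0 1, ‖f s * s ^ (3 - c - 1)‖ₑ := by
  rw [lintegral_halfLine_eq_add, setLIntegral_Ioi_one_eq hf]

theorem integrableOn_kernelV_mul_rpow {c : ℝ} (hc : -2 < c) :
    IntegrableOn (fun s => kernelV s * s ^ (c - 1)) (Ioo 0 1) := by
  have hm : Measurable fun s => kernelV s * s ^ (c - 1) := measurable_kernelV.mul (by fun_prop)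
  rw [← Ioc_union_Ioo_eq_Ioo (show (0 : ℝ) < 1 / 2 by norm_num).le (show (1 / 2 : ℝ) < 1 by norm_num)]
  refine IntegrableOn.union ?_ ?_
  -- This choice makes the total exponent `2 - ε + (c - 1)` equal to `c/2 > -1`.
  · set ε := (c + 2) / 2 with hε
    have hi : IntegrableOn (fun s : ℝ => (8 / ε + 8) * s ^ (2 - ε + (c - 1))) (Ioc 0 (1 / 2)) := by
      refine Integrable.const_mul ?_ _
      have := intervalIntegral.intervalIntegrable_rpow' (a := 0) (b := 1 / 2)
        (r := 2 - ε + (c - 1)) (by rw [hε]; linarith)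
      rwa [intervalIntegrable_iff_integrableOn_Ioc_of_le (by norm_num)] at this
    refine Integrable.mono' hi hm.aestronglyMeasurable ?_
    refine (ae_restrict_mem measurableSet_Ioc).mono fun s hs => ?_
    have h0 := kernelV_pos hs.1 (by linarith [hs.2])
    have hsp := hs.1
    rw [Real.norm_of_nonneg (by positivity), Real.rpow_add hs.1, ← mul_assoc]
    gcongr
    exact kernelV_le_of_le_half hs.1 hs.2 (by rw [hε]; linarith)
  · set K := max ((1 / 2 : ℝ) ^ (c - 1)) 1
    have hi : IntegrableOn (fun s : ℝ => 16 * (1 - s) ^ (-(1 / 2) : ℝ) * K) (Ioo (1 / 2) 1) := by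
      refine Integrable.mul_const (Integrable.const_mul ?_ _) _
      have h1 := intervalIntegral.intervalIntegrable_rpow' (a := 0) (b := 1 / 2)
        (r := -(1 / 2)) (by norm_num)
      have h2 := (h1.comp_sub_left 1)
      norm_num at h2
      have h3 := h2.symm
      rw [intervalIntegrable_iff_integrableOn_Ioo_of_le (by norm_num)] at h3
      simpa [IntegrableOn] using h3
    refine Integrable.mono' hi hm.aestronglyMeasurable ?_
    refine (ae_restrict_mem measurableSet_Ioo).mono fun s hs => ?_
    have hsp : 0 < s := by linarith [hs.1]
    have h0 := kernelV_pos hsp hs.2.ne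
    rw [Real.norm_of_nonneg (by positivity)]
    have hK : s ^ (c - 1) ≤ K := by
      rcases le_total 0 (c - 1) with h | h
      · exact (Real.rpow_le_one hsp.le hs.2.le h).trans (le_max_right _ _)
      · exact (Real.rpow_le_rpow_of_nonpos (by norm_num) hs.1.le h).trans (le_max_left _ _)
    have := kernelV_le_of_half_le hs.1.le hs.2
    have := Real.rpow_nonneg (sub_nonneg.2 hs.2.le) (-(1 / 2))
    gcongr

/-- By the inversion law the part over `s > 1` is the moment of order `3 - c` over `(0, 1)`, so the
strip is the reflection-invariant one. The range `(-1, 5/2)` of `θ` is this strip for `c = 2θ`. -/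
theorem integrable_kernelV_mul_rpow {c : ℝ} (hc : -2 < c) (hc' : c < 5) :
    Integrable (fun s => kernelV s * s ^ (c - 1)) halfLine := by
  have hm : Measurable fun s => kernelV s * s ^ (c - 1) := measurable_kernelV.mul (by fun_prop)
  refine ⟨hm.aestronglyMeasurable, ?_⟩
  rw [HasFiniteIntegral, lintegral_halfLine_mellin_eq fun p => kernelV_eq_inv]
  exact ENNReal.add_lt_top.2 ⟨(integrableOn_kernelV_mul_rpow hc).2,
    (integrableOn_kernelV_mul_rpow (by linarith)).2⟩

theorem integrable_kernelR : Integrable kernelR halfLine := by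
  refine ⟨measurable_kernelR.aestronglyMeasurable, ?_⟩
  have h := lintegral_halfLine_mellin_eq (fun p => kernelR_eq_inv) 1
  simp only [sub_self, Real.rpow_zero, mul_one] at h
  have hle : ∀ᵐ s ∂(volume.restrict (Ioo (0 : ℝ) 1)), ‖kernelR s‖ ≤ 6 * s ^ (-(1 / 2) : ℝ) := by
    refine (ae_restrict_mem measurableSet_Ioo).mono fun s hs => ?_
    rw [← norm_neg, Real.norm_of_nonneg (neg_kernelR_nonneg hs.1)]
    exact neg_kernelR_le hs.1 hs.2
  have hi : IntegrableOn (fun s : ℝ => 6 * s ^ (-(1 / 2) : ℝ)) (Ioo 0 1) := by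
    refine Integrable.const_mul ?_ _
    have := intervalIntegral.intervalIntegrable_rpow' (a := 0) (b := 1)
      (r := -(1 / 2)) (by norm_num)
    rwa [intervalIntegrable_iff_integrableOn_Ioo_of_le (by norm_num)] at this
  have hi' := Integrable.mono' hi measurable_kernelR.aestronglyMeasurable hle
  rw [HasFiniteIntegral, h]
  refine ENNReal.add_lt_top.2 ⟨hi'.2, ?_⟩
  -- For `c = 1` the reflected weight is `s^(3 - 1 - 1) = s ≤ 1`, so the part over `s > 1` is
  -- dominated by the part over `(0, 1)`.
  refine lt_of_le_of_lt ?_ hi'.2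
  refine setLIntegral_mono' measurableSet_Ioo fun s hs => ?_
  rw [enorm_mul]
  refine mul_le_of_le_one_right' ?_
  rw [Real.enorm_of_nonneg (Real.rpow_nonneg hs.1.le _), ENNReal.ofReal_le_one]
  exact Real.rpow_le_one hs.1.le hs.2.le (by norm_num)

/-! ### Evaluation of `γ_N` -/

/-- A nonnegative derivative of a function continuous up to the endpoints is integrable, so
integrands singular at an endpoint are covered. -/
theorem lintegral_Ioo_of_hasDerivAt {F f : ℝ → ℝ} {a b : ℝ} (hab : a ≤ b)
    (hc : ContinuousOn F (Icc a b)) (hd : ∀ x ∈ Ioo a b, HasDerivAt F (f x) x)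
    (hf : ∀ x ∈ Ioo a b, 0 ≤ f x) :
    ∫⁻ x in Ioo a b, ENNReal.ofReal (f x) = ENNReal.ofReal (F b - F a) := by
  have hi : IntegrableOn f (Ioc a b) := intervalIntegral.integrableOn_deriv_of_nonneg hc hd hf
  have h := intervalIntegral.integral_eq_sub_of_hasDerivAt_of_le hab hc hd
    ((intervalIntegrable_iff_integrableOn_Ioc_of_le hab).2 hi)
  rw [← h, intervalIntegral.integral_of_le hab, integral_Ioc_eq_integral_Ioo,
    ofReal_integral_eq_lintegral_ofReal (hi.mono_set Ioo_subset_Ioc_self)]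
  exact (ae_restrict_mem measurableSet_Ioo).mono hf

theorem lintegral_Ioi_of_hasDerivAt {F f : ℝ → ℝ} {a l : ℝ}
    (hc : ContinuousWithinAt F (Ici a) a) (hd : ∀ x ∈ Ioi a, HasDerivAt F (f x) x)
    (hf : ∀ x ∈ Ioi a, 0 ≤ f x) (hl : Tendsto F atTop (𝓝 l)) :
    ∫⁻ x in Ioi a, ENNReal.ofReal (f x) = ENNReal.ofReal (l - F a) := by
  have hi : IntegrableOn f (Ioi a) := integrableOn_Ioi_deriv_of_nonneg hc hd hf hl
  rw [← integral_Ioi_of_hasDerivAt_of_nonneg hc hd hf hl, ofReal_integral_eq_lintegral_ofReal hi]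
  exact (ae_restrict_mem measurableSet_Ioi).mono hf

theorem hasDerivAt_artanh {x : ℝ} (h : x ∈ Ioo (-1 : ℝ) 1) :
    HasDerivAt Real.artanh (1 / (1 - x ^ 2)) x := by
  have h1 : HasDerivAt (fun x : ℝ => 1 / 2 * (Real.log (1 + x) - Real.log (1 - x)))
      (1 / 2 * (1 / (1 + x) - -1 / (1 - x))) x := by
    refine HasDerivAt.const_mul _ (HasDerivAt.sub ?_ ?_)
    · exact HasDerivAt.log ((hasDerivAt_id x).const_add 1) (by linarith [h.1])
    · exact HasDerivAt.log ((hasDerivAt_id x).const_sub 1) (by linarith [h.2])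
  have h2 : 1 / 2 * (1 / (1 + x) - -1 / (1 - x)) = 1 / (1 - x ^ 2) := by
    have := h.1
    have := h.2
    have : 1 + x ≠ 0 := by linarith
    have : 1 - x ≠ 0 := by linarith
    rw [show 1 - x ^ 2 = (1 + x) * (1 - x) by ring]
    field_simp
    ring
  rw [h2] at h1
  refine h1.congr_of_eventuallyEq ?_
  filter_upwards [isOpen_Ioo.mem_nhds h] with y hy
  rw [Real.artanh_eq_half_log ⟨hy.1.le, hy.2.le⟩,
    Real.log_div (by linarith [hy.1]) (by linarith [hy.2])]

theorem hasDerivAt_artanh_div {x c : ℝ} (hx : 0 ≤ x) (hxc : x < c) :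
    HasDerivAt (fun x => 1 / c * Real.artanh (x / c)) (1 / (c ^ 2 - x ^ 2)) x := by
  have hc : 0 < c := by linarith
  have hx1 : x / c < 1 := (div_lt_one hc).2 hxc
  have hx0 : -1 < x / c := by have : 0 ≤ x / c := by positivity
                              linarith
  have h : 0 < c ^ 2 - x ^ 2 := by nlinarith
  have := ((hasDerivAt_artanh ⟨hx0, hx1⟩).comp x ((hasDerivAt_id x).div_const c)).const_mul (1 / c)
  refine HasDerivAt.congr_deriv (this) ?_
  have h2 : 1 - (x / c) ^ 2 = (c ^ 2 - x ^ 2) / c ^ 2 := by field_simp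
  simp only [h2]
  field_simp

theorem hasDerivAt_sqrt_sq_add {x k : ℝ} (h : 0 < x ^ 2 + k) :
    HasDerivAt (fun x : ℝ => √(x ^ 2 + k)) (x / √(x ^ 2 + k)) x := by
  refine HasDerivAt.congr_deriv (((hasDerivAt_pow 2 x).add_const k).sqrt h.ne') ?_
  have : 0 < √(x ^ 2 + k) := by positivity
  push_cast
  field_simp

theorem hasDerivAt_sqrt_sub_sq {x k : ℝ} (h : 0 < k - x ^ 2) :
    HasDerivAt (fun x : ℝ => √(k - x ^ 2)) (-x / √(k - x ^ 2)) x := by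
  refine HasDerivAt.congr_deriv (((hasDerivAt_pow 2 x).const_sub k).sqrt h.ne') ?_
  have : 0 < √(k - x ^ 2) := by positivity
  push_cast
  field_simp

theorem hasDerivAt_log_sub_half_log {x k : ℝ} (hx : 0 < x) (hk : k ≠ 0) (h : 0 < x ^ 2 + k) :
    HasDerivAt (fun x => 1 / k * (Real.log x - 1 / 2 * Real.log (x ^ 2 + k)))
      (1 / (x * (x ^ 2 + k))) x := by
  refine HasDerivAt.congr_deriv (((Real.hasDerivAt_log hx.ne').sub
    ((((hasDerivAt_pow 2 x).add_const k).log h.ne').const_mul (1 / 2))).const_mul (1 / k)) ?_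
  field_simp
  ring

theorem tendsto_log_sub_half_log (k : ℝ) :
    Tendsto (fun x : ℝ => 1 / k * (Real.log x - 1 / 2 * Real.log (x ^ 2 + k))) atTop (𝓝 0) := by
  have h1 : Tendsto (fun x : ℝ => 1 / k * (-(1 / 2) * Real.log (1 + k / x ^ 2))) atTop
      (𝓝 (1 / k * (-(1 / 2) * Real.log (1 + 0)))) := by
    refine Tendsto.const_mul _ (Tendsto.const_mul _ (Tendsto.log ?_ (by norm_num)))
    exact tendsto_const_nhds.add (tendsto_const_nhds.div_atTop (tendsto_pow_atTop two_ne_zero))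
  simp only [add_zero, Real.log_one, mul_zero] at h1
  refine h1.congr' ?_
  filter_upwards [eventually_gt_atTop 0, eventually_gt_atTop (|k| + 1)] with x hx hxk
  have h0 : 0 < x ^ 2 + k := by
    have := neg_abs_le k
    have := abs_nonneg k
    nlinarith
  have : 1 + k / x ^ 2 = (x ^ 2 + k) / x ^ 2 := by field_simp
  rw [this, Real.log_div h0.ne' (by positivity), Real.log_pow]
  push_cast
  ring

/-! ### The inner integral of `γ_N` at fixed `p₃`. -/

/-- The absolute value of the integrand of `γ_N`. -/
def gammaIntegrand (x y : ℝ) : ℝ :=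
  min 1 (min (pTwo x y) (min x y)) / (pTwo x y ^ 2 * (x * y))

theorem measurable_pTwo : Measurable (Function.uncurry pTwo) := by
  unfold pTwo Function.uncurry
  fun_prop

theorem measurable_gammaIntegrand : Measurable (Function.uncurry gammaIntegrand) := by
  have h := measurable_pTwo
  unfold Function.uncurry at h
  unfold gammaIntegrand Function.uncurry
  fun_prop

theorem gammaIntegrand_nonneg {x y : ℝ} (hx : 0 ≤ x) (hy : 0 ≤ y) : 0 ≤ gammaIntegrand x y := by
  have : 0 ≤ pTwo x y := Real.sqrt_nonneg _
  unfold gammaIntegrand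
  positivity

/-- The minimum is `p₂` for `y < 1` and `x` for `y > 1`; the two agree at `y = 1`, where `p₂ = x`.
The first range produces the arctangent, the second the logarithm. -/
theorem lintegral_gammaIntegrand_of_lt_one {x : ℝ} (hx : 0 < x) (hx1 : x < 1) :
    ∫⁻ y in Ioi √(1 - x ^ 2), ENNReal.ofReal (gammaIntegrand x y)
      = ENNReal.ofReal (kernelS x / 2) := by
  set d := √(1 - x ^ 2) with hd
  have h1 : 0 < 1 - x ^ 2 := by nlinarith
  have hd0 : 0 < d := by positivity
  have hd2 : d ^ 2 = 1 - x ^ 2 := Real.sq_sqrt h1.le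
  have hd1 : d < 1 := by nlinarith
  have hp2 : ∀ y, pTwo x y = √(y ^ 2 + -d ^ 2) := fun y => by
    rw [pTwo, hd2]; congr 1; ring
  rw [← Ioc_union_Ioi_eq_Ioi hd1.le, lintegral_union measurableSet_Ioi
    (Set.disjoint_left.2 fun x hx hx' => not_lt.2 hx.2 hx'), setLIntegral_congr Ioo_ae_eq_Ioc.symm]
  have e1 : ∫⁻ y in Ioo d 1, ENNReal.ofReal (gammaIntegrand x y)
      = ENNReal.ofReal (1 / (x * d) * Real.arctan (√(1 ^ 2 + -d ^ 2) / d)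
          - 1 / (x * d) * Real.arctan (√(d ^ 2 + -d ^ 2) / d)) := by
    refine lintegral_Ioo_of_hasDerivAt (F := fun y => 1 / (x * d) * Real.arctan (√(y ^ 2 + -d ^ 2) / d))
      hd1.le (Continuous.continuousOn (by fun_prop)) ?_ ?_
    · rintro y ⟨hy, hy1⟩
      have hy0 : 0 < y := by linarith
      have hpos : 0 < y ^ 2 + -d ^ 2 := by nlinarith
      have hs : 0 < √(y ^ 2 + -d ^ 2) := by positivity
      have hsq : √(y ^ 2 + -d ^ 2) ^ 2 = y ^ 2 + -d ^ 2 := Real.sq_sqrt hpos.le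
      have hsx : √(y ^ 2 + -d ^ 2) ≤ x := by
        rw [Real.sqrt_le_left hx.le]; nlinarith
      have hsy : √(y ^ 2 + -d ^ 2) ≤ y := by
        rw [Real.sqrt_le_left hy0.le]; nlinarith
      have hmin : gammaIntegrand x y = 1 / (x * (√(y ^ 2 + -d ^ 2) * y)) := by
        rw [gammaIntegrand, hp2, min_eq_left (le_min hsx hsy), min_eq_right (by linarith)]
        field_simp
      rw [hmin]
      refine HasDerivAt.congr_deriv ((((hasDerivAt_sqrt_sq_add hpos).div_const d).arctan).const_mul (1 / (x * d))) ?_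
      have : 1 + (√(y ^ 2 + -d ^ 2) / d) ^ 2 = y ^ 2 / d ^ 2 := by
        rw [div_pow, hsq]; field_simp; ring
      rw [this]
      field_simp
    · rintro y ⟨hy, hy1⟩
      exact gammaIntegrand_nonneg hx.le (by linarith)
  have e2 : ∫⁻ y in Ioi 1, ENNReal.ofReal (gammaIntegrand x y)
      = ENNReal.ofReal (0 - 1 / (-d ^ 2) *
        (Real.log 1 - 1 / 2 * Real.log (1 ^ 2 + -d ^ 2))) := by
    refine lintegral_Ioi_of_hasDerivAt
      (F := fun y => 1 / (-d ^ 2) * (Real.log y - 1 / 2 * Real.log (y ^ 2 + -d ^ 2)))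
      ?_ ?_ ?_ (tendsto_log_sub_half_log _)
    · exact (hasDerivAt_log_sub_half_log one_pos (by nlinarith)
        (by nlinarith)).continuousAt.continuousWithinAt
    · intro y (hy : 1 < y)
      have hpos : 0 < y ^ 2 + -d ^ 2 := by nlinarith
      have hs : 0 < √(y ^ 2 + -d ^ 2) := by positivity
      have hsq : √(y ^ 2 + -d ^ 2) ^ 2 = y ^ 2 + -d ^ 2 := Real.sq_sqrt hpos.le
      have hsx : x ≤ √(y ^ 2 + -d ^ 2) := by
        apply Real.le_sqrt_of_sq_le; nlinarith
      have hmin : gammaIntegrand x y = 1 / (y * (y ^ 2 + -d ^ 2)) := by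
        rw [gammaIntegrand, hp2, hsq, min_eq_left (show x ≤ y by linarith), min_eq_right hsx,
          min_eq_right hx1.le]
        field_simp
      rw [hmin]
      exact hasDerivAt_log_sub_half_log (by linarith) (by nlinarith) hpos
    · intro y (hy : 1 < y)
      exact gammaIntegrand_nonneg hx.le (by linarith)
  have hx2 : (1 : ℝ) ^ 2 + -d ^ 2 = x ^ 2 := by rw [hd2]; ring
  have hlog : Real.log x ≤ 0 := Real.log_nonpos hx.le hx1.le
  rw [e1, e2, hx2, add_neg_cancel, Real.sqrt_zero, Real.sqrt_sq hx.le, zero_div, Real.arctan_zero,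
    ← ENNReal.ofReal_add, kernelS, if_pos hx1, ← hd, ← hd2, Real.log_pow]
  · congr 1
    push_cast
    rw [Real.log_one]
    field_simp
    ring
  · have : 0 ≤ Real.arctan (x / d) := Real.arctan_nonneg.2 (by positivity)
    rw [mul_zero, sub_zero]
    positivity
  · rw [Real.log_pow, Real.log_one]
    have : 0 - 1 / -d ^ 2 * (0 - 1 / 2 * ((2 : ℕ) * Real.log x)) = (-Real.log x) / d ^ 2 := by
      push_cast
      field_simp
      ring
    rw [this]
    exact div_nonneg (by linarith) (by positivity)

/-- Here `√(1 - x²)` is `0` by convention, so `y` runs over the whole half line; the minimum is `y`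
for `y < 1` and `1` for `y > 1`. -/
theorem lintegral_gammaIntegrand_of_one_lt {x : ℝ} (hx1 : 1 < x) :
    ∫⁻ y in Ioi √(1 - x ^ 2), ENNReal.ofReal (gammaIntegrand x y)
      = ENNReal.ofReal (kernelS x / 2) := by
  set d := √(x ^ 2 - 1) with hd
  have hx : 0 < x := by linarith
  have h1 : 0 < x ^ 2 - 1 := by nlinarith
  have hd0 : 0 < d := by positivity
  have hd2 : d ^ 2 = x ^ 2 - 1 := Real.sq_sqrt h1.le
  have hp2 : ∀ y, pTwo x y = √(y ^ 2 + d ^ 2) := fun y => by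
    rw [pTwo, hd2]; congr 1; ring
  rw [Real.sqrt_eq_zero_of_nonpos (by linarith), ← Ioc_union_Ioi_eq_Ioi zero_le_one,
    lintegral_union measurableSet_Ioi (Set.disjoint_left.2 fun x hx hx' => not_lt.2 hx.2 hx'),
    setLIntegral_congr Ioo_ae_eq_Ioc.symm]
  have e1 : ∫⁻ y in Ioo 0 1, ENNReal.ofReal (gammaIntegrand x y)
      = ENNReal.ofReal (1 / (x * d) * Real.arctan (1 / d) - 1 / (x * d) * Real.arctan (0 / d)) := by
    refine lintegral_Ioo_of_hasDerivAt (F := fun y => 1 / (x * d) * Real.arctan (y / d))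
      zero_le_one (Continuous.continuousOn (by fun_prop)) ?_ ?_
    · rintro y ⟨hy0, hy1⟩
      have hsq : √(y ^ 2 + d ^ 2) ^ 2 = y ^ 2 + d ^ 2 := Real.sq_sqrt (by positivity)
      have hsy : y ≤ √(y ^ 2 + d ^ 2) := by
        apply Real.le_sqrt_of_sq_le; nlinarith
      have hmin : gammaIntegrand x y = 1 / (x * (y ^ 2 + d ^ 2)) := by
        rw [gammaIntegrand, hp2, hsq, min_eq_right (show y ≤ x by linarith), min_eq_right hsy,
          min_eq_right hy1.le]
        field_simp
      rw [hmin]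
      refine HasDerivAt.congr_deriv ((((hasDerivAt_id y).div_const d).arctan).const_mul (1 / (x * d))) ?_
      simp only [id]
      field_simp
      ring
    · rintro y ⟨hy, hy1⟩
      exact gammaIntegrand_nonneg hx.le hy.le
  have e2 : ∫⁻ y in Ioi 1, ENNReal.ofReal (gammaIntegrand x y)
      = ENNReal.ofReal (1 / x * 0 - 1 / x * (1 / (d ^ 2) *
        (Real.log 1 - 1 / 2 * Real.log (1 ^ 2 + d ^ 2)))) := by
    refine lintegral_Ioi_of_hasDerivAt
      (F := fun y => 1 / x * (1 / (d ^ 2) * (Real.log y - 1 / 2 * Real.log (y ^ 2 + d ^ 2))))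
      ?_ ?_ ?_ ((tendsto_log_sub_half_log _).const_mul _)
    · exact ((hasDerivAt_log_sub_half_log one_pos (by nlinarith)
        (by nlinarith)).const_mul _).continuousAt.continuousWithinAt
    · intro y (hy : 1 < y)
      have hsq : √(y ^ 2 + d ^ 2) ^ 2 = y ^ 2 + d ^ 2 := Real.sq_sqrt (by positivity)
      have hs1 : 1 ≤ √(y ^ 2 + d ^ 2) := by
        apply Real.le_sqrt_of_sq_le; nlinarith
      have hmin : gammaIntegrand x y = 1 / x * (1 / (y * (y ^ 2 + d ^ 2))) := by
        rw [gammaIntegrand, hp2, hsq, min_eq_left (le_min hs1 (le_min hx1.le hy.le))]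
        field_simp
      rw [hmin]
      exact (hasDerivAt_log_sub_half_log (by linarith) (by nlinarith) (by positivity)).const_mul _
    · intro y (hy : 1 < y)
      exact gammaIntegrand_nonneg hx.le (by linarith)
  have hx2 : (1 : ℝ) ^ 2 + d ^ 2 = x ^ 2 := by rw [hd2]; ring
  have hlog : 0 ≤ Real.log x := Real.log_nonneg hx1.le
  rw [e1, e2, hx2, zero_div, Real.arctan_zero,
    ← ENNReal.ofReal_add, kernelS, if_neg (by linarith), ← hd, ← hd2, Real.log_pow]
  · congr 1
    push_cast
    rw [Real.log_one]
    field_simp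
    ring
  · have : 0 ≤ Real.arctan (1 / d) := Real.arctan_nonneg.2 (by positivity)
    rw [mul_zero, sub_zero]
    positivity
  · rw [Real.log_pow, Real.log_one]
    have : 1 / x * 0 - 1 / x * (1 / d ^ 2 * (0 - 1 / 2 * ((2 : ℕ) * Real.log x)))
        = Real.log x / (x * d ^ 2) := by
      push_cast
      field_simp
      ring
    rw [this]
    positivity

/-! ### The inner integral of `γ_N` at fixed `p₂`. -/

/-- The integrand of `γ_N` in the variables `p₃ = x`, `p₂ = s`. -/
def gammaIntegrand' (x s : ℝ) : ℝ :=
  min 1 (min s (min x √(1 + s ^ 2 - x ^ 2))) / (s * (x * (1 + s ^ 2 - x ^ 2)))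

theorem measurable_gammaIntegrand' : Measurable (Function.uncurry gammaIntegrand') := by
  unfold gammaIntegrand' Function.uncurry
  fun_prop

/-- At fixed `p₃` the variable `p₄` is traded for `p₂`, with `p₄ dp₄ = p₂ dp₂`. -/
theorem lintegral_gammaIntegrand_eq {x : ℝ} (hx : 0 < x) :
    ∫⁻ y in Ioi √(1 - x ^ 2), ENNReal.ofReal (gammaIntegrand x y)
      = ∫⁻ s in Ioi √(x ^ 2 - 1), ENNReal.ofReal (gammaIntegrand' x s) := by
  have key : ∀ k s : ℝ, √(-k) < s → 0 < s ∧ 0 < s ^ 2 + k := fun k s hs => by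
    have h0 : 0 < s := (Real.sqrt_nonneg _).trans_lt hs
    have := (Real.sqrt_lt' h0).1 hs
    exact ⟨h0, by linarith⟩
  have himg : (fun s : ℝ => √(s ^ 2 + (1 - x ^ 2))) '' Ioi √(x ^ 2 - 1) = Ioi √(1 - x ^ 2) := by
    ext y
    simp only [mem_image, mem_Ioi]
    constructor
    · rintro ⟨s, hs, rfl⟩
      obtain ⟨h0, h1⟩ := key (1 - x ^ 2) s (by rwa [neg_sub])
      exact Real.sqrt_lt_sqrt_iff_of_pos h1 |>.2 (by nlinarith)
    · intro hy
      obtain ⟨h0, h1⟩ := key (x ^ 2 - 1) y (by rwa [neg_sub])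
      refine ⟨√(y ^ 2 + (x ^ 2 - 1)), ?_, ?_⟩
      · exact Real.sqrt_lt_sqrt_iff_of_pos h1 |>.2 (by nlinarith)
      · rw [Real.sq_sqrt h1.le, Real.sqrt_eq_iff_mul_self_eq (by nlinarith) h0.le]
        ring
  rw [← himg, lintegral_image_eq_lintegral_abs_deriv_mul
    (f' := fun s => s / √(s ^ 2 + (1 - x ^ 2))) measurableSet_Ioi]
  · refine setLIntegral_congr_fun measurableSet_Ioi fun s hs => ?_
    obtain ⟨h0, h1⟩ := key (1 - x ^ 2) s (by rw [neg_sub]; exact hs)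
    have hp : pTwo x √(s ^ 2 + (1 - x ^ 2)) = s := by
      rw [pTwo, Real.sq_sqrt h1.le, Real.sqrt_eq_iff_mul_self_eq (by nlinarith) h0.le]
      ring
    have hs' : 0 < √(s ^ 2 + (1 - x ^ 2)) := by positivity
    have hsq := Real.sq_sqrt h1.le
    rw [abs_of_nonneg (by positivity), ← ENNReal.ofReal_mul (by positivity), gammaIntegrand, hp,
      gammaIntegrand', show 1 + s ^ 2 - x ^ 2 = s ^ 2 + (1 - x ^ 2) by ring]
    congr 1
    nth_rw 5 [← hsq]
    field_simp
  · intro s hs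
    obtain ⟨h0, h1⟩ := key (1 - x ^ 2) s (by rw [neg_sub]; exact hs)
    exact (hasDerivAt_sqrt_sq_add h1).hasDerivWithinAt
  · intro s hs t ht hst
    obtain ⟨h0, h1⟩ := key (1 - x ^ 2) s (by rw [neg_sub]; exact hs)
    obtain ⟨h0', h1'⟩ := key (1 - x ^ 2) t (by rw [neg_sub]; exact ht)
    have := (Real.sqrt_inj h1.le h1'.le).1 hst
    exact (sq_eq_sq₀ h0.le h0'.le).1 (by linarith)

/-- Here `m < M` stand for `1` and `p₂` in increasing order, and `(x, √(c² - x²))` is the pair `(p₃,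
p₄)` on a circle. The minimum is `x` up to `m`, then `m` up to `M`, then `√(c² - x²)`, since `√(c² -
M²) = m`. The two outer ranges give the same inverse hyperbolic tangent and the middle one gives the
logarithms. -/
theorem lintegral_min_div {m M s c : ℝ} (hm : 0 < m) (hmM : m < M) (hs : 0 < s) (hc : 0 < c)
    (hc2 : c ^ 2 = m ^ 2 + M ^ 2) :
    ∫⁻ x in Ioo 0 c, ENNReal.ofReal (min m (min x √(c ^ 2 - x ^ 2)) / (s * (x * (c ^ 2 - x ^ 2))))
      = ENNReal.ofReal (2 / (s * c) * Real.artanh (m / c)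
        + 2 * m / (s * c ^ 2) * (Real.log M - Real.log m)) := by
  have hMc : M < c := by nlinarith
  have hM : 0 < M := by linarith
  have hsqm : √(c ^ 2 - M ^ 2) = m := by
    rw [hc2, add_sub_cancel_right, Real.sqrt_sq hm.le]
  have hnn : ∀ x ∈ Ioo 0 c,
      0 ≤ min m (min x √(c ^ 2 - x ^ 2)) / (s * (x * (c ^ 2 - x ^ 2))) := by
    rintro x ⟨h0, h1⟩
    have : 0 < c ^ 2 - x ^ 2 := by nlinarith
    positivity
  have hu : Ioo 0 c = Ioc 0 m ∪ (Ioc m M ∪ Ioo M c) := by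
    rw [Ioc_union_Ioo_eq_Ioo hmM.le hMc, Ioc_union_Ioo_eq_Ioo hm.le (hmM.trans hMc)]
  rw [hu, lintegral_union (measurableSet_Ioc.union measurableSet_Ioo)
    (Set.disjoint_left.2 fun x hx hx' => by
      rcases hx' with h | h
      · exact not_lt.2 hx.2 h.1
      · exact not_lt.2 hx.2 (hmM.trans h.1)),
    lintegral_union measurableSet_Ioo (Set.disjoint_left.2 fun x hx hx' => not_lt.2 hx.2 hx'.1),
    setLIntegral_congr Ioo_ae_eq_Ioc.symm, setLIntegral_congr (Ioo_ae_eq_Ioc (a := m)).symm]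
  have e1 : ∫⁻ x in Ioo 0 m,
      ENNReal.ofReal (min m (min x √(c ^ 2 - x ^ 2)) / (s * (x * (c ^ 2 - x ^ 2))))
      = ENNReal.ofReal (1 / s * (1 / c * Real.artanh (m / c))
        - 1 / s * (1 / c * Real.artanh (0 / c))) := by
    refine lintegral_Ioo_of_hasDerivAt (F := fun x => 1 / s * (1 / c * Real.artanh (x / c)))
      hm.le ?_ ?_ fun x hx => hnn x ⟨hx.1, hx.2.trans (hmM.trans hMc)⟩
    · intro x hx
      exact ((hasDerivAt_artanh_div hx.1 (by linarith [hx.2])).const_mul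
        _).continuousAt.continuousWithinAt
    · rintro x ⟨h0, h1⟩
      have hpos : 0 < c ^ 2 - x ^ 2 := by nlinarith
      have h2 : x ≤ √(c ^ 2 - x ^ 2) := by apply Real.le_sqrt_of_sq_le; nlinarith
      rw [min_eq_left h2, min_eq_right h1.le]
      refine HasDerivAt.congr_deriv ((hasDerivAt_artanh_div h0.le (show x < c by linarith)).const_mul (1 / s)) ?_
      field_simp
  have e2 : ∫⁻ x in Ioo m M,
      ENNReal.ofReal (min m (min x √(c ^ 2 - x ^ 2)) / (s * (x * (c ^ 2 - x ^ 2))))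
      = ENNReal.ofReal
        (m / s * (1 / c ^ 2 * (Real.log M - 1 / 2 * Real.log (c ^ 2 - M ^ 2)))
          - m / s * (1 / c ^ 2 * (Real.log m - 1 / 2 * Real.log (c ^ 2 - m ^ 2)))) := by
    have hder : ∀ x ∈ Icc m M, HasDerivAt
        (fun x => m / s * (1 / c ^ 2 * (Real.log x - 1 / 2 * Real.log (c ^ 2 - x ^ 2))))
        (m / (s * (x * (c ^ 2 - x ^ 2)))) x := by
      rintro x ⟨h0, h1⟩
      have hx0 : 0 < x := by linarith
      have hpos : 0 < c ^ 2 - x ^ 2 := by nlinarith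
      refine HasDerivAt.congr_deriv ((((Real.hasDerivAt_log hx0.ne').sub
        ((((hasDerivAt_pow 2 x).const_sub (c ^ 2)).log hpos.ne').const_mul (1 / 2))).const_mul
          (1 / c ^ 2)).const_mul (m / s)) ?_
      field_simp
      ring
    refine lintegral_Ioo_of_hasDerivAt
      (F := fun x => m / s * (1 / c ^ 2 * (Real.log x - 1 / 2 * Real.log (c ^ 2 - x ^ 2))))
      hmM.le ?_ ?_ fun x hx => hnn x ⟨hm.trans hx.1, hx.2.trans hMc⟩
    · exact fun x hx => (hder x hx).continuousAt.continuousWithinAt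
    · rintro x ⟨h0, h1⟩
      have h2 : m ≤ √(c ^ 2 - x ^ 2) := by apply Real.le_sqrt_of_sq_le; nlinarith
      rw [min_eq_left (le_min h0.le h2)]
      exact hder x ⟨h0.le, h1.le⟩
  have e3 : ∫⁻ x in Ioo M c,
      ENNReal.ofReal (min m (min x √(c ^ 2 - x ^ 2)) / (s * (x * (c ^ 2 - x ^ 2))))
      = ENNReal.ofReal (-(1 / s) * (1 / c * Real.artanh (√(c ^ 2 - c ^ 2) / c))
        - -(1 / s) * (1 / c * Real.artanh (√(c ^ 2 - M ^ 2) / c))) := by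
    have hlt : ∀ x, M ≤ x → √(c ^ 2 - x ^ 2) < c := fun x hx => by
      rw [Real.sqrt_lt' hc]
      nlinarith
    refine lintegral_Ioo_of_hasDerivAt
      (F := fun x => -(1 / s) * (1 / c * Real.artanh (√(c ^ 2 - x ^ 2) / c)))
      hMc.le ?_ ?_ fun x hx => hnn x ⟨hM.trans hx.1, hx.2⟩
    · intro x hx
      have h1 : ContinuousAt (fun x => √(c ^ 2 - x ^ 2)) x := Continuous.continuousAt (by fun_prop)
      have h2 := (hasDerivAt_artanh_div (Real.sqrt_nonneg (c ^ 2 - x ^ 2)) (hlt x hx.1)).continuousAt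
      exact (ContinuousAt.const_mul
        (ContinuousAt.comp (f := fun x => √(c ^ 2 - x ^ 2)) h2 h1) _).continuousWithinAt
    · rintro x ⟨h0, h1⟩
      have hx0 : 0 < x := by linarith
      have hpos : 0 < c ^ 2 - x ^ 2 := by nlinarith
      have hsq := Real.sq_sqrt hpos.le
      have hs' : 0 < √(c ^ 2 - x ^ 2) := by positivity
      have h2 : √(c ^ 2 - x ^ 2) ≤ m := by rw [Real.sqrt_le_left hm.le]; nlinarith
      rw [min_eq_right (show √(c ^ 2 - x ^ 2) ≤ x by linarith), min_eq_right h2]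
      have := ((hasDerivAt_artanh_div (Real.sqrt_nonneg (c ^ 2 - x ^ 2)) (hlt x h0.le)).comp x
        (hasDerivAt_sqrt_sub_sq hpos)).const_mul (-(1 / s))
      refine HasDerivAt.congr_deriv (this) ?_
      rw [hsq, sub_sub_cancel]
      field_simp
      exact hsq.symm
  have hcm : c ^ 2 - m ^ 2 = M ^ 2 := by rw [hc2]; ring
  have hcM : c ^ 2 - M ^ 2 = m ^ 2 := by rw [hc2]; ring
  have hart : 0 ≤ Real.artanh (m / c) := Real.artanh_nonneg (by positivity)
  have hlog : Real.log m ≤ Real.log M := Real.log_le_log hm hmM.le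
  rw [e1, e2, e3, hsqm, sub_self, hcm, hcM, Real.sqrt_zero, zero_div, Real.artanh_zero,
    Real.log_pow, Real.log_pow]
  have h2 : m / s * (1 / c ^ 2 * (Real.log M - 1 / 2 * ((2 : ℕ) * Real.log m)))
      - m / s * (1 / c ^ 2 * (Real.log m - 1 / 2 * ((2 : ℕ) * Real.log M)))
      = 2 * m / (s * c ^ 2) * (Real.log M - Real.log m) := by
    push_cast
    ring
  have h2' : 0 ≤ 2 * m / (s * c ^ 2) * (Real.log M - Real.log m) :=
    mul_nonneg (by positivity) (by linarith)
  have h3' : 0 ≤ -(1 / s) * (1 / c * 0) - -(1 / s) * (1 / c * Real.artanh (m / c)) := by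
    rw [mul_zero, mul_zero, zero_sub, neg_mul, neg_neg]
    positivity
  rw [h2, ← ENNReal.ofReal_add h2' h3', ← ENNReal.ofReal_add]
  · congr 1
    field_simp
    ring
  · rw [mul_zero, mul_zero, sub_zero]
    positivity
  · linarith

theorem lintegral_gammaIntegrand'_eq {s : ℝ} (hs : 0 < s) (hs1 : s ≠ 1) :
    ∫⁻ x in Ioo 0 √(1 + s ^ 2), ENNReal.ofReal (gammaIntegrand' x s)
      = ENNReal.ofReal (-kernelR s) := by
  have hc : 0 < √(1 + s ^ 2) := by positivity
  have hsq : √(1 + s ^ 2) ^ 2 = 1 + s ^ 2 := Real.sq_sqrt (by positivity)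
  rcases lt_or_gt_of_ne hs1 with h | h
  · have := lintegral_min_div hs h hs hc (by rw [hsq]; ring)
    rw [hsq] at this
    rw [kernelR, if_pos h]
    convert this using 2
    · simp only [gammaIntegrand']
      refine funext fun x => ?_
      rw [← min_assoc, min_eq_right h.le]
    · rw [Real.log_one]
      field_simp
      ring
  · have := lintegral_min_div one_pos h hs hc (by rw [hsq]; ring)
    rw [hsq] at this
    rw [kernelR, if_neg (by linarith)]
    convert this using 2
    · simp only [gammaIntegrand']
      refine funext fun x => ?_
      rw [← min_assoc, min_eq_left h.le]
    · rw [Real.log_one]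
      field_simp
      ring

/-! ### The two slicings of `γ_N` and the identity `γ_N = -∫ 𝒱`. -/

/-- The domain of integration of `γ_N`. -/
def gammaDomain : Set (ℝ × ℝ) := {z | 0 < z.1 ∧ 0 < z.2 ∧ 1 < z.1 ^ 2 + z.2 ^ 2}

theorem measurableSet_gammaDomain : MeasurableSet gammaDomain := by
  have h : Measurable fun z : ℝ × ℝ => z.1 ^ 2 + z.2 ^ 2 := by fun_prop
  exact (measurableSet_lt measurable_const measurable_fst).inter
    ((measurableSet_lt measurable_const measurable_snd).inter
      (measurableSet_lt (f := fun _ => (1 : ℝ)) measurable_const h))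

theorem lintegral_gammaDomain_eq :
    ∫⁻ z in gammaDomain, ENNReal.ofReal (gammaIntegrand z.1 z.2)
      = ∫⁻ x, (∫⁻ y in Ioi √(1 - x ^ 2), ENNReal.ofReal (gammaIntegrand x y)) ∂halfLine := by
  have hm : Measurable fun z : ℝ × ℝ => ENNReal.ofReal (gammaIntegrand z.1 z.2) :=
    measurable_gammaIntegrand.ennreal_ofReal
  rw [← lintegral_indicator measurableSet_gammaDomain, Measure.volume_eq_prod,
    lintegral_prod _ (hm.indicator measurableSet_gammaDomain).aemeasurable, halfLine,
    ← lintegral_indicator measurableSet_Ioi]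
  refine lintegral_congr fun x => ?_
  by_cases hx : 0 < x
  · rw [indicator_of_mem (mem_Ioi.2 hx), ← lintegral_indicator measurableSet_Ioi]
    refine lintegral_congr fun y => ?_
    have hiff : (x, y) ∈ gammaDomain ↔ y ∈ Ioi √(1 - x ^ 2) := by
      simp only [gammaDomain, mem_ofPred_eq, mem_Ioi]
      constructor
      · rintro ⟨_, h2, h3⟩
        rw [Real.sqrt_lt' h2]
        linarith
      · intro h
        have h2 : 0 < y := (Real.sqrt_nonneg _).trans_lt h
        rw [Real.sqrt_lt' h2] at h
        exact ⟨hx, h2, by linarith⟩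
    by_cases hy : (x, y) ∈ gammaDomain
    · rw [indicator_of_mem hy, indicator_of_mem (hiff.1 hy)]
    · rw [indicator_of_notMem hy, indicator_of_notMem (fun h => hy (hiff.2 h))]
  · rw [indicator_of_notMem (by simpa using hx)]
    refine (lintegral_congr fun y => indicator_of_notMem (fun h => hx h.1) _).trans lintegral_zero

theorem ae_halfLine_pos : ∀ᵐ x ∂halfLine, 0 < x := ae_restrict_mem measurableSet_Ioi

theorem ae_halfLine_ne (a : ℝ) : ∀ᵐ x ∂halfLine, x ≠ a :=
  ae_restrict_of_ae (Measure.ae_ne volume a)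

instance : SFinite halfLine := by
  unfold halfLine
  infer_instance

/-- Slicing along `p₃`. Only half of `S` appears because `S` collects the `p₃` and `p₄`
contributions, which agree by symmetry. -/
theorem lintegral_gammaDomain_eq_kernelS :
    ∫⁻ z in gammaDomain, ENNReal.ofReal (gammaIntegrand z.1 z.2)
      = ∫⁻ x, ENNReal.ofReal (kernelS x / 2) ∂halfLine := by
  rw [lintegral_gammaDomain_eq]
  refine lintegral_congr_ae ?_
  filter_upwards [ae_halfLine_pos, ae_halfLine_ne 1] with x hx hx1
  rcases lt_or_gt_of_ne hx1 with h | h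
  · exact lintegral_gammaIntegrand_of_lt_one hx h
  · exact lintegral_gammaIntegrand_of_one_lt h

/-- The same integral sliced along `p₂`: after the substitution at fixed `p₃`, Tonelli exchanges the
order of integration. -/
theorem lintegral_gammaDomain_eq_kernelR :
    ∫⁻ z in gammaDomain, ENNReal.ofReal (gammaIntegrand z.1 z.2)
      = ∫⁻ s, ENNReal.ofReal (-kernelR s) ∂halfLine := by
  -- In the variables `(p₃, p₂)` this is the condition `p₄² > 0`.
  set D : Set (ℝ × ℝ) := {z | z.1 ^ 2 < 1 + z.2 ^ 2} with hD
  have hDm : MeasurableSet D := measurableSet_lt (by fun_prop) (by fun_prop)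
  set F : ℝ × ℝ → ℝ≥0∞ := D.indicator fun z => ENNReal.ofReal (gammaIntegrand' z.1 z.2) with hF
  have hFm : Measurable F := measurable_gammaIntegrand'.ennreal_ofReal.indicator hDm
  calc ∫⁻ z in gammaDomain, ENNReal.ofReal (gammaIntegrand z.1 z.2)
      = ∫⁻ x, (∫⁻ s, F (x, s) ∂halfLine) ∂halfLine := by
        rw [lintegral_gammaDomain_eq]
        refine lintegral_congr_ae ?_
        filter_upwards [ae_halfLine_pos] with x hx
        rw [lintegral_gammaIntegrand_eq hx, halfLine, ← lintegral_indicator measurableSet_Ioi,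
          ← lintegral_indicator measurableSet_Ioi]
        refine lintegral_congr fun s => ?_
        have hiff : s ∈ Ioi √(x ^ 2 - 1) ↔ 0 < s ∧ (x, s) ∈ D := by
          simp only [hD, mem_ofPred_eq, mem_Ioi]
          constructor
          · intro h
            have h2 : 0 < s := (Real.sqrt_nonneg _).trans_lt h
            rw [Real.sqrt_lt' h2] at h
            exact ⟨h2, by linarith⟩
          · rintro ⟨h2, h3⟩
            rw [Real.sqrt_lt' h2]
            linarith
        by_cases hs : s ∈ Ioi √(x ^ 2 - 1)
        · rw [indicator_of_mem hs, indicator_of_mem (mem_Ioi.2 (hiff.1 hs).1), hF,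
            indicator_of_mem (hiff.1 hs).2]
        · rw [indicator_of_notMem hs]
          by_cases h0 : 0 < s
          · rw [indicator_of_mem (mem_Ioi.2 h0), hF, indicator_of_notMem]
            exact fun h => hs (hiff.2 ⟨h0, h⟩)
          · rw [indicator_of_notMem (by simpa using h0)]
    _ = ∫⁻ s, (∫⁻ x, F (x, s) ∂halfLine) ∂halfLine :=
        lintegral_lintegral_swap (f := fun x s => F (x, s)) hFm.aemeasurable
    _ = ∫⁻ s, ENNReal.ofReal (-kernelR s) ∂halfLine := by
        refine lintegral_congr_ae ?_
        filter_upwards [ae_halfLine_pos, ae_halfLine_ne 1] with s hs hs1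
        rw [← lintegral_gammaIntegrand'_eq hs hs1, halfLine,
          ← lintegral_indicator measurableSet_Ioi, ← lintegral_indicator measurableSet_Ioo]
        refine lintegral_congr fun x => ?_
        have hiff : x ∈ Ioo 0 √(1 + s ^ 2) ↔ 0 < x ∧ (x, s) ∈ D := by
          simp only [hD, mem_ofPred_eq, mem_Ioo]
          refine and_congr_right fun hx => ?_
          rw [Real.lt_sqrt hx.le]
        by_cases hs : x ∈ Ioo 0 √(1 + s ^ 2)
        · rw [indicator_of_mem hs, indicator_of_mem (mem_Ioi.2 (hiff.1 hs).1), hF,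
            indicator_of_mem (hiff.1 hs).2]
        · rw [indicator_of_notMem hs]
          by_cases h0 : 0 < x
          · rw [indicator_of_mem (mem_Ioi.2 h0), hF, indicator_of_notMem]
            exact fun h => hs (hiff.2 ⟨h0, h⟩)
          · rw [indicator_of_notMem (by simpa using h0)]

theorem integrable_kernelV : Integrable kernelV halfLine := by
  simpa using integrable_kernelV_mul_rpow (c := 1) (by norm_num) (by norm_num)

/-- Since `p₂² - p₃² - p₄² = -1`, the combination `n₃n₄ - n₂n₃ - n₂n₄` collapses to `-n₂n₃n₄`, which
has a sign. -/
theorem gammaN_eq_neg_toReal :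
    gammaN = -(∫⁻ z in gammaDomain, ENNReal.ofReal (gammaIntegrand z.1 z.2)).toReal := by
  rw [← integral_toReal, gammaN, ← integral_neg]
  · refine setIntegral_congr_fun measurableSet_gammaDomain fun z hz => ?_
    obtain ⟨h1, h2, h3⟩ := hz
    have hpos : 0 < z.1 ^ 2 + z.2 ^ 2 - 1 := by linarith
    have hp : 0 < pTwo z.1 z.2 := Real.sqrt_pos.2 hpos
    have hsq : pTwo z.1 z.2 ^ 2 = z.1 ^ 2 + z.2 ^ 2 - 1 := Real.sq_sqrt hpos.le
    rw [ENNReal.toReal_ofReal (gammaIntegrand_nonneg h1.le h2.le), gammaIntegrand]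
    have : n0 z.1 * n0 z.2 - n0 (pTwo z.1 z.2) * n0 z.1 - n0 (pTwo z.1 z.2) * n0 z.2
        = -1 / (pTwo z.1 z.2 ^ 2 * z.1 ^ 2 * z.2 ^ 2) := by
      simp only [n0]
      field_simp
      rw [hsq]
      ring
    rw [this]
    field_simp
  · exact measurable_gammaIntegrand.ennreal_ofReal.aemeasurable
  · exact ae_of_all _ fun _ => ENNReal.ofReal_lt_top

/-- The gain and loss terms of the linearized equation balance exactly on constants. -/
theorem gammaN_eq_neg_integral_kernelV : gammaN = -∫ s, kernelV s ∂halfLine := by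
  have hSi : Integrable kernelS halfLine := by
    have := integrable_kernelV.sub integrable_kernelR
    refine this.congr (ae_of_all _ fun s => ?_)
    simp [kernelV]
  have hR : (∫⁻ z in gammaDomain, ENNReal.ofReal (gammaIntegrand z.1 z.2)).toReal
      = -∫ s, kernelR s ∂halfLine := by
    rw [lintegral_gammaDomain_eq_kernelR, ← integral_neg, integral_eq_lintegral_of_nonneg_ae]
    · filter_upwards [ae_halfLine_pos] with s hs using neg_kernelR_nonneg hs
    · exact measurable_kernelR.neg.aestronglyMeasurable
  have hS : (∫⁻ z in gammaDomain, ENNReal.ofReal (gammaIntegrand z.1 z.2)).toReal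
      = (∫ s, kernelS s ∂halfLine) / 2 := by
    rw [lintegral_gammaDomain_eq_kernelS, ← integral_div, integral_eq_lintegral_of_nonneg_ae]
    · filter_upwards [ae_halfLine_pos, ae_halfLine_ne 1] with s hs hs1
      have h1 := neg_kernelR_nonneg hs
      have h2 := kernelV_pos hs hs1
      have h3 : kernelS s = kernelV s + -kernelR s := by rw [kernelV]; ring
      simp only [Pi.zero_apply, h3]
      positivity
    · exact (measurable_kernelS.div_const 2).aestronglyMeasurable
  have hV : ∫ s, kernelV s ∂halfLine = ∫ s, kernelR s ∂halfLine + ∫ s, kernelS s ∂halfLine :=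
    integral_add integrable_kernelR hSi
  -- With `G = -γ_N`, the two slicings say `∫ R = -G` and `∫ S = 2G`, whence `∫ 𝒱 = G`.
  rw [gammaN_eq_neg_toReal]
  linarith

/-! ### Moments of the kernel -/

/-- The Mellin moment `∫₀^∞ 𝒱(s) s^(c-1) ds`. -/
def kernelMoment (c : ℝ) : ℝ := ∫ s, kernelV s * s ^ (c - 1) ∂halfLine

theorem ae_kernelV_pos : ∀ᵐ s ∂halfLine, 0 < kernelV s := by
  filter_upwards [ae_halfLine_pos, ae_halfLine_ne 1] with s hs hs1 using kernelV_pos hs hs1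

theorem ae_kernelV_mul_rpow_nonneg (c : ℝ) : ∀ᵐ s ∂halfLine, 0 ≤ kernelV s * s ^ (c - 1) := by
  filter_upwards [ae_halfLine_pos, ae_kernelV_pos] with s hs hV
  positivity

theorem kernelMoment_nonneg (c : ℝ) : 0 ≤ kernelMoment c :=
  integral_nonneg_of_ae (ae_kernelV_mul_rpow_nonneg c)

theorem lintegral_enorm_kernelV_mul_rpow {c : ℝ} (hc : -2 < c) (hc' : c < 5) :
    ∫⁻ s, ‖kernelV s * s ^ (c - 1)‖ₑ ∂halfLine = ENNReal.ofReal (kernelMoment c) := by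
  rw [kernelMoment, ofReal_integral_eq_lintegral_ofReal (integrable_kernelV_mul_rpow hc hc')
    (ae_kernelV_mul_rpow_nonneg c)]
  refine lintegral_congr_ae ?_
  filter_upwards [ae_kernelV_mul_rpow_nonneg c] with s hs using Real.enorm_of_nonneg hs

/-- Both moments are the sum of the same two integrals over `(0, 1)`, in opposite order. -/
theorem kernelMoment_symm {c : ℝ} (hc : -2 < c) (hc' : c < 5) :
    kernelMoment (3 - c) = kernelMoment c := by
  rw [← ENNReal.ofReal_eq_ofReal_iff (kernelMoment_nonneg _) (kernelMoment_nonneg _),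
    ← lintegral_enorm_kernelV_mul_rpow hc hc',
    ← lintegral_enorm_kernelV_mul_rpow (by linarith) (by linarith),
    lintegral_halfLine_mellin_eq fun p => kernelV_eq_inv,
    lintegral_halfLine_mellin_eq fun p => kernelV_eq_inv, sub_sub_cancel, add_comm]

theorem gammaN_eq_neg_kernelMoment : gammaN = -kernelMoment 1 := by
  rw [gammaN_eq_neg_integral_kernelV, kernelMoment]
  simp

/-- The point `s = 1` is exempt because the weights used to compare moments vanish there. -/
theorem integral_kernelV_mul_pos {w : ℝ → ℝ} (hi : Integrable (fun s => kernelV s * w s) halfLine)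
    (hw : ∀ s, 0 < s → s ≠ 1 → 0 < w s) : 0 < ∫ s, kernelV s * w s ∂halfLine := by
  have hpos : ∀ᵐ s ∂halfLine, 0 < kernelV s * w s := by
    filter_upwards [ae_halfLine_pos, ae_halfLine_ne 1] with s hs hs1
    exact mul_pos (kernelV_pos hs hs1) (hw s hs hs1)
  rw [integral_pos_iff_support_of_nonneg_ae (hpos.mono fun _ h => h.le) hi]
  have : halfLine (Function.support fun s => kernelV s * w s) = halfLine univ := by
    refine measure_congr ?_
    filter_upwards [hpos] with s hs
    exact propext ⟨fun _ => trivial, fun _ => hs.ne'⟩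
  rw [this, halfLine, Measure.restrict_apply_univ, Real.volume_Ioi]
  exact ENNReal.zero_lt_top

/-- By symmetry `2 (m(3) - m(1)) = m(3) + m(0) - m(1) - m(2)`, the integral of `𝒱` against `s² + s⁻¹
- 1 - s = (1 - s)² (1 + s) / s`. -/
theorem kernelMoment_one_lt_three : kernelMoment 1 < kernelMoment 3 := by
  have h0 := integrable_kernelV_mul_rpow (c := 0) (by norm_num) (by norm_num)
  have h1 := integrable_kernelV_mul_rpow (c := 1) (by norm_num) (by norm_num)
  have h2 := integrable_kernelV_mul_rpow (c := 2) (by norm_num) (by norm_num)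
  have h3 := integrable_kernelV_mul_rpow (c := 3) (by norm_num) (by norm_num)
  have e03 := kernelMoment_symm (c := 0) (by norm_num) (by norm_num)
  have e12 := kernelMoment_symm (c := 1) (by norm_num) (by norm_num)
  norm_num at e03 e12
  have hfun : (fun s : ℝ => kernelV s * (s ^ ((3 : ℝ) - 1) + s ^ ((0 : ℝ) - 1)
      - (s ^ ((1 : ℝ) - 1) + s ^ ((2 : ℝ) - 1)))) = fun s => kernelV s * s ^ ((3 : ℝ) - 1)
        + kernelV s * s ^ ((0 : ℝ) - 1)
        - (kernelV s * s ^ ((1 : ℝ) - 1) + kernelV s * s ^ ((2 : ℝ) - 1)) := by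
    ext s
    ring
  have hpos : 0 < ∫ s, kernelV s * (s ^ ((3 : ℝ) - 1) + s ^ ((0 : ℝ) - 1)
      - (s ^ ((1 : ℝ) - 1) + s ^ ((2 : ℝ) - 1))) ∂halfLine := by
    refine integral_kernelV_mul_pos ?_ fun s hs hs1 => ?_
    · rw [hfun]
      exact (h3.add h0).sub (h1.add h2)
    · norm_num
      rw [Real.rpow_neg_one]
      have : s ^ 2 + s⁻¹ - (1 + s) = (1 - s) ^ 2 * (1 + s) / s := by field_simp; ring
      have h4 : 0 < (1 - s) ^ 2 := by
        have : 1 - s ≠ 0 := sub_ne_zero.2 hs1.symm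
        positivity
      have : 0 < s ^ 2 + s⁻¹ - (1 + s) := by rw [this]; positivity
      linarith
  rw [hfun, integral_sub (by exact h3.add h0) (by exact h1.add h2), integral_add h3 h0,
    integral_add h1 h2] at hpos
  change 0 < kernelMoment 3 + kernelMoment 0 - (kernelMoment 1 + kernelMoment 2) at hpos
  linarith

/-- By symmetry `2 (m(1) - m(3/2)) = m(1) + m(2) - 2 m(3/2)`, the integral of `𝒱` against `(1 -
√s)²`. -/
theorem kernelMoment_three_halves_lt_one : kernelMoment (3 / 2) < kernelMoment 1 := by
  have h0 := integrable_kernelV_mul_rpow (c := 3 / 2) (by norm_num) (by norm_num)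
  have h1 := integrable_kernelV_mul_rpow (c := 1) (by norm_num) (by norm_num)
  have h2 := integrable_kernelV_mul_rpow (c := 2) (by norm_num) (by norm_num)
  have e12 := kernelMoment_symm (c := 1) (by norm_num) (by norm_num)
  norm_num at e12
  have hfun : (fun s : ℝ => kernelV s * (s ^ ((1 : ℝ) - 1) + s ^ ((2 : ℝ) - 1)
      - 2 * s ^ ((3 / 2 : ℝ) - 1))) = fun s => kernelV s * s ^ ((1 : ℝ) - 1)
        + kernelV s * s ^ ((2 : ℝ) - 1) - 2 * (kernelV s * s ^ ((3 / 2 : ℝ) - 1)) := by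
    ext s
    ring
  have hpos : 0 < ∫ s, kernelV s * (s ^ ((1 : ℝ) - 1) + s ^ ((2 : ℝ) - 1)
      - 2 * s ^ ((3 / 2 : ℝ) - 1)) ∂halfLine := by
    refine integral_kernelV_mul_pos ?_ fun s hs hs1 => ?_
    · rw [hfun]
      exact (h1.add h2).sub (h0.const_mul 2)
    · norm_num
      rw [← Real.sqrt_eq_rpow]
      have hsq := Real.sq_sqrt hs.le
      have h4 : 0 < (1 - √s) ^ 2 := by
        have : 1 - √s ≠ 0 := by
          rw [sub_ne_zero, ne_comm, Ne, Real.sqrt_eq_one]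
          exact hs1
        positivity
      nlinarith
  rw [hfun, integral_sub (by exact h1.add h2) (h0.const_mul 2), integral_const_mul,
    integral_add h1 h2] at hpos
  change 0 < kernelMoment 1 + kernelMoment 2 - 2 * kernelMoment (3 / 2) at hpos
  linarith

/-- The lower bound `2 s²` on `(0, 1)`, divided by `s`, already integrates to `1`. The explicit
bound for `θ = 0` depends on this. -/
theorem one_le_kernelMoment_zero : 1 ≤ kernelMoment 0 := by
  have h0 := integrable_kernelV_mul_rpow (c := 0) (by norm_num) (by norm_num)
  have h1 : ∫ s in Ioo (0 : ℝ) 1, 2 * s = 1 := by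
    rw [← integral_Ioc_eq_integral_Ioo, ← intervalIntegral.integral_of_le zero_le_one,
      intervalIntegral.integral_const_mul, integral_id]
    norm_num
  have hle : Ioo (0 : ℝ) 1 ⊆ Ioi 0 := fun x hx => hx.1
  rw [← h1]
  calc ∫ s in Ioo (0 : ℝ) 1, 2 * s ≤ ∫ s in Ioo 0 1, kernelV s * s ^ ((0 : ℝ) - 1) := by
        refine setIntegral_mono_on ?_ ?_ measurableSet_Ioo fun s hs => ?_
        · exact (Continuous.integrableOn_Icc (by fun_prop)).mono_set Ioo_subset_Icc_self
        · exact IntegrableOn.mono_set h0 hle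
        · have := le_kernelV hs.1 hs.2
          have h0 := hs.1
          rw [zero_sub, Real.rpow_neg_one, ← div_eq_mul_inv, le_div_iff₀ h0]
          linarith
    _ ≤ _ := setIntegral_mono_set h0 (ae_kernelV_mul_rpow_nonneg 0) hle.eventuallyLE

/-! ### The integral operator -/

/-- The integral operator with kernel `|𝒱(p / q)| / q` on nonnegative extended functions. -/
def absOp (f : ℝ → ℝ≥0∞) (p : ℝ) : ℝ≥0∞ := ∫⁻ q, ‖kernelV (p / q) / q‖ₑ * f q ∂halfLine

/-- The integral operator of the linearized equation. -/
def kernelOp (f : ℝ → ℝ) (p : ℝ) : ℝ := ∫ q, kernelV (p / q) * f q / q ∂halfLine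

theorem measurable_kernelV_div : Measurable fun z : ℝ × ℝ => kernelV (z.1 / z.2) / z.2 :=
  (measurable_kernelV.comp (by fun_prop)).div (by fun_prop)

theorem enorm_kernelV_div {p q : ℝ} (f : ℝ → ℝ) :
    ‖kernelV (p / q) * f q / q‖ₑ = ‖kernelV (p / q) / q‖ₑ * ‖f q‖ₑ := by
  rw [← enorm_mul]
  congr 1
  ring

theorem enorm_kernelOp_le (f : ℝ → ℝ) (p : ℝ) : ‖kernelOp f p‖ₑ ≤ absOp (fun q => ‖f q‖ₑ) p := by
  refine (enorm_integral_le_lintegral_enorm _).trans_eq ?_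
  exact lintegral_congr fun q => enorm_kernelV_div f

theorem absOp_congr {f g : ℝ → ℝ≥0∞} (h : f =ᵐ[halfLine] g) : absOp f = absOp g := by
  ext p
  refine lintegral_congr_ae ?_
  filter_upwards [h] with q hq
  rw [hq]

theorem kernelOp_congr {f g : ℝ → ℝ} (h : f =ᵐ[halfLine] g) : kernelOp f = kernelOp g := by
  ext p
  refine integral_congr_ae ?_
  filter_upwards [h] with q hq
  rw [hq]

theorem measurable_absOp {f : ℝ → ℝ≥0∞} (hf : AEMeasurable f halfLine) : Measurable (absOp f) := by
  rw [absOp_congr hf.ae_eq_mk]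
  exact Measurable.lintegral_prod_right' (f := fun z => ‖kernelV (z.1 / z.2) / z.2‖ₑ * hf.mk f z.2)
    (measurable_kernelV_div.enorm.mul (hf.measurable_mk.comp measurable_snd))

theorem measurable_kernelOp {f : ℝ → ℝ} (hf : AEStronglyMeasurable f halfLine) :
    StronglyMeasurable (kernelOp f) := by
  rw [kernelOp_congr hf.ae_eq_mk]
  refine StronglyMeasurable.integral_prod_right'
    (f := fun z : ℝ × ℝ => kernelV (z.1 / z.2) * hf.mk f z.2 / z.2) ?_
  have h1 : Measurable fun z : ℝ × ℝ => kernelV (z.1 / z.2) :=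
    measurable_kernelV.comp (by fun_prop)
  have h2 : Measurable fun z : ℝ × ℝ => hf.mk f z.2 :=
    hf.stronglyMeasurable_mk.measurable.comp measurable_snd
  exact ((h1.mul h2).div measurable_snd).stronglyMeasurable

theorem aestronglyMeasurable_kernelV_div_mul {f : ℝ → ℝ} (hf : AEStronglyMeasurable f halfLine)
    (p : ℝ) : AEStronglyMeasurable (fun q => kernelV (p / q) * f q / q) halfLine := by
  have h1 : Measurable fun q : ℝ => kernelV (p / q) := measurable_kernelV.comp (by fun_prop)
  simp only [div_eq_mul_inv] at h1 ⊢
  exact (h1.aestronglyMeasurable.mul hf).mul measurable_inv.aestronglyMeasurable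

/-- The integral defining `kernelOp f p` converges absolutely as soon as `absOp |f| p` is finite. -/
theorem integrable_kernelV_div_mul {f : ℝ → ℝ} (hf : AEStronglyMeasurable f halfLine) {p : ℝ}
    (h : absOp (fun q => ‖f q‖ₑ) p < ∞) :
    Integrable (fun q => kernelV (p / q) * f q / q) halfLine := by
  refine ⟨aestronglyMeasurable_kernelV_div_mul hf p, ?_⟩
  rw [HasFiniteIntegral]
  simp only [enorm_kernelV_div]
  exact h

theorem kernelOp_nonneg {f : ℝ → ℝ} (hf : Nonneg f) {p : ℝ} (hp : 0 < p) : 0 ≤ kernelOp f p := by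
  refine integral_nonneg_of_ae ?_
  filter_upwards [hf, ae_halfLine_pos, ae_halfLine_ne p] with q hq hq0 hqp
  have := kernelV_pos (div_pos hp hq0) (fun h => hqp (by rw [div_eq_one_iff_eq hq0.ne'] at h; exact h.symm))
  simp only [Pi.zero_apply]
  positivity

/-- Powers are eigenfunctions, by dilation invariance: the substitution `s = p/q` pulls out `p^r`
and leaves the moment of order `-r`. -/
theorem absOp_rpow {p r : ℝ} (hp : 0 < p) (hr : -5 < r) (hr' : r < 2) :
    absOp (fun q => ENNReal.ofReal (q ^ r)) p = ENNReal.ofReal (p ^ r * kernelMoment (-r)) := by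
  have h := lintegral_halfLine_const_div hp
    (fun s => ENNReal.ofReal (p ^ r) * (‖kernelV s‖ₑ * ENNReal.ofReal (s ^ (-r))))
  have hl : absOp (fun q => ENNReal.ofReal (q ^ r)) p = ∫⁻ x, ENNReal.ofReal x⁻¹ *
      (ENNReal.ofReal (p ^ r) * (‖kernelV (p / x)‖ₑ * ENNReal.ofReal ((p / x) ^ (-r)))) ∂halfLine := by
    refine lintegral_congr_ae ?_
    filter_upwards [ae_halfLine_pos] with q hq
    have e : q ^ r = p ^ r * (p / q) ^ (-r) := by
      rw [Real.div_rpow hp.le hq.le, Real.rpow_neg hp.le, Real.rpow_neg hq.le]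
      field_simp
    rw [e, ENNReal.ofReal_mul (by positivity), div_eq_mul_inv (kernelV (p / q)), enorm_mul,
      Real.enorm_of_nonneg (inv_nonneg.2 hq.le)]
    ring
  rw [hl, h, ENNReal.ofReal_mul (by positivity),
    ← lintegral_enorm_kernelV_mul_rpow (by linarith) (by linarith),
    ← lintegral_const_mul' _ _ ENNReal.ofReal_ne_top]
  refine lintegral_congr_ae ?_
  filter_upwards [ae_halfLine_pos] with s hs
  rw [enorm_mul, Real.rpow_sub_one hs.ne', Real.enorm_of_nonneg (r := s ^ (-r) / s) (by positivity),
    div_eq_mul_inv (s ^ (-r)), ENNReal.ofReal_mul (by positivity)]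
  ring

theorem lintegral_kernelV_div_mul_rpow {q c : ℝ} (hq : 0 < q) (hc : -2 < c) (hc' : c < 5) :
    ∫⁻ p, ‖kernelV (p / q) / q‖ₑ * ENNReal.ofReal (p ^ (c - 1)) ∂halfLine
      = ENNReal.ofReal (kernelMoment c) * ENNReal.ofReal (q ^ (c - 1)) := by
  have h := lintegral_halfLine_div hq
    (fun s => ‖kernelV s * s ^ (c - 1)‖ₑ * ENNReal.ofReal (q ^ (c - 1) * q⁻¹))
  rw [lintegral_mul_const' _ (fun s => ‖kernelV s * s ^ (c - 1)‖ₑ) ENNReal.ofReal_ne_top,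
    lintegral_enorm_kernelV_mul_rpow hc hc'] at h
  calc _ = _ := ?_
    _ = _ := h
    _ = _ := ?_
  · refine lintegral_congr_ae ?_
    filter_upwards [ae_halfLine_pos] with p hp
    rw [div_eq_mul_inv, enorm_mul, enorm_mul, Real.div_rpow hp.le hq.le,
      Real.enorm_of_nonneg (inv_nonneg.2 hq.le),
      Real.enorm_of_nonneg (r := p ^ (c - 1) / q ^ (c - 1)) (by positivity), mul_assoc,
      mul_assoc, ← ENNReal.ofReal_mul (by positivity), ← ENNReal.ofReal_mul (by positivity)]
    congr 2
    have : 0 < q ^ (c - 1) := by positivity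
    field_simp
  · rw [mul_comm, mul_assoc, ← ENNReal.ofReal_mul (by positivity)]
    congr 2
    field_simp

/-- Tonelli, then the dilation `p = q s` in the inner integral. -/
theorem lintegral_absOp_mul_rpow {f : ℝ → ℝ≥0∞} (hf : AEMeasurable f halfLine) {c : ℝ} (hc : -2 < c)
    (hc' : c < 5) :
    ∫⁻ p, absOp f p * ENNReal.ofReal (p ^ (c - 1)) ∂halfLine
      = ENNReal.ofReal (kernelMoment c) * ∫⁻ q, f q * ENNReal.ofReal (q ^ (c - 1)) ∂halfLine := by
  have hm : AEMeasurable (Function.uncurry fun p q : ℝ =>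
      ‖kernelV (p / q) / q‖ₑ * f q * ENNReal.ofReal (p ^ (c - 1))) (halfLine.prod halfLine) := by
    refine AEMeasurable.mul (AEMeasurable.mul measurable_kernelV_div.enorm.aemeasurable ?_) ?_
    · exact hf.comp_quasiMeasurePreserving Measure.quasiMeasurePreserving_snd
    · exact Measurable.aemeasurable (by fun_prop)
  calc ∫⁻ p, absOp f p * ENNReal.ofReal (p ^ (c - 1)) ∂halfLine
      = ∫⁻ p, ∫⁻ q, ‖kernelV (p / q) / q‖ₑ * f q * ENNReal.ofReal (p ^ (c - 1)) ∂halfLine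
          ∂halfLine := by
        refine lintegral_congr fun p => ?_
        rw [absOp, lintegral_mul_const' _ _ ENNReal.ofReal_ne_top]
    _ = ∫⁻ q, ∫⁻ p, ‖kernelV (p / q) / q‖ₑ * f q * ENNReal.ofReal (p ^ (c - 1)) ∂halfLine
          ∂halfLine := lintegral_lintegral_swap hm
    _ = ∫⁻ q, ENNReal.ofReal (kernelMoment c) * (f q * ENNReal.ofReal (q ^ (c - 1)))
          ∂halfLine := by
        refine lintegral_congr_ae ?_
        filter_upwards [ae_halfLine_pos] with q hq
        have hmq : Measurable fun p : ℝ => ‖kernelV (p / q) / q‖ₑ * ENNReal.ofReal (p ^ (c - 1)) :=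
          ((measurable_kernelV.comp (by fun_prop)).div_const q).enorm.mul (by fun_prop)
        rw [mul_left_comm, ← lintegral_kernelV_div_mul_rpow hq hc hc', ← lintegral_const_mul _ hmq]
        refine lintegral_congr fun p => ?_
        ring
    _ = _ := lintegral_const_mul' _ _ ENNReal.ofReal_ne_top

theorem enorm_mul_rpow {p : ℝ} (hp : 0 < p) (x c : ℝ) :
    ‖x * p ^ c‖ₑ = ‖x‖ₑ * ENNReal.ofReal (p ^ c) := by
  rw [enorm_mul, Real.enorm_of_nonneg (r := p ^ c) (by positivity)]

theorem integrable_mul_rpow_iff {f : ℝ → ℝ} (hf : AEStronglyMeasurable f halfLine) (c : ℝ) :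
    Integrable (fun p => f p * p ^ c) halfLine ↔
      ∫⁻ p, ‖f p‖ₑ * ENNReal.ofReal (p ^ c) ∂halfLine < ∞ := by
  have hm : AEStronglyMeasurable (fun p => f p * p ^ c) halfLine :=
    hf.mul (Measurable.aestronglyMeasurable (by fun_prop))
  have : ∫⁻ p, ‖f p * p ^ c‖ₑ ∂halfLine = ∫⁻ p, ‖f p‖ₑ * ENNReal.ofReal (p ^ c) ∂halfLine := by
    refine lintegral_congr_ae ?_
    filter_upwards [ae_halfLine_pos] with p hp using enorm_mul_rpow hp _ _
  rw [← this]
  exact ⟨fun h => h.2, fun h => ⟨hm, h⟩⟩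

theorem integrable_kernelOp_mul_rpow {f : ℝ → ℝ} (hf : AEStronglyMeasurable f halfLine) {c : ℝ}
    (hc : -2 < c) (hc' : c < 5) (hi : Integrable (fun p => f p * p ^ (c - 1)) halfLine) :
    Integrable (fun p => kernelOp f p * p ^ (c - 1)) halfLine := by
  rw [integrable_mul_rpow_iff (measurable_kernelOp hf).aestronglyMeasurable]
  rw [integrable_mul_rpow_iff hf] at hi
  calc _ ≤ ∫⁻ p, absOp (fun q => ‖f q‖ₑ) p * ENNReal.ofReal (p ^ (c - 1)) ∂halfLine := by
        refine lintegral_mono fun p => ?_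
        gcongr
        exact enorm_kernelOp_le f p
    _ < ∞ := by
        rw [lintegral_absOp_mul_rpow hf.enorm hc hc']
        exact ENNReal.mul_lt_top ENNReal.ofReal_lt_top hi

theorem integral_kernelOp_mul_rpow {f : ℝ → ℝ} (hf : AEStronglyMeasurable f halfLine) {c : ℝ}
    (hc : -2 < c) (hc' : c < 5) (hi : Integrable (fun p => f p * p ^ (c - 1)) halfLine) :
    ∫ p, kernelOp f p * p ^ (c - 1) ∂halfLine
      = kernelMoment c * ∫ p, f p * p ^ (c - 1) ∂halfLine := by
  have hm : AEStronglyMeasurable (Function.uncurry fun p q : ℝ =>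
      kernelV (p / q) / q * f q * p ^ (c - 1)) (halfLine.prod halfLine) := by
    refine AEStronglyMeasurable.mul (AEStronglyMeasurable.mul
      measurable_kernelV_div.aestronglyMeasurable ?_) ?_
    · exact hf.comp_quasiMeasurePreserving Measure.quasiMeasurePreserving_snd
    · exact Measurable.aestronglyMeasurable (by fun_prop)
  have hp : Integrable (Function.uncurry fun p q : ℝ =>
      kernelV (p / q) / q * f q * p ^ (c - 1)) (halfLine.prod halfLine) := by
    refine ⟨hm, ?_⟩
    rw [HasFiniteIntegral, lintegral_prod _ hm.enorm]
    have : ∫⁻ p, ∫⁻ q, ‖kernelV (p / q) / q * f q * p ^ (c - 1)‖ₑ ∂halfLine ∂halfLine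
        = ∫⁻ p, absOp (fun q => ‖f q‖ₑ) p * ENNReal.ofReal (p ^ (c - 1)) ∂halfLine := by
      refine lintegral_congr_ae ?_
      filter_upwards [ae_halfLine_pos] with p hp
      rw [absOp, ← lintegral_mul_const' _ _ ENNReal.ofReal_ne_top]
      refine lintegral_congr fun q => ?_
      rw [enorm_mul_rpow hp, enorm_mul]
    simp only [Function.uncurry]
    rw [this, lintegral_absOp_mul_rpow hf.enorm hc hc']
    exact ENNReal.mul_lt_top ENNReal.ofReal_lt_top ((integrable_mul_rpow_iff hf _).1 hi)
  have hinner : ∀ᵐ q ∂halfLine, ∫ p, kernelV (p / q) / q * p ^ (c - 1) ∂halfLine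
      = kernelMoment c * q ^ (c - 1) := by
    filter_upwards [ae_halfLine_pos] with q hq
    have hae : ∀ᵐ p ∂halfLine, 0 ≤ kernelV (p / q) / q * p ^ (c - 1) := by
      filter_upwards [ae_halfLine_pos, ae_halfLine_ne q] with p hp hpq
      have := kernelV_pos (div_pos hp hq) (fun h => hpq (by rwa [div_eq_one_iff_eq hq.ne'] at h))
      positivity
    have hmq : Measurable fun p : ℝ => kernelV (p / q) / q * p ^ (c - 1) :=
      ((measurable_kernelV.comp (by fun_prop)).div_const q).mul (by fun_prop)
    rw [integral_eq_lintegral_of_nonneg_ae hae hmq.aestronglyMeasurable,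
      ← ENNReal.toReal_ofReal (mul_nonneg (kernelMoment_nonneg c) (Real.rpow_nonneg hq.le _)),
      ENNReal.ofReal_mul (kernelMoment_nonneg c), ← lintegral_kernelV_div_mul_rpow hq hc hc']
    congr 1
    refine lintegral_congr_ae ?_
    filter_upwards [ae_halfLine_pos, hae] with p hp hn
    rw [← Real.enorm_of_nonneg hn, enorm_mul_rpow hp]
  calc ∫ p, kernelOp f p * p ^ (c - 1) ∂halfLine
      = ∫ p, ∫ q, kernelV (p / q) / q * f q * p ^ (c - 1) ∂halfLine ∂halfLine := by
        refine integral_congr_ae (ae_of_all _ fun p => ?_)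
        simp only
        rw [kernelOp, ← integral_mul_const]
        refine integral_congr_ae (ae_of_all _ fun q => ?_)
        ring
    _ = ∫ q, ∫ p, kernelV (p / q) / q * f q * p ^ (c - 1) ∂halfLine ∂halfLine :=
        integral_integral_swap hp
    _ = ∫ q, kernelMoment c * (f q * q ^ (c - 1)) ∂halfLine := by
        refine integral_congr_ae ?_
        filter_upwards [hinner] with q hq
        rw [mul_left_comm, ← hq, ← integral_const_mul]
        refine integral_congr_ae (ae_of_all _ fun p => ?_)
        ring
    _ = _ := integral_const_mul _ _

/-! ### Abstract theory in a Banach function space -/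

/-- A function norm on `(0, ∞)` with the countable triangle inequality, for which the integral
operator with kernel `|𝒱(p / q)| / q` is bounded by `C`. -/
structure FunctionNorm (Φ : (ℝ → ℝ≥0∞) → ℝ≥0∞) (C : ℝ) : Prop where
  nonneg : 0 ≤ C
  mono : ∀ {f g : ℝ → ℝ≥0∞}, f ≤ᵐ[halfLine] g → Φ f ≤ Φ g
  const_mul_le : ∀ (c : ℝ≥0∞) (f : ℝ → ℝ≥0∞), c ≠ ∞ → Φ (fun p => c * f p) ≤ c * Φ f
  tsum_le : ∀ f : ℕ → ℝ → ℝ≥0∞, (∀ n, AEMeasurable (f n) halfLine) →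
    Φ (fun p => ∑' n, f n p) ≤ ∑' n, Φ (f n)
  ae_lt_top : ∀ {f : ℝ → ℝ≥0∞}, AEMeasurable f halfLine → Φ f < ∞ → ∀ᵐ p ∂halfLine, f p < ∞
  ae_eq_zero : ∀ {f : ℝ → ℝ≥0∞}, AEMeasurable f halfLine → Φ f = 0 → ∀ᵐ p ∂halfLine, f p = 0
  absOp_le : ∀ {f : ℝ → ℝ≥0∞}, AEMeasurable f halfLine → Φ (absOp f) ≤ ENNReal.ofReal C * Φ f

/-- The norm of real valued functions induced by a norm of extended nonnegative functions. -/
def inducedNorm (Φ : (ℝ → ℝ≥0∞) → ℝ≥0∞) (f : ℝ → ℝ) : ℝ≥0∞ := Φ fun p => ‖f p‖ₑ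

namespace FunctionNorm

variable {Φ : (ℝ → ℝ≥0∞) → ℝ≥0∞} {C : ℝ}

theorem zero (h : FunctionNorm Φ C) : Φ (fun _ => 0) = 0 := by
  have := h.const_mul_le 0 (fun _ => 0) ENNReal.zero_ne_top
  simpa using this

theorem add_le (h : FunctionNorm Φ C) {f g : ℝ → ℝ≥0∞} (hf : AEMeasurable f halfLine) (hg : AEMeasurable g halfLine) :
    Φ (fun p => f p + g p) ≤ Φ f + Φ g := by
  -- The binary triangle inequality is the countable one for the sequence `f, g, 0, 0, …`.
  set F : ℕ → ℝ → ℝ≥0∞ := fun n => if n = 0 then f else if n = 1 then g else fun _ => 0 with hF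
  have h2 := h.tsum_le F (fun n => by
    simp only [hF]
    split_ifs
    exacts [hf, hg, aemeasurable_const])
  have hs : ∀ G : ℕ → ℝ≥0∞, (∀ n, n ∉ Finset.range 2 → G n = 0) → ∑' n, G n = G 0 + G 1 := by
    intro G hG
    rw [tsum_eq_sum hG, Finset.sum_range_succ, Finset.sum_range_one]
  have hz : ∀ n, n ∉ Finset.range 2 → F n = fun _ => 0 := by
    intro n hn
    have : 2 ≤ n := not_lt.1 fun h => hn (Finset.mem_range.2 h)
    simp only [hF]
    rw [if_neg (by omega), if_neg (by omega)]
  rw [hs (fun n => Φ (F n)) (fun n hn => by rw [hz n hn, h.zero])] at h2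
  have hp : (fun p => ∑' n, F n p) = fun p => f p + g p := by
    ext p
    rw [hs (fun n => F n p) (fun n hn => by rw [hz n hn])]
    rfl
  rwa [hp] at h2

theorem norm_mono (h : FunctionNorm Φ C) {f g : ℝ → ℝ} (hfg : ∀ᵐ p ∂halfLine, ‖f p‖ₑ ≤ ‖g p‖ₑ) :
    inducedNorm Φ f ≤ inducedNorm Φ g := h.mono hfg

theorem norm_congr (h : FunctionNorm Φ C) {f g : ℝ → ℝ} (hfg : f =ᵐ[halfLine] g) :
    inducedNorm Φ f = inducedNorm Φ g :=
  le_antisymm (h.norm_mono (hfg.mono fun p hp => by rw [hp]))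
    (h.norm_mono (hfg.mono fun p hp => by rw [hp]))

theorem norm_add_le (h : FunctionNorm Φ C) {f g : ℝ → ℝ} (hf : AEStronglyMeasurable f halfLine)
    (hg : AEStronglyMeasurable g halfLine) :
    inducedNorm Φ (f + g) ≤ inducedNorm Φ f + inducedNorm Φ g :=
  (h.mono (ae_of_all _ fun p => enorm_add_le (f p) (g p))).trans (h.add_le hf.enorm hg.enorm)

theorem norm_smul_le (h : FunctionNorm Φ C) (c : ℝ) (f : ℝ → ℝ) : inducedNorm Φ (c • f) ≤ ‖c‖ₑ * inducedNorm Φ f := by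
  refine (h.mono (ae_of_all _ fun p => ?_)).trans (h.const_mul_le ‖c‖ₑ _ enorm_ne_top)
  simp only [Pi.smul_apply, smul_eq_mul, enorm_mul, le_refl]

theorem norm_neg (f : ℝ → ℝ) : inducedNorm Φ (-f) = inducedNorm Φ f := by
  simp [inducedNorm]

theorem norm_sub_le (h : FunctionNorm Φ C) {f g : ℝ → ℝ} (hf : AEStronglyMeasurable f halfLine)
    (hg : AEStronglyMeasurable g halfLine) :
    inducedNorm Φ (f - g) ≤ inducedNorm Φ f + inducedNorm Φ g := by
  rw [sub_eq_add_neg, ← norm_neg g]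
  exact h.norm_add_le hf hg.neg

theorem norm_kernelOp_le (h : FunctionNorm Φ C) {f : ℝ → ℝ} (hf : AEStronglyMeasurable f halfLine) :
    inducedNorm Φ (kernelOp f) ≤ ENNReal.ofReal C * inducedNorm Φ f :=
  (h.mono (ae_of_all _ fun p => enorm_kernelOp_le f p)).trans (h.absOp_le hf.enorm)

theorem memSpace_add (h : FunctionNorm Φ C) {f g : ℝ → ℝ} (hf : MemSpace (inducedNorm Φ) f)
    (hg : MemSpace (inducedNorm Φ) g) : MemSpace (inducedNorm Φ) (f + g) :=
  ⟨hf.1.add hg.1, (h.norm_add_le hf.1 hg.1).trans_lt (ENNReal.add_lt_top.2 ⟨hf.2, hg.2⟩)⟩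

theorem memSpace_smul (h : FunctionNorm Φ C) {f : ℝ → ℝ} (c : ℝ) (hf : MemSpace (inducedNorm Φ) f) :
    MemSpace (inducedNorm Φ) (c • f) :=
  ⟨hf.1.const_smul c, (h.norm_smul_le c f).trans_lt (ENNReal.mul_lt_top enorm_lt_top hf.2)⟩

theorem memSpace_sub (h : FunctionNorm Φ C) {f g : ℝ → ℝ} (hf : MemSpace (inducedNorm Φ) f)
    (hg : MemSpace (inducedNorm Φ) g) : MemSpace (inducedNorm Φ) (f - g) :=
  ⟨hf.1.sub hg.1, (h.norm_sub_le hf.1 hg.1).trans_lt (ENNReal.add_lt_top.2 ⟨hf.2, hg.2⟩)⟩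

theorem memSpace_kernelOp (h : FunctionNorm Φ C) {f : ℝ → ℝ} (hf : MemSpace (inducedNorm Φ) f) :
    MemSpace (inducedNorm Φ) (kernelOp f) :=
  ⟨(measurable_kernelOp hf.1).aestronglyMeasurable,
    (h.norm_kernelOp_le hf.1).trans_lt (ENNReal.mul_lt_top ENNReal.ofReal_lt_top hf.2)⟩

theorem ae_integrable (h : FunctionNorm Φ C) {f : ℝ → ℝ} (hf : MemSpace (inducedNorm Φ) f) :
    ∀ᵐ p ∂halfLine, Integrable (fun q => kernelV (p / q) * f q / q) halfLine := by
  have hlt : Φ (absOp fun q => ‖f q‖ₑ) < ∞ :=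
    (h.absOp_le hf.1.enorm).trans_lt (ENNReal.mul_lt_top ENNReal.ofReal_lt_top hf.2)
  filter_upwards [h.ae_lt_top (measurable_absOp hf.1.enorm).aemeasurable hlt] with p hp
  exact integrable_kernelV_div_mul hf.1 hp

end FunctionNorm

/-! #### Power series in the integral operator -/

/-- The power series `∑ₙ dₙ Uⁿ f` in the integral operator `U`, summed pointwise. -/
def opSeries (d : ℕ → ℝ) (f : ℝ → ℝ) (p : ℝ) : ℝ := ∑' n, d n * kernelOp^[n] f p

theorem aestronglyMeasurable_iterate {f : ℝ → ℝ} (hf : AEStronglyMeasurable f halfLine) (n : ℕ) :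
    AEStronglyMeasurable (kernelOp^[n] f) halfLine := by
  induction n with
  | zero => exact hf
  | succ n ih =>
    rw [Function.iterate_succ_apply']
    exact (measurable_kernelOp ih).aestronglyMeasurable

theorem aemeasurable_enorm_iterate {f : ℝ → ℝ} (hf : AEStronglyMeasurable f halfLine) (d : ℕ → ℝ)
    (n : ℕ) : AEMeasurable (fun p => ‖d n * kernelOp^[n] f p‖ₑ) halfLine :=
  ((aestronglyMeasurable_iterate hf n).const_mul (d n)).enorm

theorem aemeasurable_tsum_enorm {f : ℝ → ℝ} (hf : AEStronglyMeasurable f halfLine) (d : ℕ → ℝ) :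
    AEMeasurable (fun p => ∑' n, ‖d n * kernelOp^[n] f p‖ₑ) halfLine :=
  AEMeasurable.tsum fun n => aemeasurable_enorm_iterate hf d n

theorem summable_of_tsum_enorm_lt_top {x : ℕ → ℝ} (hx : ∑' n, ‖x n‖ₑ < ∞) : Summable x := by
  simp only [enorm_eq_nnnorm] at hx
  exact Summable.of_nnnorm (ENNReal.tsum_coe_ne_top_iff_summable.1 hx.ne)

theorem aestronglyMeasurable_opSeries {f : ℝ → ℝ} (hf : AEStronglyMeasurable f halfLine)
    (d : ℕ → ℝ) : AEStronglyMeasurable (opSeries d f) halfLine := by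
  have hm : ∀ n, AEMeasurable (kernelOp^[n] f) halfLine := fun n =>
    (aestronglyMeasurable_iterate hf n).aemeasurable
  exact (AEMeasurable.tsum fun n => (hm n).const_mul (d n)).aestronglyMeasurable

namespace FunctionNorm

variable {Φ : (ℝ → ℝ≥0∞) → ℝ≥0∞} {C : ℝ}

theorem norm_iterate_le (h : FunctionNorm Φ C) {f : ℝ → ℝ} (hf : AEStronglyMeasurable f halfLine) (n : ℕ) :
    inducedNorm Φ (kernelOp^[n] f) ≤ ENNReal.ofReal (C ^ n) * inducedNorm Φ f := by
  induction n with
  | zero => simp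
  | succ n ih =>
    rw [Function.iterate_succ_apply', pow_succ', ENNReal.ofReal_mul h.nonneg, mul_assoc]
    exact (h.norm_kernelOp_le (aestronglyMeasurable_iterate hf n)).trans (by gcongr)

/-- Bounding the series of absolute values gives at once the norm of the sum and its pointwise
convergence almost everywhere. It takes the place of completeness of the space. -/
theorem tsum_enorm_le (h : FunctionNorm Φ C) {f : ℝ → ℝ} (hf : AEStronglyMeasurable f halfLine) {d : ℕ → ℝ}
    (hd : Summable fun n => |d n| * C ^ n) :
    Φ (fun p => ∑' n, ‖d n * kernelOp^[n] f p‖ₑ)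
      ≤ ENNReal.ofReal (∑' n, |d n| * C ^ n) * inducedNorm Φ f := by
  have hC := h.nonneg
  refine (h.tsum_le _ fun n => aemeasurable_enorm_iterate hf d n).trans ?_
  rw [ENNReal.ofReal_tsum_of_nonneg (fun n => by positivity) hd, ← ENNReal.tsum_mul_right]
  refine ENNReal.tsum_le_tsum fun n => ?_
  rw [ENNReal.ofReal_mul (abs_nonneg _), mul_assoc, ← Real.norm_eq_abs, ofReal_norm]
  exact (h.norm_smul_le (d n) (kernelOp^[n] f)).trans (by gcongr; exact h.norm_iterate_le hf n)

theorem tsum_enorm_lt_top (h : FunctionNorm Φ C) {f : ℝ → ℝ} (hf : MemSpace (inducedNorm Φ) f) {d : ℕ → ℝ}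
    (hd : Summable fun n => |d n| * C ^ n) :
    Φ (fun p => ∑' n, ‖d n * kernelOp^[n] f p‖ₑ) < ∞ :=
  (h.tsum_enorm_le hf.1 hd).trans_lt (ENNReal.mul_lt_top ENNReal.ofReal_lt_top hf.2)

theorem norm_opSeries_le (h : FunctionNorm Φ C) {f : ℝ → ℝ} (hf : AEStronglyMeasurable f halfLine) {d : ℕ → ℝ}
    (hd : Summable fun n => |d n| * C ^ n) :
    inducedNorm Φ (opSeries d f) ≤ ENNReal.ofReal (∑' n, |d n| * C ^ n) * inducedNorm Φ f :=
  (h.mono (ae_of_all _ fun _ => enorm_tsum_le_tsum_enorm)).trans (h.tsum_enorm_le hf hd)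

theorem memSpace_opSeries (h : FunctionNorm Φ C) {f : ℝ → ℝ} (hf : MemSpace (inducedNorm Φ) f) {d : ℕ → ℝ}
    (hd : Summable fun n => |d n| * C ^ n) : MemSpace (inducedNorm Φ) (opSeries d f) :=
  ⟨aestronglyMeasurable_opSeries hf.1 d,
    (h.norm_opSeries_le hf.1 hd).trans_lt (ENNReal.mul_lt_top ENNReal.ofReal_lt_top hf.2)⟩

theorem ae_summable (h : FunctionNorm Φ C) {f : ℝ → ℝ} (hf : MemSpace (inducedNorm Φ) f) {d : ℕ → ℝ}
    (hd : Summable fun n => |d n| * C ^ n) :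
    ∀ᵐ p ∂halfLine, Summable fun n => d n * kernelOp^[n] f p := by
  filter_upwards [h.ae_lt_top (aemeasurable_tsum_enorm hf.1 d) (h.tsum_enorm_lt_top hf hd)]
    with p hp using summable_of_tsum_enorm_lt_top hp

/-- Sum and integral may be exchanged wherever `absOp` of the series of absolute values is finite,
hence almost everywhere. -/
theorem kernelOp_opSeries (h : FunctionNorm Φ C) {f : ℝ → ℝ} (hf : MemSpace (inducedNorm Φ) f) {d : ℕ → ℝ}
    (hd : Summable fun n => |d n| * C ^ n) :
    ∀ᵐ p ∂halfLine, kernelOp (opSeries d f) p = ∑' n, d n * kernelOp^[n + 1] f p := by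
  have hm := aemeasurable_tsum_enorm hf.1 d
  have hlt := (h.absOp_le hm).trans_lt
    (ENNReal.mul_lt_top ENNReal.ofReal_lt_top (h.tsum_enorm_lt_top hf hd))
  filter_upwards [h.ae_lt_top (measurable_absOp hm).aemeasurable hlt] with p hp
  have hms : ∀ n, AEStronglyMeasurable
      (fun q => kernelV (p / q) * (d n * kernelOp^[n] f q) / q) halfLine := fun n =>
    aestronglyMeasurable_kernelV_div_mul ((aestronglyMeasurable_iterate hf.1 n).const_mul (d n)) p
  have hi := integral_tsum hms (by
    rw [← lintegral_tsum fun n => (hms n).enorm]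
    refine ne_of_lt (lt_of_le_of_lt (lintegral_mono fun q => ?_) hp)
    rw [← ENNReal.tsum_mul_left]
    refine ENNReal.tsum_le_tsum fun n => ?_
    rw [enorm_kernelV_div (fun q => d n * kernelOp^[n] f q)])
  rw [kernelOp]
  simp only [opSeries]
  calc _ = ∫ q, ∑' n, kernelV (p / q) * (d n * kernelOp^[n] f q) / q ∂halfLine := by
        refine integral_congr_ae (ae_of_all _ fun q => ?_)
        simp only
        rw [← tsum_mul_left, tsum_div_const]
    _ = _ := hi
    _ = _ := by
        refine tsum_congr fun n => ?_
        rw [Function.iterate_succ_apply', kernelOp, ← integral_const_mul]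
        refine integral_congr_ae (ae_of_all _ fun q => ?_)
        simp only
        ring

end FunctionNorm

/-! #### The exponential series -/

/-- The coefficients of the solution semigroup as a power series in the integral operator. -/
def solCoef (t : ℝ) (n : ℕ) : ℝ := Real.exp (gammaN * t) * (t ^ n / n.factorial)

/-- The time derivative of `solCoef`. -/
def solCoefDeriv (t : ℝ) (n : ℕ) : ℝ :=
  gammaN * solCoef t n + Real.exp (gammaN * t) * (n * t ^ (n - 1) / n.factorial)

theorem solCoef_nonneg {t : ℝ} (ht : 0 ≤ t) (n : ℕ) : 0 ≤ solCoef t n := by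
  unfold solCoef
  positivity

theorem hasDerivAt_solCoef (t : ℝ) (n : ℕ) :
    HasDerivAt (fun t => solCoef t n) (solCoefDeriv t n) t := by
  have h1 : HasDerivAt (fun t => Real.exp (gammaN * t)) (Real.exp (gammaN * t) * (gammaN * 1)) t :=
    ((hasDerivAt_id t).const_mul gammaN).exp
  refine (h1.mul ((hasDerivAt_pow n t).div_const (n.factorial : ℝ))).congr_deriv ?_
  rw [solCoefDeriv, solCoef]
  ring

theorem solCoefDeriv_zero (t : ℝ) : solCoefDeriv t 0 = gammaN * solCoef t 0 := by
  simp [solCoefDeriv]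

theorem solCoefDeriv_succ (t : ℝ) (n : ℕ) :
    solCoefDeriv t (n + 1) = gammaN * solCoef t (n + 1) + solCoef t n := by
  rw [solCoefDeriv, add_right_inj, solCoef, Nat.factorial_succ]
  push_cast
  congr 1
  have : (n : ℝ) + 1 ≠ 0 := by positivity
  have : (n.factorial : ℝ) ≠ 0 := by positivity
  field_simp

theorem hasSum_pow_div_factorial (x : ℝ) :
    HasSum (fun n : ℕ => x ^ n / n.factorial) (Real.exp x) := by
  rw [Real.exp_eq_exp_ℝ]
  exact NormedSpace.expSeries_div_hasSum_exp x

theorem hasSum_solCoef (t m : ℝ) :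
    HasSum (fun n => solCoef t n * m ^ n) (Real.exp ((gammaN + m) * t)) := by
  have := (hasSum_pow_div_factorial (m * t)).mul_left (Real.exp (gammaN * t))
  rw [← Real.exp_add, ← add_mul] at this
  refine this.congr_fun ?_
  intro n
  rw [solCoef, mul_pow]
  ring

theorem abs_exp_mul_le {t M : ℝ} (ht : |t| ≤ M) :
    |Real.exp (gammaN * t)| ≤ Real.exp (|gammaN| * M) := by
  rw [Real.abs_exp, Real.exp_le_exp]
  exact (le_abs_self _).trans (by rw [abs_mul]; gcongr)

theorem abs_solCoef_le {t M : ℝ} (ht : |t| ≤ M) (n : ℕ) :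
    |solCoef t n| ≤ Real.exp (|gammaN| * M) * (M ^ n / n.factorial) := by
  rw [solCoef, abs_mul, abs_div, abs_pow, Nat.abs_cast]
  gcongr
  exact abs_exp_mul_le ht

theorem abs_solCoefDeriv_le {t M : ℝ} (ht : |t| ≤ M) (n : ℕ) :
    |solCoefDeriv t n| ≤ Real.exp (|gammaN| * M) *
      (|gammaN| * (M ^ n / n.factorial) + n * M ^ (n - 1) / n.factorial) := by
  have h1 : |gammaN * solCoef t n|
      ≤ |gammaN| * (Real.exp (|gammaN| * M) * (M ^ n / n.factorial)) := by
    rw [abs_mul]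
    gcongr
    exact abs_solCoef_le ht n
  have h2 : |Real.exp (gammaN * t) * (n * t ^ (n - 1) / n.factorial)|
      ≤ Real.exp (|gammaN| * M) * (n * M ^ (n - 1) / n.factorial) := by
    rw [abs_mul, abs_div, abs_mul, abs_pow, Nat.abs_cast, Nat.abs_cast]
    gcongr
    exact abs_exp_mul_le ht
  refine (abs_add_le _ _).trans ((add_le_add h1 h2).trans_eq ?_)
  ring

theorem summable_pow_div_factorial_mul (M C : ℝ) :
    Summable fun n : ℕ => M ^ n / n.factorial * C ^ n := by
  refine (Real.summable_pow_div_factorial (M * C)).congr fun n => ?_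
  rw [mul_pow]
  ring

theorem summable_natCast_mul_pow_div_factorial_mul (M C : ℝ) :
    Summable fun n : ℕ => n * M ^ (n - 1) / n.factorial * C ^ n := by
  rw [← summable_nat_add_iff 1]
  refine ((summable_pow_div_factorial_mul M C).mul_right C).congr fun n => ?_
  rw [Nat.factorial_succ, Nat.add_sub_cancel, pow_succ]
  have : (n : ℝ) + 1 ≠ 0 := by positivity
  have : (n.factorial : ℝ) ≠ 0 := by positivity
  push_cast
  field_simp

theorem summable_solCoef_bound (M C : ℝ) : Summable fun n : ℕ =>
    Real.exp (|gammaN| * M) * (M ^ n / n.factorial) * C ^ n :=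
  ((summable_pow_div_factorial_mul M C).mul_left (Real.exp (|gammaN| * M))).congr fun n => by ring

theorem summable_solCoefDeriv_bound (M C : ℝ) : Summable fun n : ℕ =>
    Real.exp (|gammaN| * M) *
      (|gammaN| * (M ^ n / n.factorial) + n * M ^ (n - 1) / n.factorial) * C ^ n := by
  refine (((((summable_pow_div_factorial_mul M C).mul_left |gammaN|).add
    (summable_natCast_mul_pow_div_factorial_mul M C)).mul_left
      (Real.exp (|gammaN| * M)))).congr fun n => ?_
  ring

theorem summable_solCoef {C : ℝ} (hC : 0 ≤ C) (t : ℝ) :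
    Summable fun n => |solCoef t n| * C ^ n :=
  Summable.of_nonneg_of_le (fun n => by positivity)
    (fun n => mul_le_mul_of_nonneg_right (abs_solCoef_le le_rfl n) (by positivity))
    (summable_solCoef_bound |t| C)

theorem summable_solCoefDeriv {C : ℝ} (hC : 0 ≤ C) (t : ℝ) :
    Summable fun n => |solCoefDeriv t n| * C ^ n :=
  Summable.of_nonneg_of_le (fun n => by positivity)
    (fun n => mul_le_mul_of_nonneg_right (abs_solCoefDeriv_le le_rfl n) (by positivity))
    (summable_solCoefDeriv_bound |t| C)

theorem summable_abs_sub {C : ℝ} (hC : 0 ≤ C) {d e : ℕ → ℝ} (hd : Summable fun n => |d n| * C ^ n)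
    (he : Summable fun n => |e n| * C ^ n) : Summable fun n => |d n - e n| * C ^ n :=
  Summable.of_nonneg_of_le (fun n => by positivity)
    (fun n => (mul_le_mul_of_nonneg_right (abs_sub (d n) (e n)) (by positivity)).trans_eq
      (add_mul _ _ _)) (hd.add he)

theorem summable_abs_const_mul {C : ℝ} {d : ℕ → ℝ} (hd : Summable fun n => |d n| * C ^ n) (c : ℝ) :
    Summable fun n => |c * d n| * C ^ n :=
  (hd.mul_left |c|).congr fun n => by rw [abs_mul, mul_assoc]

/-- This weighted `ℓ¹` distance between coefficient sequences dominates the norm of the difference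
of the series, so time regularity reduces to scalar dominated convergence. -/
theorem tendsto_tsum_solCoef_sub {C : ℝ} (hC : 0 ≤ C) (t : ℝ) :
    Tendsto (fun s => ∑' n, |solCoef s n - solCoef t n| * C ^ n) (𝓝 t) (𝓝 0) := by
  rw [show (0 : ℝ) = ∑' _ : ℕ, 0 from tsum_zero.symm]
  refine tendsto_tsum_of_dominated_convergence
    (bound := fun n => 2 * (Real.exp (|gammaN| * (|t| + 1)) * ((|t| + 1) ^ n / n.factorial) * C ^ n))
    ((summable_solCoef_bound _ C).mul_left 2) (fun n => ?_) ?_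
  · have h1 : Tendsto (fun s => |solCoef s n - solCoef t n| * C ^ n) (𝓝 t)
        (𝓝 (|solCoef t n - solCoef t n| * C ^ n)) :=
      ((hasDerivAt_solCoef t n).continuousAt.tendsto.sub_const _).abs.mul_const _
    simpa using h1
  · filter_upwards [Metric.ball_mem_nhds t one_pos] with s hs n
    have hs' : |s| ≤ |t| + 1 := by
      have h1 : |s - t| < 1 := hs
      have h2 := abs_sub_abs_le_abs_sub s t
      linarith
    rw [Real.norm_of_nonneg (by positivity), ← mul_assoc]
    gcongr
    have h1 := abs_solCoef_le hs' n
    have h2 := abs_solCoef_le (show |t| ≤ |t| + 1 by linarith) n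
    have h3 := abs_sub (solCoef s n) (solCoef t n)
    linarith

theorem tendsto_tsum_solCoef_slope {C : ℝ} (hC : 0 ≤ C) (t : ℝ) :
    Tendsto (fun s => ∑' n, |(s - t)⁻¹ * (solCoef s n - solCoef t n) - solCoefDeriv t n| * C ^ n)
      (𝓝[≠] t) (𝓝 0) := by
  rw [show (0 : ℝ) = ∑' _ : ℕ, 0 from tsum_zero.symm]
  set M := |t| + 1 with hM
  refine tendsto_tsum_of_dominated_convergence
    (bound := fun n => 2 * (Real.exp (|gammaN| * M) *
      (|gammaN| * (M ^ n / n.factorial) + n * M ^ (n - 1) / n.factorial) * C ^ n))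
    ((summable_solCoefDeriv_bound M C).mul_left 2) (fun n => ?_) ?_
  · have h1 := (hasDerivAt_solCoef t n).tendsto_slope
    have h2 : Tendsto (fun s => |slope (fun t => solCoef t n) t s - solCoefDeriv t n| * C ^ n)
        (𝓝[≠] t) (𝓝 (|solCoefDeriv t n - solCoefDeriv t n| * C ^ n)) :=
      (h1.sub_const _).abs.mul_const _
    simpa [slope_def_module] using h2
  · filter_upwards [mem_nhdsWithin_of_mem_nhds (Metric.ball_mem_nhds t one_pos),
      self_mem_nhdsWithin] with s hs hst n
    have hs' : |s| ≤ M := by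
      have h1 : |s - t| < 1 := hs
      have h2 := abs_sub_abs_le_abs_sub s t
      linarith
    have ht' : |t| ≤ M := by linarith
    rw [Real.norm_of_nonneg (by positivity), ← mul_assoc]
    gcongr
    set B := Real.exp (|gammaN| * M) *
      (|gammaN| * (M ^ n / n.factorial) + n * M ^ (n - 1) / n.factorial) with hB
    -- The mean value inequality bounds all difference quotients on `[-M, M]` by the bound on the
    -- derivative, which supplies the summable majorant.
    have hmv := (convex_Icc (-M) M).norm_image_sub_le_of_norm_hasDerivWithin_le
      (f := fun t => solCoef t n) (f' := fun t => solCoefDeriv t n) (C := B)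
      (fun x _ => (hasDerivAt_solCoef x n).hasDerivWithinAt)
      (fun x hx => abs_solCoefDeriv_le (abs_le.2 hx) n) (abs_le.1 ht') (abs_le.1 hs')
    have hpos : 0 < |s - t| := abs_pos.2 (sub_ne_zero.2 hst)
    have h1 : |(s - t)⁻¹ * (solCoef s n - solCoef t n)| ≤ B := by
      rw [abs_mul, abs_inv, inv_mul_le_iff₀ hpos, mul_comm]
      exact hmv
    have h2 := abs_solCoefDeriv_le ht' n
    have h3 := abs_sub ((s - t)⁻¹ * (solCoef s n - solCoef t n)) (solCoefDeriv t n)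
    linarith

/-! #### Existence -/

/-- The solution with initial datum `A₀`. -/
def solution (A₀ : ℝ → ℝ) (t : ℝ) : ℝ → ℝ := opSeries (solCoef t) A₀

theorem solution_zero (A₀ : ℝ → ℝ) : solution A₀ 0 = A₀ := by
  ext p
  rw [solution, opSeries, tsum_eq_single 0]
  · simp [solCoef]
  · intro n hn
    simp [solCoef, hn]

theorem nonneg_iterate {A₀ : ℝ → ℝ} (h : Nonneg A₀) (n : ℕ) : Nonneg (kernelOp^[n] A₀) := by
  induction n with
  | zero => exact h
  | succ n ih =>
    rw [Function.iterate_succ_apply']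
    filter_upwards [ae_halfLine_pos] with p hp using kernelOp_nonneg ih hp

theorem nonneg_solution {A₀ : ℝ → ℝ} (h : Nonneg A₀) {t : ℝ} (ht : 0 ≤ t) :
    Nonneg (solution A₀ t) := by
  filter_upwards [ae_all_iff.2 fun n => nonneg_iterate h n] with p hp
  exact tsum_nonneg fun n => mul_nonneg (solCoef_nonneg ht n) (hp n)

theorem tendsto_zero_of_le_ofReal_mul {α : Type*} {l : Filter α} {F : α → ℝ≥0∞} {G : α → ℝ}
    {c : ℝ≥0∞} (hc : c ≠ ∞) (hFG : ∀ᶠ s in l, F s ≤ ENNReal.ofReal (G s) * c)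
    (hG : Tendsto G l (𝓝 0)) : Tendsto F l (𝓝 0) := by
  have h1 : Tendsto (fun s => ENNReal.ofReal (G s) * c) l (𝓝 (ENNReal.ofReal 0 * c)) :=
    ENNReal.Tendsto.mul_const (ENNReal.tendsto_ofReal hG) (Or.inr hc)
  rw [ENNReal.ofReal_zero, zero_mul] at h1
  exact tendsto_of_tendsto_of_tendsto_of_le_of_le' tendsto_const_nhds h1
    (Eventually.of_forall fun _ => zero_le) hFG

namespace FunctionNorm

variable {Φ : (ℝ → ℝ≥0∞) → ℝ≥0∞} {C : ℝ}

theorem memSpace_solution (h : FunctionNorm Φ C) {A₀ : ℝ → ℝ}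
    (hA : MemSpace (inducedNorm Φ) A₀) (t : ℝ) : MemSpace (inducedNorm Φ) (solution A₀ t) :=
  h.memSpace_opSeries hA (summable_solCoef h.nonneg t)

theorem solution_sub_ae_eq (h : FunctionNorm Φ C) {A₀ : ℝ → ℝ}
    (hA : MemSpace (inducedNorm Φ) A₀) (s t : ℝ) :
    solution A₀ s - solution A₀ t =ᵐ[halfLine]
      opSeries (fun n => solCoef s n - solCoef t n) A₀ := by
  filter_upwards [h.ae_summable hA (summable_solCoef h.nonneg s),
    h.ae_summable hA (summable_solCoef h.nonneg t)] with p hs ht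
  simp only [Pi.sub_apply, solution, opSeries, sub_mul]
  exact (hs.tsum_sub ht).symm

/-- The operator shifts the index of the series by one, and the coefficients satisfy `d'ₙ₊₁ = γ_N
dₙ₊₁ + dₙ` and `d'₀ = γ_N d₀`. -/
theorem generator_solution_ae_eq (h : FunctionNorm Φ C) {A₀ : ℝ → ℝ}
    (hA : MemSpace (inducedNorm Φ) A₀) (t : ℝ) :
    gammaN • solution A₀ t + kernelOp (solution A₀ t) =ᵐ[halfLine]
      opSeries (solCoefDeriv t) A₀ := by
  filter_upwards [h.ae_summable hA (summable_solCoef h.nonneg t),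
    h.ae_summable hA (summable_solCoefDeriv h.nonneg t),
    h.kernelOp_opSeries hA (summable_solCoef h.nonneg t)] with p h1 h2 h3
  simp only [Pi.add_apply, Pi.smul_apply, smul_eq_mul, solution]
  have h1' := (summable_nat_add_iff 1).2 h1
  have h2' := (summable_nat_add_iff 1).2 h2
  have h4 : Summable fun n => solCoef t n * kernelOp^[n + 1] A₀ p := by
    refine (h2'.sub (h1'.mul_left gammaN)).congr fun n => ?_
    rw [solCoefDeriv_succ]
    ring
  rw [h3, opSeries, opSeries, h1.tsum_eq_zero_add, h2.tsum_eq_zero_add, mul_add, ← tsum_mul_left,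
    add_assoc, ← (h1'.mul_left gammaN).tsum_add h4, solCoefDeriv_zero]
  congr 1
  · ring
  · refine tsum_congr fun n => ?_
    rw [solCoefDeriv_succ]
    ring

theorem isSolution_solution (h : FunctionNorm Φ C) {A₀ : ℝ → ℝ}
    (hA : MemSpace (inducedNorm Φ) A₀) : IsSolution (inducedNorm Φ) A₀ (solution A₀) := by
  have hcont : ∀ t, Tendsto (fun s => inducedNorm Φ (solution A₀ s - solution A₀ t)) (𝓝 t) (𝓝 0) := by
    intro t
    refine tendsto_zero_of_le_ofReal_mul hA.2.ne (Eventually.of_forall fun s => ?_)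
      (tendsto_tsum_solCoef_sub h.nonneg t)
    rw [h.norm_congr (h.solution_sub_ae_eq hA s t)]
    exact h.norm_opSeries_le hA.1
      (summable_abs_sub h.nonneg (summable_solCoef h.nonneg s) (summable_solCoef h.nonneg t))
  have hgen : ∀ t, MemSpace (inducedNorm Φ)
      (gammaN • solution A₀ t + kernelOp (solution A₀ t)) := fun t =>
    h.memSpace_add (h.memSpace_smul _ (h.memSpace_solution hA t))
      (h.memSpace_kernelOp (h.memSpace_solution hA t))
  refine ⟨fun t _ => h.memSpace_solution hA t, by rw [solution_zero], fun t _ =>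
    (hcont t).mono_left nhdsWithin_le_nhds,
    fun t => gammaN • solution A₀ t + kernelOp (solution A₀ t), fun t _ => ⟨hgen t, ?_, ?_, ?_⟩⟩
  · refine tendsto_zero_of_le_ofReal_mul hA.2.ne (Eventually.of_forall fun s => ?_)
      (tendsto_tsum_solCoef_slope h.nonneg t)
    have hsub := summable_abs_sub h.nonneg (summable_solCoef h.nonneg s)
      (summable_solCoef h.nonneg t)
    have hsm := summable_abs_const_mul hsub (s - t)⁻¹
    have heq : (s - t)⁻¹ • (solution A₀ s - solution A₀ t)
        - (gammaN • solution A₀ t + kernelOp (solution A₀ t)) =ᵐ[halfLine]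
        opSeries (fun n => (s - t)⁻¹ * (solCoef s n - solCoef t n) - solCoefDeriv t n) A₀ := by
      filter_upwards [h.solution_sub_ae_eq hA s t, h.generator_solution_ae_eq hA t,
        h.ae_summable hA hsm, h.ae_summable hA (summable_solCoefDeriv h.nonneg t)]
        with p h1 h2 h3 h4
      rw [Pi.sub_apply, h2, Pi.smul_apply, h1]
      simp only [opSeries, sub_mul (_ * _), smul_eq_mul]
      rw [h3.tsum_sub h4, ← tsum_mul_left]
      simp only [mul_assoc]
    rw [h.norm_congr heq]
    exact h.norm_opSeries_le hA.1
      (summable_abs_sub h.nonneg hsm (summable_solCoefDeriv h.nonneg t))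
  -- The generator is bounded, so continuity of the time derivative follows from continuity of the
  -- solution.
  · have hle : ∀ s, inducedNorm Φ (gammaN • solution A₀ s + kernelOp (solution A₀ s)
        - (gammaN • solution A₀ t + kernelOp (solution A₀ t)))
        ≤ (‖gammaN‖ₑ + ENNReal.ofReal C) * inducedNorm Φ (solution A₀ s - solution A₀ t) := by
      intro s
      have hm := h.memSpace_sub (h.memSpace_solution hA s) (h.memSpace_solution hA t)
      have heq : gammaN • solution A₀ s + kernelOp (solution A₀ s)
          - (gammaN • solution A₀ t + kernelOp (solution A₀ t)) =ᵐ[halfLine]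
          gammaN • (solution A₀ s - solution A₀ t)
            + kernelOp (solution A₀ s - solution A₀ t) := by
        filter_upwards [h.ae_integrable (h.memSpace_solution hA s),
          h.ae_integrable (h.memSpace_solution hA t)] with p h1 h2
        have : kernelOp (solution A₀ s - solution A₀ t) p
            = kernelOp (solution A₀ s) p - kernelOp (solution A₀ t) p := by
          rw [kernelOp, kernelOp, kernelOp, ← integral_sub h1 h2]
          refine integral_congr_ae (ae_of_all _ fun q => ?_)
          simp only [Pi.sub_apply]
          ring
        simp only [Pi.add_apply, Pi.sub_apply, Pi.smul_apply, smul_eq_mul, this]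
        ring
      rw [h.norm_congr heq, add_mul]
      exact (h.norm_add_le (hm.1.const_smul _) (h.memSpace_kernelOp hm).1).trans
        (add_le_add (h.norm_smul_le _ _) (h.norm_kernelOp_le hm.1))
    have h1 := ENNReal.Tendsto.const_mul (hcont t) (a := ‖gammaN‖ₑ + ENNReal.ofReal C)
      (Or.inr (ENNReal.add_ne_top.2 ⟨enorm_ne_top, ENNReal.ofReal_ne_top⟩))
    rw [mul_zero] at h1
    exact tendsto_of_tendsto_of_tendsto_of_le_of_le tendsto_const_nhds h1
      (fun _ => zero_le) hle
  · filter_upwards [h.ae_integrable (h.memSpace_solution hA t)] with p hp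
    exact ⟨hp, rfl⟩

end FunctionNorm

/-! #### Growth bound and uniqueness -/

namespace FunctionNorm

variable {Φ : (ℝ → ℝ≥0∞) → ℝ≥0∞} {C : ℝ}

theorem norm_le_add_norm_sub (h : FunctionNorm Φ C) {f g : ℝ → ℝ}
    (hf : MemSpace (inducedNorm Φ) f) (hg : MemSpace (inducedNorm Φ) g) :
    (inducedNorm Φ f).toReal ≤ (inducedNorm Φ g).toReal + (inducedNorm Φ (f - g)).toReal := by
  have hs := h.memSpace_sub hf hg
  rw [← ENNReal.toReal_add hg.2.ne hs.2.ne]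
  refine ENNReal.toReal_mono (ENNReal.add_ne_top.2 ⟨hg.2.ne, hs.2.ne⟩) ?_
  have := h.norm_add_le hg.1 hs.1
  rwa [add_sub_cancel] at this

theorem abs_toReal_norm_sub_le (h : FunctionNorm Φ C) {f g : ℝ → ℝ}
    (hf : MemSpace (inducedNorm Φ) f) (hg : MemSpace (inducedNorm Φ) g) :
    |(inducedNorm Φ f).toReal - (inducedNorm Φ g).toReal| ≤ (inducedNorm Φ (f - g)).toReal := by
  have h1 := h.norm_le_add_norm_sub hf hg
  have h2 := h.norm_le_add_norm_sub hg hf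
  rw [← neg_sub f g, norm_neg] at h2
  rw [abs_le]
  constructor <;> linarith

theorem continuousOn_norm (h : FunctionNorm Φ C) {A₀ : ℝ → ℝ} {A : ℝ → ℝ → ℝ}
    (hA : IsSolution (inducedNorm Φ) A₀ A) :
    ContinuousOn (fun t => (inducedNorm Φ (A t)).toReal) (Ici 0) := by
  intro t ht
  rw [ContinuousWithinAt, tendsto_iff_dist_tendsto_zero]
  have h1 := (ENNReal.tendsto_toReal ENNReal.zero_ne_top).comp (hA.continuous t ht)
  rw [ENNReal.toReal_zero] at h1
  refine squeeze_zero' (Eventually.of_forall fun _ => dist_nonneg) ?_ h1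
  filter_upwards [self_mem_nhdsWithin] with s hs
  rw [Real.dist_eq]
  exact h.abs_toReal_norm_sub_le (hA.mem s hs) (hA.mem t ht)

/-- One explicit Euler step with error `e`, for a time step `τ` small enough. -/
theorem norm_euler_le (h : FunctionNorm Φ C) {f g e : ℝ → ℝ} {τ : ℝ} (hτ : 0 ≤ τ)
    (hτ' : 0 ≤ 1 + τ * gammaN) (hf : MemSpace (inducedNorm Φ) f) (he : MemSpace (inducedNorm Φ) e)
    (hg : g =ᵐ[halfLine] (1 + τ * gammaN) • f + τ • (kernelOp f + e)) :
    (inducedNorm Φ g).toReal ≤ (1 + τ * (gammaN + C)) * (inducedNorm Φ f).toReal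
      + τ * (inducedNorm Φ e).toReal := by
  have hU := h.memSpace_kernelOp hf
  have hC := h.nonneg
  have hle : inducedNorm Φ g ≤ ENNReal.ofReal (1 + τ * gammaN) * inducedNorm Φ f
      + ENNReal.ofReal τ * (ENNReal.ofReal C * inducedNorm Φ f + inducedNorm Φ e) := by
    rw [h.norm_congr hg]
    refine (h.norm_add_le (hf.1.const_smul _) ((hU.1.add he.1).const_smul _)).trans ?_
    refine add_le_add ((h.norm_smul_le _ _).trans_eq (by rw [Real.enorm_of_nonneg hτ']))
      ((h.norm_smul_le _ _).trans ?_)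
    rw [Real.enorm_of_nonneg hτ]
    gcongr
    exact (h.norm_add_le hU.1 he.1).trans (by gcongr; exact h.norm_kernelOp_le hf.1)
  have h1 : ENNReal.ofReal (1 + τ * gammaN) * inducedNorm Φ f ≠ ∞ :=
    ENNReal.mul_ne_top ENNReal.ofReal_ne_top hf.2.ne
  have h2 : ENNReal.ofReal C * inducedNorm Φ f ≠ ∞ :=
    ENNReal.mul_ne_top ENNReal.ofReal_ne_top hf.2.ne
  have h3 : ENNReal.ofReal τ * (ENNReal.ofReal C * inducedNorm Φ f + inducedNorm Φ e) ≠ ∞ :=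
    ENNReal.mul_ne_top ENNReal.ofReal_ne_top (ENNReal.add_ne_top.2 ⟨h2, he.2.ne⟩)
  refine (ENNReal.toReal_mono (ENNReal.add_ne_top.2 ⟨h1, h3⟩) hle).trans_eq ?_
  rw [ENNReal.toReal_add h1 h3, ENNReal.toReal_mul, ENNReal.toReal_mul,
    ENNReal.toReal_add h2 he.2.ne, ENNReal.toReal_mul, ENNReal.toReal_ofReal hτ',
    ENNReal.toReal_ofReal hτ, ENNReal.toReal_ofReal hC]
  ring

/-- The norm need not be differentiable in time, so Grönwall is applied to right difference
quotients, estimated by one Euler step. For short steps `1 + τ γ_N ≥ 0`, which keeps `γ_N` with its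
sign in the rate instead of `|γ_N|`. -/
theorem norm_isSolution_le_of_pos (h : FunctionNorm Φ C) {A₀ : ℝ → ℝ} {A : ℝ → ℝ → ℝ}
    (hA : IsSolution (inducedNorm Φ) A₀ A) {a b : ℝ} (ha : 0 < a) (hab : a ≤ b) :
    (inducedNorm Φ (A b)).toReal
      ≤ (inducedNorm Φ (A a)).toReal * Real.exp ((gammaN + C) * (b - a)) := by
  obtain ⟨D, hD⟩ := hA.equation
  set n : ℝ → ℝ := fun t => (inducedNorm Φ (A t)).toReal with hn
  have hgr := le_gronwallBound_of_liminf_deriv_right_le (f := n)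
    (f' := fun t => (gammaN + C) * n t) (δ := n a) (K := gammaN + C) (ε := 0) (a := a) (b := b)
    ((h.continuousOn_norm hA).mono fun t ht => ha.le.trans ht.1) ?_ le_rfl
    (fun x _ => by rw [add_zero]) b ⟨hab, le_rfl⟩
  · rwa [gronwallBound_ε0] at hgr
  · intro t ht r hr
    have ht0 : 0 < t := ha.trans_le ht.1
    obtain ⟨hDm, hDlim, -, hDeq⟩ := hD t ht0
    refine Eventually.frequently ?_
    have hlim : Tendsto (fun z => (inducedNorm Φ ((z - t)⁻¹ • (A z - A t) - D t)).toReal)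
        (𝓝[>] t) (𝓝 0) := by
      have := (ENNReal.tendsto_toReal ENNReal.zero_ne_top).comp
        (hDlim.mono_left (nhdsWithin_mono t fun z (hz : t < z) => hz.ne'))
      rwa [ENNReal.toReal_zero] at this
    have hstep : ∀ᶠ z in 𝓝[>] t, 0 ≤ 1 + (z - t) * gammaN := by
      have : Tendsto (fun z => 1 + (z - t) * gammaN) (𝓝[>] t) (𝓝 (1 + (t - t) * gammaN)) :=
        (Continuous.tendsto (by fun_prop) t).mono_left nhdsWithin_le_nhds
      rw [sub_self, zero_mul, add_zero] at this
      exact (this.eventually (lt_mem_nhds one_pos)).mono fun z hz => hz.le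
    filter_upwards [hlim.eventually (gt_mem_nhds (sub_pos.2 hr)), hstep, self_mem_nhdsWithin]
      with z hz hz' htz
    have hτ : 0 < z - t := sub_pos.2 htz
    have hmz := hA.mem z (ht0.trans htz).le
    have hmt := hA.mem t ht0.le
    have hme := h.memSpace_sub (h.memSpace_smul (z - t)⁻¹ (h.memSpace_sub hmz hmt)) hDm
    have := h.norm_euler_le hτ.le hz' hmt hme (g := A z) (by
      filter_upwards [hDeq] with p hp
      have hp2 : D t p = gammaN * A t p + kernelOp (A t) p := hp.2
      simp only [Pi.add_apply, Pi.smul_apply, Pi.sub_apply, smul_eq_mul, hp2]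
      field_simp
      ring)
    rw [inv_mul_lt_iff₀ hτ]
    nlinarith

theorem norm_isSolution_le (h : FunctionNorm Φ C) {A₀ : ℝ → ℝ} {A : ℝ → ℝ → ℝ}
    (hA : IsSolution (inducedNorm Φ) A₀ A) {t : ℝ} (ht : 0 ≤ t) :
    inducedNorm Φ (A t) ≤ ENNReal.ofReal (Real.exp ((gammaN + C) * t)) * inducedNorm Φ A₀ := by
  have h0 := hA.mem 0 le_rfl
  rw [← h.norm_congr hA.init]
  rcases ht.eq_or_lt with rfl | htpos
  · simp
  -- The equation holds only for positive times; the starting time `a` tends to `0` and continuity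
  -- at `0` is used.
  have hcont := (h.continuousOn_norm hA 0 self_mem_Ici).mono Ioi_subset_Ici_self
  have hlim : Tendsto (fun a => (inducedNorm Φ (A a)).toReal * Real.exp ((gammaN + C) * (t - a)))
      (𝓝[>] 0) (𝓝 ((inducedNorm Φ (A 0)).toReal * Real.exp ((gammaN + C) * (t - 0)))) := by
    refine hcont.tendsto.mul ?_
    exact (Continuous.tendsto (by fun_prop) 0).mono_left nhdsWithin_le_nhds
  have hle : (inducedNorm Φ (A t)).toReal
      ≤ (inducedNorm Φ (A 0)).toReal * Real.exp ((gammaN + C) * (t - 0)) := by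
    refine ge_of_tendsto hlim ?_
    filter_upwards [Ioo_mem_nhdsGT htpos] with a ha
    exact h.norm_isSolution_le_of_pos hA ha.1 ha.2.le
  rw [sub_zero, mul_comm] at hle
  rw [← ENNReal.ofReal_toReal (hA.mem t ht).2.ne, ← ENNReal.ofReal_toReal h0.2.ne,
    ← ENNReal.ofReal_mul (Real.exp_nonneg _)]
  exact ENNReal.ofReal_le_ofReal hle

theorem isSolution_sub (h : FunctionNorm Φ C) {A₀ : ℝ → ℝ} {A B : ℝ → ℝ → ℝ}
    (hA : IsSolution (inducedNorm Φ) A₀ A) (hB : IsSolution (inducedNorm Φ) A₀ B) :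
    IsSolution (inducedNorm Φ) 0 (A - B) := by
  have hsq : ∀ {l : Filter ℝ} {F G H : ℝ → ℝ → ℝ}, Tendsto (fun s => inducedNorm Φ (F s)) l (𝓝 0) →
      Tendsto (fun s => inducedNorm Φ (G s)) l (𝓝 0) →
      (∀ᶠ s in l, inducedNorm Φ (H s) ≤ inducedNorm Φ (F s) + inducedNorm Φ (G s)) →
      Tendsto (fun s => inducedNorm Φ (H s)) l (𝓝 0) := by
    intro l F G H h1 h2 h3
    have := h1.add h2
    rw [add_zero] at this
    exact tendsto_of_tendsto_of_tendsto_of_le_of_le' tendsto_const_nhds this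
      (Eventually.of_forall fun _ => zero_le) h3
  obtain ⟨D, hD⟩ := hA.equation
  obtain ⟨E, hE⟩ := hB.equation
  refine ⟨fun t ht => h.memSpace_sub (hA.mem t ht) (hB.mem t ht), ?_, fun t ht => ?_,
    D - E, fun t ht => ?_⟩
  · filter_upwards [hA.init, hB.init] with p h1 h2
    simp [h1, h2]
  · refine hsq (hA.continuous t ht) (hB.continuous t ht) ?_
    filter_upwards [self_mem_nhdsWithin] with s hs
    rw [Pi.sub_apply, Pi.sub_apply, sub_sub_sub_comm]
    exact h.norm_sub_le ((hA.mem s hs).1.sub (hA.mem t ht).1)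
      ((hB.mem s hs).1.sub (hB.mem t ht).1)
  · obtain ⟨hD1, hD2, hD3, hD4⟩ := hD t ht
    obtain ⟨hE1, hE2, hE3, hE4⟩ := hE t ht
    have hpos : ∀ᶠ s in 𝓝 t, 0 < s := lt_mem_nhds ht
    refine ⟨h.memSpace_sub hD1 hE1, ?_, ?_, ?_⟩
    · refine hsq hD2 hE2 ?_
      filter_upwards [mem_nhdsWithin_of_mem_nhds hpos] with s hs
      have hs : 0 < s := hs
      have e : (s - t)⁻¹ • ((A - B) s - (A - B) t) - (D - E) t
          = ((s - t)⁻¹ • (A s - A t) - D t) - ((s - t)⁻¹ • (B s - B t) - E t) := by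
        simp only [Pi.sub_apply, smul_sub]
        abel
      rw [e]
      exact h.norm_sub_le
        ((((hA.mem s hs.le).1.sub (hA.mem t ht.le).1).const_smul _).sub hD1.1)
        ((((hB.mem s hs.le).1.sub (hB.mem t ht.le).1).const_smul _).sub hE1.1)
    · refine hsq hD3 hE3 ?_
      filter_upwards [hpos] with s hs
      rw [Pi.sub_apply, Pi.sub_apply, sub_sub_sub_comm]
      exact h.norm_sub_le ((hD s hs).1.1.sub hD1.1) ((hE s hs).1.1.sub hE1.1)
    · filter_upwards [hD4, hE4] with p h1 h2
      have e : (fun q => kernelV (p / q) * (A - B) t q / q)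
          = fun q => kernelV (p / q) * A t q / q - kernelV (p / q) * B t q / q := by
        ext q
        simp only [Pi.sub_apply]
        ring
      rw [e]
      refine ⟨h1.1.sub h2.1, ?_⟩
      rw [integral_sub h1.1 h2.1]
      simp only [Pi.sub_apply, h1.2, h2.2]
      ring

theorem isSolution_unique (h : FunctionNorm Φ C) {A₀ : ℝ → ℝ} {A B : ℝ → ℝ → ℝ}
    (hA : IsSolution (inducedNorm Φ) A₀ A) (hB : IsSolution (inducedNorm Φ) A₀ B) {t : ℝ}
    (ht : 0 ≤ t) : A t =ᵐ[halfLine] B t := by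
  have h1 := h.norm_isSolution_le (h.isSolution_sub hA hB) ht
  have h0 : inducedNorm Φ 0 = 0 := by
    have := h.zero
    simpa [inducedNorm] using this
  rw [h0, mul_zero, nonpos_iff_eq_zero] at h1
  filter_upwards [h.ae_eq_zero ((hA.mem t ht).1.sub (hB.mem t ht).1).enorm h1] with p hp
  have : A t p - B t p = 0 := by simpa using hp
  linarith

theorem memSpace_of_isSolution (h : FunctionNorm Φ C) {A₀ : ℝ → ℝ} {A : ℝ → ℝ → ℝ}
    (hA : IsSolution (inducedNorm Φ) A₀ A) : MemSpace (inducedNorm Φ) A₀ := by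
  have h0 := hA.mem 0 le_rfl
  exact ⟨h0.1.congr hA.init, by rw [← h.norm_congr hA.init]; exact h0.2⟩

/-- The series makes no reference to the norm. A solution found in one space can therefore be
studied in any other admissible space containing its datum, in particular in a weighted `L¹` space.
-/
theorem isSolution_ae_eq_solution (h : FunctionNorm Φ C) {A₀ : ℝ → ℝ} {A : ℝ → ℝ → ℝ}
    (hA : IsSolution (inducedNorm Φ) A₀ A) {t : ℝ} (ht : 0 ≤ t) :
    A t =ᵐ[halfLine] solution A₀ t :=
  h.isSolution_unique hA (h.isSolution_solution (h.memSpace_of_isSolution hA)) ht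

theorem wellPosed (h : FunctionNorm Φ C) : WellPosed (inducedNorm Φ) := by
  refine ⟨fun A₀ hA hpos => ⟨solution A₀, h.isSolution_solution hA,
    fun t ht => nonneg_solution hpos ht, fun B hB t ht => h.isSolution_ae_eq_solution hB ht⟩,
    fun T hT => ⟨Real.exp (|gammaN + C| * T), Real.exp_pos _, fun A₀ A _ hA t ht => ?_⟩⟩
  -- The absolute value in the constant makes the exponent monotone in `t` whatever the sign of the
  -- rate.
  refine (h.norm_isSolution_le hA ht.1).trans ?_
  gcongr
  · exact ht.1
  · exact le_abs_self _
  · exact ht.2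

end FunctionNorm

/-! ### The spaces `L^q_θ` and `𝒴_{a,b}` -/

/-! ### Minkowski and Jensen inequalities for extended nonnegative functions. -/

section ENNRealLp

variable {α : Type*} {m : MeasurableSpace α} {μ : Measure α}

theorem eLpNorm_ofReal_eq {q : ℝ} (hq : 1 ≤ q) (f : α → ℝ≥0∞) :
    eLpNorm f (ENNReal.ofReal q) μ = (∫⁻ x, f x ^ q ∂μ) ^ (1 / q) := by
  have hq0 : 0 < q := by linarith
  rw [eLpNorm_eq_lintegral_rpow_enorm_toReal (by simpa using hq0) ENNReal.ofReal_ne_top,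
    ENNReal.toReal_ofReal hq0.le]
  rfl

theorem eLpNorm_sum_range_le {p : ℝ≥0∞} (hp : 1 ≤ p) {f : ℕ → α → ℝ≥0∞}
    (hf : ∀ n, AEMeasurable (f n) μ) (n : ℕ) :
    eLpNorm (fun x => ∑ i ∈ Finset.range n, f i x) p μ
      ≤ ∑ i ∈ Finset.range n, eLpNorm (f i) p μ := by
  induction n with
  | zero => simp
  | succ n ih =>
    simp only [Finset.sum_range_succ]
    refine (eLpNorm_add_le (f := fun x => ∑ i ∈ Finset.range n, f i x) ?_
      (hf n).aestronglyMeasurable hp).trans (by gcongr)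
    exact (Finset.aemeasurable_fun_sum _ fun i _ => hf i).aestronglyMeasurable

/-- Finite Minkowski for the partial sums, then monotone convergence. -/
theorem eLpNorm_ofReal_tsum_le {q : ℝ} (hq : 1 ≤ q) {f : ℕ → α → ℝ≥0∞}
    (hf : ∀ n, AEMeasurable (f n) μ) :
    eLpNorm (fun x => ∑' n, f n x) (ENNReal.ofReal q) μ
      ≤ ∑' n, eLpNorm (f n) (ENNReal.ofReal q) μ := by
  have hq0 : 0 < q := by linarith
  rw [eLpNorm_ofReal_eq hq, one_div, ENNReal.rpow_inv_le_iff hq0]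
  have hsup : ∀ x, (∑' n, f n x) ^ q = ⨆ n, (∑ i ∈ Finset.range n, f i x) ^ q := fun x => by
    rw [ENNReal.tsum_eq_iSup_nat]
    exact (ENNReal.orderIsoRpow q hq0).map_iSup _
  simp only [hsup]
  rw [lintegral_iSup' (fun n => (Finset.aemeasurable_fun_sum _ fun i _ => hf i).pow_const q)]
  · refine iSup_le fun n => ?_
    rw [← ENNReal.rpow_inv_le_iff hq0, ← one_div, ← eLpNorm_ofReal_eq hq]
    exact (eLpNorm_sum_range_le (by simpa using hq) hf n).trans (ENNReal.sum_le_tsum _)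
  · refine ae_of_all _ fun x => fun i j hij => ?_
    exact ENNReal.rpow_le_rpow (Finset.sum_le_sum_of_subset (Finset.range_mono hij)) hq0.le

theorem eLpNorm_ofReal_const_mul_le {q : ℝ} (hq : 1 ≤ q) {c : ℝ≥0∞} (hc : c ≠ ∞) (f : α → ℝ≥0∞) :
    eLpNorm (fun x => c * f x) (ENNReal.ofReal q) μ ≤ c * eLpNorm f (ENNReal.ofReal q) μ := by
  have hq0 : 0 < q := by linarith
  rw [eLpNorm_ofReal_eq hq, eLpNorm_ofReal_eq hq]
  simp only [ENNReal.mul_rpow_of_nonneg _ _ hq0.le]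
  rw [lintegral_const_mul' _ _ (ENNReal.rpow_ne_top_of_nonneg hq0.le hc),
    ENNReal.mul_rpow_of_nonneg _ _ (by positivity), ← ENNReal.rpow_mul, mul_one_div_cancel hq0.ne',
    ENNReal.rpow_one]

/-- Comparison of the `L¹` and `L^q` norms of `g` for the measure `k dμ`, whose total mass is `∫ k`.
-/
theorem lintegral_mul_rpow_le {q : ℝ} (hq : 1 ≤ q) {k g : α → ℝ≥0∞} (hk : AEMeasurable k μ)
    (hg : AEMeasurable g μ) :
    (∫⁻ x, k x * g x ∂μ) ^ q ≤ (∫⁻ x, k x ∂μ) ^ (q - 1) * ∫⁻ x, k x * g x ^ q ∂μ := by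
  have hq0 : 0 < q := by linarith
  have h := eLpNorm'_le_eLpNorm'_mul_rpow_measure_univ (μ := μ.withDensity k) one_pos hq
    (hg.mono_ac (withDensity_absolutelyContinuous μ k)).aestronglyMeasurable
  simp only [eLpNorm'_eq_lintegral_enorm, enorm_eq_self, ENNReal.rpow_one, one_div_one] at h
  rw [lintegral_withDensity_eq_lintegral_mul₀ hk hg,
    lintegral_withDensity_eq_lintegral_mul₀ hk (hg.pow_const q),
    withDensity_apply _ MeasurableSet.univ, Measure.restrict_univ] at h
  refine (ENNReal.rpow_le_rpow h hq0.le).trans_eq ?_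
  rw [ENNReal.mul_rpow_of_nonneg _ _ hq0.le, ← ENNReal.rpow_mul, ← ENNReal.rpow_mul,
    one_div_mul_cancel hq0.ne', ENNReal.rpow_one, sub_mul, one_div_mul_cancel hq0.ne', one_mul,
    mul_comm]
  rfl

end ENNRealLp

/-! ### Boundedness of the operator on `L^q_θ`. -/

/-- The measure `p^(2θ-1) dp` on the half line. -/
def weightedHalfLine (θ : ℝ) : Measure ℝ :=
  halfLine.withDensity fun p => ENNReal.ofReal (p ^ (2 * θ - 1))

theorem weightedHalfLine_absolutelyContinuous (θ : ℝ) : weightedHalfLine θ ≪ halfLine :=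
  withDensity_absolutelyContinuous _ _

theorem halfLine_absolutelyContinuous (θ : ℝ) : halfLine ≪ weightedHalfLine θ := by
  refine withDensity_absolutelyContinuous' (Measurable.aemeasurable (by fun_prop)) ?_
  filter_upwards [ae_halfLine_pos] with p hp
  have : 0 < p ^ (2 * θ - 1) := by positivity
  simpa using this

theorem lintegral_weightedHalfLine {θ : ℝ} {f : ℝ → ℝ≥0∞} (hf : AEMeasurable f halfLine) :
    ∫⁻ p, f p ∂weightedHalfLine θ = ∫⁻ p, f p * ENNReal.ofReal (p ^ (2 * θ - 1)) ∂halfLine := by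
  rw [weightedHalfLine,
    lintegral_withDensity_eq_lintegral_mul₀ (Measurable.aemeasurable (by fun_prop)) hf]
  exact lintegral_congr fun p => mul_comm _ _

theorem normLq_eq (q θ : ℝ) :
    normLq q θ = inducedNorm fun f => eLpNorm f (ENNReal.ofReal q) (weightedHalfLine θ) := by
  ext f
  exact (eLpNorm_enorm f).symm

theorem ofReal_rpow_mul_ofReal_rpow {p : ℝ} (hp : 0 < p) (r s : ℝ) :
    ENNReal.ofReal (p ^ r) * ENNReal.ofReal (p ^ s) = ENNReal.ofReal (p ^ (r + s)) := by
  rw [← ENNReal.ofReal_mul (by positivity), ← Real.rpow_add hp]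

theorem ofReal_rpow_rpow {p : ℝ} (hp : 0 < p) (r s : ℝ) :
    ENNReal.ofReal (p ^ r) ^ s = ENNReal.ofReal (p ^ (r * s)) := by
  rw [ENNReal.ofReal_rpow_of_pos (by positivity), ← Real.rpow_mul hp.le]

/-- Schur test: write `f = x^(-α) · (x^α f)`, put `x^(-α)` into the kernel and apply Jensen. The
weighted kernel has total mass `m(α) p^(-α)` because powers are eigenfunctions. -/
theorem absOp_rpow_le {q α : ℝ} (hq : 1 ≤ q) (hα : -2 < α) (hα' : α < 5) {f : ℝ → ℝ≥0∞}
    (hf : AEMeasurable f halfLine) {p : ℝ} (hp : 0 < p) :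
    absOp f p ^ q ≤ ENNReal.ofReal (kernelMoment α) ^ (q - 1) *
      (ENNReal.ofReal (p ^ (-α * (q - 1))) *
        absOp (fun x => f x ^ q * ENNReal.ofReal (x ^ (α * (q - 1)))) p) := by
  have hmp : Measurable fun x : ℝ => ‖kernelV (p / x) / x‖ₑ :=
    ((measurable_kernelV.comp (by fun_prop)).div measurable_id).enorm
  have hk : AEMeasurable (fun x : ℝ => ‖kernelV (p / x) / x‖ₑ * ENNReal.ofReal (x ^ (-α)))
      halfLine := (hmp.mul (by fun_prop)).aemeasurable
  have hg : AEMeasurable (fun x => f x * ENNReal.ofReal (x ^ α)) halfLine :=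
    hf.mul (Measurable.aemeasurable (by fun_prop))
  have hJ := lintegral_mul_rpow_le hq hk hg
  have e1 : ∫⁻ x, ‖kernelV (p / x) / x‖ₑ * ENNReal.ofReal (x ^ (-α)) *
      (f x * ENNReal.ofReal (x ^ α)) ∂halfLine = absOp f p := by
    refine lintegral_congr_ae ?_
    filter_upwards [ae_halfLine_pos] with x hx
    rw [mul_assoc, mul_left_comm (ENNReal.ofReal (x ^ (-α))), ofReal_rpow_mul_ofReal_rpow hx,
      neg_add_cancel, Real.rpow_zero, ENNReal.ofReal_one, mul_one]
  have e2 : ∫⁻ x, ‖kernelV (p / x) / x‖ₑ * ENNReal.ofReal (x ^ (-α)) ∂halfLine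
      = ENNReal.ofReal (kernelMoment α) * ENNReal.ofReal (p ^ (-α)) := by
    have := absOp_rpow hp (r := -α) (by linarith) (by linarith)
    rw [neg_neg, mul_comm, ENNReal.ofReal_mul (kernelMoment_nonneg α)] at this
    exact this
  have e3 : ∫⁻ x, ‖kernelV (p / x) / x‖ₑ * ENNReal.ofReal (x ^ (-α)) *
      (f x * ENNReal.ofReal (x ^ α)) ^ q ∂halfLine
      = absOp (fun x => f x ^ q * ENNReal.ofReal (x ^ (α * (q - 1)))) p := by
    refine lintegral_congr_ae ?_
    filter_upwards [ae_halfLine_pos] with x hx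
    rw [ENNReal.mul_rpow_of_nonneg _ _ (by linarith), ofReal_rpow_rpow hx, mul_assoc,
      mul_left_comm (ENNReal.ofReal (x ^ (-α))), ofReal_rpow_mul_ofReal_rpow hx,
      show -α + α * q = α * (q - 1) by ring]
  rw [e1, e2, e3, ENNReal.mul_rpow_of_nonneg _ _ (by linarith), ofReal_rpow_rpow hp, mul_assoc] at hJ
  exact hJ

theorem functionNorm_lq {q θ : ℝ} (hq : 1 ≤ q) (hθ : θ ∈ Ioo (-1 : ℝ) (5 / 2)) :
    FunctionNorm (fun f => eLpNorm f (ENNReal.ofReal q) (weightedHalfLine θ))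
      (kernelMoment (2 * θ / q)) := by
  have hq0 : 0 < q := by linarith
  have hac := weightedHalfLine_absolutelyContinuous θ
  have hac' := halfLine_absolutelyContinuous θ
  refine ⟨kernelMoment_nonneg _, fun hfg => ?_, fun c f hc => eLpNorm_ofReal_const_mul_le hq hc f,
    fun f hf => eLpNorm_ofReal_tsum_le hq fun n => (hf n).mono_ac hac, fun hf hlt => ?_,
    fun hf h0 => ?_, fun {f} hf => ?_⟩
  · exact eLpNorm_mono_enorm_ae (hac.ae_le hfg)
  · rw [eLpNorm_ofReal_eq hq] at hlt
    have h1 := (ENNReal.rpow_lt_top_iff_of_pos (by positivity)).1 hlt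
    refine hac'.ae_le ?_
    filter_upwards [ae_lt_top' ((hf.mono_ac hac).pow_const q) h1.ne] with p hp
    exact (ENNReal.rpow_lt_top_iff_of_pos hq0).1 hp
  · refine hac'.ae_le ?_
    exact (eLpNorm_eq_zero_iff (hf.mono_ac hac).aestronglyMeasurable (by simpa using hq0)).1 h0
  -- The Schur exponent is fixed by requiring `α (q - 1) + (α - 1) = 2θ - 1`, so that the original
  -- weight returns. Since `q ≥ 1`, the range of `θ` keeps `α` inside the strip `(-2, 5)`.
  · set α := 2 * θ / q with hα
    have hαq : α * q = 2 * θ := by rw [hα]; field_simp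
    have hα2 : -2 < α := by
      rw [hα, lt_div_iff₀ hq0]
      nlinarith [hθ.1]
    have hα5 : α < 5 := by
      rw [hα, div_lt_iff₀ hq0]
      nlinarith [hθ.2]
    rw [eLpNorm_ofReal_eq hq, eLpNorm_ofReal_eq hq, one_div, ENNReal.rpow_inv_le_iff hq0,
      ENNReal.mul_rpow_of_nonneg _ _ hq0.le, ← ENNReal.rpow_mul, inv_mul_cancel₀ hq0.ne',
      ENNReal.rpow_one, lintegral_weightedHalfLine ((measurable_absOp hf).pow_const q).aemeasurable,
      lintegral_weightedHalfLine (hf.pow_const q)]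
    have hFm : AEMeasurable (fun x => f x ^ q * ENNReal.ofReal (x ^ (α * (q - 1)))) halfLine :=
      (hf.pow_const q).mul (Measurable.aemeasurable (by fun_prop))
    have hMne : ENNReal.ofReal (kernelMoment α) ^ (q - 1) ≠ ∞ :=
      ENNReal.rpow_ne_top_of_nonneg (by linarith) ENNReal.ofReal_ne_top
    calc ∫⁻ p, absOp f p ^ q * ENNReal.ofReal (p ^ (2 * θ - 1)) ∂halfLine
        ≤ ∫⁻ p, ENNReal.ofReal (kernelMoment α) ^ (q - 1) *
          (absOp (fun x => f x ^ q * ENNReal.ofReal (x ^ (α * (q - 1)))) p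
            * ENNReal.ofReal (p ^ (α - 1))) ∂halfLine := by
          refine lintegral_mono_ae ?_
          filter_upwards [ae_halfLine_pos] with p hp
          refine (mul_le_mul_left (absOp_rpow_le hq hα2 hα5 hf hp) _).trans_eq ?_
          rw [show α - 1 = -α * (q - 1) + (2 * θ - 1) by rw [← hαq]; ring,
            ← ofReal_rpow_mul_ofReal_rpow hp]
          ring
      _ = ENNReal.ofReal (kernelMoment α) ^ (q - 1) * (ENNReal.ofReal (kernelMoment α) *
          ∫⁻ p, f p ^ q * ENNReal.ofReal (p ^ (α * (q - 1))) * ENNReal.ofReal (p ^ (α - 1))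
            ∂halfLine) := by
          rw [lintegral_const_mul' _ _ hMne, lintegral_absOp_mul_rpow hFm hα2 hα5]
      _ = ENNReal.ofReal (kernelMoment α) ^ q *
          ∫⁻ p, f p ^ q * ENNReal.ofReal (p ^ (2 * θ - 1)) ∂halfLine := by
          rw [← mul_assoc]
          congr 1
          · nth_rw 2 [← ENNReal.rpow_one (ENNReal.ofReal (kernelMoment α))]
            rw [← ENNReal.rpow_add_of_nonneg _ _ (by linarith) zero_le_one, sub_add_cancel]
          · refine lintegral_congr_ae ?_
            filter_upwards [ae_halfLine_pos] with p hp
            rw [mul_assoc, ofReal_rpow_mul_ofReal_rpow hp,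
              show α * (q - 1) + (α - 1) = 2 * θ - 1 by rw [← hαq]; ring]
      _ ≤ _ := le_rfl

/-! #### The spaces `𝒴_{a,b}` -/

/-- The norm of `𝒴_{a,b}` on extended nonnegative functions. -/
def normYE (a b : ℝ) (f : ℝ → ℝ≥0∞) : ℝ≥0∞ :=
  eLpNorm (fun p => ENNReal.ofReal (p ^ (-2 * a)) * f p) ∞ (volume.restrict (Ioo 0 1)) +
    eLpNorm (fun p => ENNReal.ofReal (p ^ (-2 * b)) * f p) ∞ (volume.restrict (Ioi 1))

theorem normY_eq (a b : ℝ) : normY a b = inducedNorm (normYE a b) := by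
  ext f
  refine congrArg₂ (· + ·) (eLpNorm_congr_enorm_ae ?_) (eLpNorm_congr_enorm_ae ?_)
  · filter_upwards [ae_restrict_mem measurableSet_Ioo] with p hp
    rw [enorm_mul, Real.enorm_of_nonneg (Real.rpow_nonneg hp.1.le _), enorm_eq_self]
  · filter_upwards [ae_restrict_mem measurableSet_Ioi] with p hp
    have : (0 : ℝ) ≤ p := zero_le_one.trans (le_of_lt hp)
    rw [enorm_mul, Real.enorm_of_nonneg (Real.rpow_nonneg this _), enorm_eq_self]

theorem ae_halfLine_iff {P : ℝ → Prop} : (∀ᵐ p ∂halfLine, P p) ↔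
    (∀ᵐ p ∂(volume.restrict (Ioo (0 : ℝ) 1)), P p) ∧
      ∀ᵐ p ∂(volume.restrict (Ioi (1 : ℝ))), P p := by
  have h1 : (Ioi (0 : ℝ)) = Ioc 0 1 ∪ Ioi 1 := (Ioc_union_Ioi_eq_Ioi zero_le_one).symm
  rw [halfLine, h1, ae_restrict_union_iff, Measure.restrict_congr_set Ioo_ae_eq_Ioc]

theorem normYE_le {a b : ℝ} {f : ℝ → ℝ≥0∞} {s t : ℝ≥0∞}
    (hs : ∀ᵐ p ∂halfLine, f p ≤ s * ENNReal.ofReal (p ^ (2 * a)))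
    (ht : ∀ᵐ p ∂halfLine, f p ≤ t * ENNReal.ofReal (p ^ (2 * b))) : normYE a b f ≤ s + t := by
  have key : ∀ {p c : ℝ} {s : ℝ≥0∞}, 0 < p → f p ≤ s * ENNReal.ofReal (p ^ (2 * c)) →
      ENNReal.ofReal (p ^ (-2 * c)) * f p ≤ s := fun {p c s} hp hle => by
    calc _ ≤ ENNReal.ofReal (p ^ (-2 * c)) * (s * ENNReal.ofReal (p ^ (2 * c))) := by gcongr
      _ = s := by
        rw [mul_left_comm, ofReal_rpow_mul_ofReal_rpow hp,
          show -2 * c + 2 * c = 0 by ring, Real.rpow_zero, ENNReal.ofReal_one, mul_one]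
  refine add_le_add ?_ ?_
  · rw [eLpNorm_exponent_top]
    refine eLpNormEssSup_le_of_ae_enorm_bound ?_
    filter_upwards [(ae_halfLine_iff.1 hs).1, ae_restrict_mem measurableSet_Ioo] with p h1 h2
    exact key h2.1 h1
  · rw [eLpNorm_exponent_top]
    refine eLpNormEssSup_le_of_ae_enorm_bound ?_
    filter_upwards [(ae_halfLine_iff.1 ht).2, ae_restrict_mem measurableSet_Ioi] with p h1 h2
    exact key (one_pos.trans h2) h1

/-- As `b ≤ a`, the power `p^(2a)` is the smaller one on `(0, 1)` and the larger one on `(1, ∞)`.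
Each one-sided bound thus extends to the whole half line, where the operator acts diagonally on
powers. -/
theorem ae_le_normYE {a b : ℝ} (hab : b ≤ a) (f : ℝ → ℝ≥0∞) : ∀ᵐ p ∂halfLine,
    f p ≤ normYE a b f * ENNReal.ofReal (p ^ (2 * a)) ∧
      f p ≤ normYE a b f * ENNReal.ofReal (p ^ (2 * b)) := by
  have key : ∀ {p c : ℝ} {s : ℝ≥0∞}, 0 < p → ENNReal.ofReal (p ^ (-2 * c)) * f p ≤ s →
      f p ≤ s * ENNReal.ofReal (p ^ (2 * c)) := fun {p c s} hp hle => by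
    calc f p = ENNReal.ofReal (p ^ (-2 * c)) * f p * ENNReal.ofReal (p ^ (2 * c)) := by
          rw [mul_right_comm, ofReal_rpow_mul_ofReal_rpow hp,
            show -2 * c + 2 * c = 0 by ring, Real.rpow_zero, ENNReal.ofReal_one, one_mul]
      _ ≤ _ := by gcongr
  rw [ae_halfLine_iff]
  constructor
  · have h1 := ae_le_eLpNormEssSup (f := fun p => ENNReal.ofReal (p ^ (-2 * a)) * f p)
      (μ := volume.restrict (Ioo (0 : ℝ) 1))
    filter_upwards [h1, ae_restrict_mem measurableSet_Ioo] with p h1 h2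
    have h3 : f p ≤ normYE a b f * ENNReal.ofReal (p ^ (2 * a)) := by
      refine key h2.1 (le_trans h1 ?_)
      rw [← eLpNorm_exponent_top]
      exact le_self_add
    refine ⟨h3, h3.trans ?_⟩
    gcongr normYE a b f * ENNReal.ofReal ?_
    exact Real.rpow_le_rpow_of_exponent_ge h2.1 h2.2.le (by linarith)
  · have h1 := ae_le_eLpNormEssSup (f := fun p => ENNReal.ofReal (p ^ (-2 * b)) * f p)
      (μ := volume.restrict (Ioi (1 : ℝ)))
    filter_upwards [h1, ae_restrict_mem measurableSet_Ioi] with p h1 (h2 : 1 < p)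
    have h3 : f p ≤ normYE a b f * ENNReal.ofReal (p ^ (2 * b)) := by
      refine key (one_pos.trans h2) (le_trans h1 ?_)
      rw [← eLpNorm_exponent_top]
      exact le_add_self
    refine ⟨h3.trans ?_, h3⟩
    gcongr normYE a b f * ENNReal.ofReal ?_
    exact Real.rpow_le_rpow_of_exponent_le h2.le (by linarith)

theorem eLpNorm_top_tsum_le {α : Type*} {m : MeasurableSpace α} {μ : Measure α}
    (f : ℕ → α → ℝ≥0∞) :
    eLpNorm (fun x => ∑' n, f n x) ∞ μ ≤ ∑' n, eLpNorm (f n) ∞ μ := by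
  simp only [eLpNorm_exponent_top]
  refine eLpNormEssSup_le_of_ae_enorm_bound ?_
  filter_upwards [ae_all_iff.2 fun n => ae_le_eLpNormEssSup (f := f n) (μ := μ)] with x hx
  exact ENNReal.tsum_le_tsum hx

theorem eLpNorm_top_const_mul_le {α : Type*} {m : MeasurableSpace α} {μ : Measure α}
    (c : ℝ≥0∞) (f : α → ℝ≥0∞) : eLpNorm (fun x => c * f x) ∞ μ ≤ c * eLpNorm f ∞ μ := by
  simp only [eLpNorm_exponent_top]
  refine eLpNormEssSup_le_of_ae_enorm_bound ?_
  filter_upwards [ae_le_eLpNormEssSup (f := f) (μ := μ)] with x hx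
  exact mul_le_mul_right hx c

theorem absOp_le_of_le_rpow {f : ℝ → ℝ≥0∞} {s : ℝ≥0∞} {r : ℝ} (hr : -5 < r) (hr' : r < 2)
    (hf : ∀ᵐ p ∂halfLine, f p ≤ s * ENNReal.ofReal (p ^ r)) {p : ℝ} (hp : 0 < p) :
    absOp f p ≤ ENNReal.ofReal (kernelMoment (-r)) * s * ENNReal.ofReal (p ^ r) := by
  have hm : Measurable fun q : ℝ => ‖kernelV (p / q) / q‖ₑ * ENNReal.ofReal (q ^ r) :=
    (((measurable_kernelV.comp (by fun_prop)).div measurable_id).enorm).mul (by fun_prop)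
  calc absOp f p ≤ ∫⁻ q, s * (‖kernelV (p / q) / q‖ₑ * ENNReal.ofReal (q ^ r)) ∂halfLine := by
        refine lintegral_mono_ae ?_
        filter_upwards [hf] with q hq
        rw [mul_left_comm]
        gcongr
    _ = s * absOp (fun q => ENNReal.ofReal (q ^ r)) p := lintegral_const_mul _ hm
    _ = _ := by
        rw [absOp_rpow hp hr hr', mul_comm (p ^ r), ENNReal.ofReal_mul (kernelMoment_nonneg _)]
        ring

/-- The operator preserves domination by `p^(2a)` and by `p^(2b)` separately. The bounds `a < 1` and
`-5/2 < b` are what puts `-2a` and `-2b` inside the strip `(-2, 5)`. -/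
theorem functionNorm_y {a b : ℝ} (hab : AdmissibleY a b) :
    FunctionNorm (normYE a b) (kernelMoment (-(2 * a)) + kernelMoment (-(2 * b))) := by
  obtain ⟨hb, hb', ha, ha'⟩ := hab
  have hba : b ≤ a := by linarith
  refine ⟨add_nonneg (kernelMoment_nonneg _) (kernelMoment_nonneg _), fun hfg => ?_,
    fun c f hc => ?_, fun f hf => ?_, fun {f} hf hlt => ?_, fun {f} hf h0 => ?_, fun {f} hf => ?_⟩
  · have h1 := ae_halfLine_iff.1 hfg
    refine add_le_add (eLpNorm_mono_enorm_ae ?_) (eLpNorm_mono_enorm_ae ?_)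
    · exact h1.1.mono fun p hp => mul_le_mul_right hp _
    · exact h1.2.mono fun p hp => mul_le_mul_right hp _
  · rw [normYE, normYE, mul_add]
    simp only [mul_left_comm _ c]
    exact add_le_add (eLpNorm_top_const_mul_le _ _) (eLpNorm_top_const_mul_le _ _)
  · simp only [normYE, ← ENNReal.tsum_mul_left]
    rw [ENNReal.tsum_add]
    exact add_le_add (eLpNorm_top_tsum_le _) (eLpNorm_top_tsum_le _)
  · filter_upwards [ae_le_normYE hba f] with p hp
    exact hp.1.trans_lt (ENNReal.mul_lt_top hlt ENNReal.ofReal_lt_top)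
  · filter_upwards [ae_le_normYE hba f] with p hp
    simpa [h0] using hp.1
  · have hle := ae_le_normYE hba f
    refine (normYE_le (s := ENNReal.ofReal (kernelMoment (-(2 * a))) * normYE a b f)
      (t := ENNReal.ofReal (kernelMoment (-(2 * b))) * normYE a b f) ?_ ?_).trans_eq ?_
    · filter_upwards [ae_halfLine_pos] with p hp
      exact absOp_le_of_le_rpow (by linarith) (by linarith) (hle.mono fun _ h => h.1) hp
    · filter_upwards [ae_halfLine_pos] with p hp
      exact absOp_le_of_le_rpow (by linarith) (by linarith) (hle.mono fun _ h => h.2) hp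
    · rw [ENNReal.ofReal_add (kernelMoment_nonneg _) (kernelMoment_nonneg _), add_mul]

/-! ### Moments of solutions -/

theorem wellPosed_normLq {q θ : ℝ} (hq : 1 ≤ q) (hθ : θ ∈ Ioo (-1 : ℝ) (5 / 2)) :
    WellPosed (normLq q θ) := by
  rw [normLq_eq]
  exact (functionNorm_lq hq hθ).wellPosed

theorem wellPosed_normY {a b : ℝ} (hab : AdmissibleY a b) : WellPosed (normY a b) := by
  rw [normY_eq]
  exact (functionNorm_y hab).wellPosed

theorem eLpNorm_one_weightedHalfLine {c : ℝ} {f : ℝ → ℝ≥0∞} (hf : AEMeasurable f halfLine) :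
    eLpNorm f (ENNReal.ofReal 1) (weightedHalfLine (c / 2))
      = ∫⁻ p, f p * ENNReal.ofReal (p ^ (c - 1)) ∂halfLine := by
  rw [eLpNorm_ofReal_eq le_rfl, one_div_one, ENNReal.rpow_one]
  simp only [ENNReal.rpow_one]
  rw [lintegral_weightedHalfLine hf, mul_div_cancel₀ c two_ne_zero]

theorem memSpace_one_iff {c : ℝ} {f : ℝ → ℝ} (hf : AEStronglyMeasurable f halfLine) :
    MemSpace (inducedNorm fun f => eLpNorm f (ENNReal.ofReal 1) (weightedHalfLine (c / 2))) f ↔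
      Integrable (fun p => f p * p ^ (c - 1)) halfLine := by
  rw [integrable_mul_rpow_iff hf, ← eLpNorm_one_weightedHalfLine hf.enorm]
  exact ⟨fun h => h.2, fun h => ⟨hf, h⟩⟩

/-- A finite absolute moment of order `c` is membership in `L¹_{c/2}`, so the abstract theory also
controls moments. -/
theorem functionNorm_one {c : ℝ} (hc : -2 < c) (hc' : c < 5) :
    FunctionNorm (fun f => eLpNorm f (ENNReal.ofReal 1) (weightedHalfLine (c / 2)))
      (kernelMoment c) := by
  have := functionNorm_lq (q := 1) (θ := c / 2) le_rfl ⟨by linarith, by linarith⟩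
  rwa [show 2 * (c / 2) / 1 = c by ring] at this

theorem moment_iterate {A₀ : ℝ → ℝ} (hA : AEStronglyMeasurable A₀ halfLine) {c : ℝ} (hc : -2 < c)
    (hc' : c < 5) (hi : Integrable (fun p => A₀ p * p ^ (c - 1)) halfLine) (n : ℕ) :
    Integrable (fun p => kernelOp^[n] A₀ p * p ^ (c - 1)) halfLine ∧
      ∫ p, kernelOp^[n] A₀ p * p ^ (c - 1) ∂halfLine
        = kernelMoment c ^ n * ∫ p, A₀ p * p ^ (c - 1) ∂halfLine := by
  induction n with
  | zero => simpa using hi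
  | succ n ih =>
    have hm := aestronglyMeasurable_iterate hA n
    rw [Function.iterate_succ_apply', integral_kernelOp_mul_rpow hm hc hc' ih.1, ih.2, pow_succ',
      mul_assoc]
    exact ⟨integrable_kernelOp_mul_rpow hm hc hc' ih.1, rfl⟩

theorem integrable_solution_mul_rpow {A₀ : ℝ → ℝ} (hA : AEStronglyMeasurable A₀ halfLine) {c : ℝ}
    (hc : -2 < c) (hc' : c < 5) (hi : Integrable (fun p => A₀ p * p ^ (c - 1)) halfLine) (t : ℝ) :
    Integrable (fun p => solution A₀ t p * p ^ (c - 1)) halfLine := by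
  have h := (functionNorm_one hc hc').memSpace_solution ((memSpace_one_iff hA).2 hi) t
  exact (memSpace_one_iff h.1).1 h

/-- Termwise integration: the `n`-th iterate multiplies the moment by `m(c)ⁿ`, and the coefficients
then sum to an exponential. -/
theorem integral_solution_mul_rpow {A₀ : ℝ → ℝ} (hA : AEStronglyMeasurable A₀ halfLine) {c : ℝ}
    (hc : -2 < c) (hc' : c < 5) (hi : Integrable (fun p => A₀ p * p ^ (c - 1)) halfLine) (t : ℝ) :
    ∫ p, solution A₀ t p * p ^ (c - 1) ∂halfLine
      = Real.exp ((gammaN + kernelMoment c) * t) * ∫ p, A₀ p * p ^ (c - 1) ∂halfLine := by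
  have hlt := (functionNorm_one hc hc').tsum_enorm_lt_top ((memSpace_one_iff hA).2 hi)
    (summable_solCoef (kernelMoment_nonneg c) t)
  rw [eLpNorm_one_weightedHalfLine (aemeasurable_tsum_enorm hA _)] at hlt
  have hms : ∀ n, AEStronglyMeasurable
      (fun p => solCoef t n * kernelOp^[n] A₀ p * p ^ (c - 1)) halfLine := fun n =>
    ((aestronglyMeasurable_iterate hA n).const_mul _).mul
      (Measurable.aestronglyMeasurable (by fun_prop))
  have hsum := integral_tsum hms (by
    rw [← lintegral_tsum fun n => (hms n).enorm]
    refine ne_of_lt (lt_of_le_of_lt (lintegral_mono_ae ?_) hlt)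
    filter_upwards [ae_halfLine_pos] with p hp
    rw [← ENNReal.tsum_mul_right]
    exact (tsum_congr fun n => enorm_mul_rpow hp _ _).le)
  calc ∫ p, solution A₀ t p * p ^ (c - 1) ∂halfLine
      = ∫ p, ∑' n, solCoef t n * kernelOp^[n] A₀ p * p ^ (c - 1) ∂halfLine := by
        refine integral_congr_ae (ae_of_all _ fun p => ?_)
        simp only [solution, opSeries]
        rw [tsum_mul_right]
    _ = ∑' n, solCoef t n * kernelMoment c ^ n * ∫ p, A₀ p * p ^ (c - 1) ∂halfLine := by
        rw [hsum]
        refine tsum_congr fun n => ?_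
        rw [mul_assoc, ← (moment_iterate hA hc hc' hi n).2, ← integral_const_mul]
        refine integral_congr_ae (ae_of_all _ fun p => ?_)
        simp only [mul_assoc]
    _ = _ := by rw [tsum_mul_right, (hasSum_solCoef t (kernelMoment c)).tsum_eq]

theorem isSolutionInSomeSpace_ae_eq {A₀ : ℝ → ℝ} {A : ℝ → ℝ → ℝ}
    (hA : IsSolutionInSomeSpace A₀ A) :
    AEStronglyMeasurable A₀ halfLine ∧ ∀ t, 0 ≤ t → A t =ᵐ[halfLine] solution A₀ t := by
  rcases hA with ⟨q, θ, hq, hθ, hA⟩ | ⟨a, b, hab, hA⟩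
  · rw [normLq_eq] at hA
    have h := functionNorm_lq hq hθ
    exact ⟨(h.memSpace_of_isSolution hA).1, fun t ht => h.isSolution_ae_eq_solution hA ht⟩
  · rw [normY_eq] at hA
    have h := functionNorm_y hab
    exact ⟨(h.memSpace_of_isSolution hA).1, fun t ht => h.isSolution_ae_eq_solution hA ht⟩

/-- The moments of a solution evolve exponentially. -/
theorem moment_isSolution {A₀ : ℝ → ℝ} {A : ℝ → ℝ → ℝ} (hA : IsSolutionInSomeSpace A₀ A) {c : ℝ}
    (hc : -2 < c) (hc' : c < 5) (hi : Integrable (fun p => A₀ p * p ^ (c - 1)) halfLine) {t : ℝ}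
    (ht : 0 ≤ t) :
    Integrable (fun p => A t p * p ^ (c - 1)) halfLine ∧
      ∫ p, A t p * p ^ (c - 1) ∂halfLine
        = Real.exp ((gammaN + kernelMoment c) * t) * ∫ p, A₀ p * p ^ (c - 1) ∂halfLine := by
  obtain ⟨hm, heq⟩ := isSolutionInSomeSpace_ae_eq hA
  have h1 : (fun p => A t p * p ^ (c - 1)) =ᵐ[halfLine]
      fun p => solution A₀ t p * p ^ (c - 1) := by
    filter_upwards [heq t ht] with p hp
    rw [hp]
  exact ⟨(integrable_solution_mul_rpow hm hc hc' hi t).congr h1.symm,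
    (integral_congr_ae h1).trans (integral_solution_mul_rpow hm hc hc' hi t)⟩

/-- At `c = 1` the rate `γ_N + m(1)` vanishes. -/
theorem mass_isSolution {A₀ : ℝ → ℝ} {A : ℝ → ℝ → ℝ} (hA : IsSolutionInSomeSpace A₀ A)
    (hi : Integrable A₀ halfLine) {t : ℝ} (ht : 0 ≤ t) :
    Integrable (A t) halfLine ∧ ∫ p, A t p ∂halfLine = ∫ p, A₀ p ∂halfLine := by
  have := moment_isSolution hA (c := 1) (by norm_num) (by norm_num) (by simpa using hi) ht
  simpa [gammaN_eq_neg_kernelMoment] using this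

/-! ### The explicit bound in `L^q_0` -/

theorem normLq_one_zero_kernelV : normLq 1 0 kernelV = ENNReal.ofReal (kernelMoment 0) := by
  have h := eLpNorm_one_weightedHalfLine (c := 0) (measurable_kernelV.enorm.aemeasurable)
  rw [zero_div] at h
  rw [normLq_eq, inducedNorm, h,
    ← lintegral_enorm_kernelV_mul_rpow (by norm_num) (by norm_num)]
  refine lintegral_congr_ae ?_
  filter_upwards [ae_halfLine_pos] with p hp using (enorm_mul_rpow hp _ _).symm

/-- Equivalent to `(K - 1)(e^(Kt) - 1) ≥ 0`; it will be used with `K = m(0)`. -/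
theorem exp_mul_le_one_add {K t : ℝ} (hK : 1 ≤ K) (ht : 0 ≤ t) :
    Real.exp (K * t) ≤ 1 + K * (Real.exp (K * t) - 1) := by
  have : 1 ≤ Real.exp (K * t) := Real.one_le_exp (by positivity)
  nlinarith

/-- For `θ = 0` the exponent `2θ/q` is `0` for every `q`, so the operator bound is `m(0)`, the norm
of the kernel in `L¹_0`. -/
theorem normLq_zero_le {q : ℝ} (hq : 1 ≤ q) {A₀ : ℝ → ℝ} {A : ℝ → ℝ → ℝ}
    (hA : IsSolution (normLq q 0) A₀ A) {t : ℝ} (ht : 0 ≤ t) :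
    normLq q 0 (A t) ≤ ENNReal.ofReal (Real.exp (gammaN * t) *
      (1 + (normLq 1 0 kernelV).toReal *
        (Real.exp ((normLq 1 0 kernelV).toReal * t) - 1))) * normLq q 0 A₀ := by
  have h := functionNorm_lq hq (θ := 0) ⟨by norm_num, by norm_num⟩
  rw [mul_zero, zero_div] at h
  rw [normLq_one_zero_kernelV, ENNReal.toReal_ofReal (kernelMoment_nonneg 0)]
  rw [normLq_eq] at hA ⊢
  refine (h.norm_isSolution_le hA ht).trans ?_
  rw [add_mul, Real.exp_add]
  gcongr
  exact exp_mul_le_one_add one_le_kernelMoment_zero ht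

/-! ### Long time behaviour -/

/-- Power counting: `2a + c > 0` at the origin and `2b + c < 0` at infinity. -/
theorem integrable_mul_rpow_of_memSpace_normY {a b c : ℝ} (hab : AdmissibleY a b)
    (hca : 0 < 2 * a + c) (hcb : 2 * b + c < 0) {A₀ : ℝ → ℝ} (hA : MemSpace (normY a b) A₀) :
    Integrable (fun p => A₀ p * p ^ (c - 1)) halfLine := by
  obtain ⟨hb, hb', ha, ha'⟩ := hab
  rw [normY_eq] at hA
  have hS : normYE a b (fun p => ‖A₀ p‖ₑ) < ∞ := hA.2
  rw [integrable_mul_rpow_iff hA.1, lintegral_halfLine_eq_add]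
  have hle := ae_halfLine_iff.1 (ae_le_normYE (show b ≤ a by linarith) fun p => ‖A₀ p‖ₑ)
  have hmul : ∀ {p r : ℝ}, 0 < p →
      ‖A₀ p‖ₑ ≤ normYE a b (fun p => ‖A₀ p‖ₑ) * ENNReal.ofReal (p ^ (2 * r)) →
      ‖A₀ p‖ₑ * ENNReal.ofReal (p ^ (c - 1))
        ≤ normYE a b (fun p => ‖A₀ p‖ₑ) * ‖p ^ (2 * r + c - 1)‖ₑ := fun {p r} hp h => by
    rw [Real.enorm_of_nonneg (r := p ^ (2 * r + c - 1)) (by positivity), add_sub_assoc,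
      ← ofReal_rpow_mul_ofReal_rpow hp, ← mul_assoc]
    gcongr
  refine ENNReal.add_lt_top.2 ⟨?_, ?_⟩
  · have hi : IntegrableOn (fun p : ℝ => p ^ (2 * a + c - 1)) (Ioo 0 1) := by
      have := intervalIntegral.intervalIntegrable_rpow' (a := 0) (b := 1)
        (r := 2 * a + c - 1) (by linarith)
      rwa [intervalIntegrable_iff_integrableOn_Ioo_of_le zero_le_one] at this
    calc _ ≤ ∫⁻ p in Ioo (0 : ℝ) 1, normYE a b (fun p => ‖A₀ p‖ₑ) * ‖p ^ (2 * a + c - 1)‖ₑ := by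
          refine lintegral_mono_ae ?_
          filter_upwards [hle.1, ae_restrict_mem measurableSet_Ioo] with p h1 h2
          exact hmul h2.1 h1.1
      _ < ∞ := by
          rw [lintegral_const_mul' _ _ hS.ne]
          exact ENNReal.mul_lt_top hS hi.2
  · have hi : IntegrableOn (fun p : ℝ => p ^ (2 * b + c - 1)) (Ioi 1) :=
      integrableOn_Ioi_rpow_of_lt (by linarith) one_pos
    calc _ ≤ ∫⁻ p in Ioi (1 : ℝ), normYE a b (fun p => ‖A₀ p‖ₑ) * ‖p ^ (2 * b + c - 1)‖ₑ := by
          refine lintegral_mono_ae ?_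
          filter_upwards [hle.2, ae_restrict_mem measurableSet_Ioi] with p h1 (h2 : 1 < p)
          exact hmul (one_pos.trans h2) h1.2
      _ < ∞ := by
          rw [lintegral_const_mul' _ _ hS.ne]
          exact ENNReal.mul_lt_top hS hi.2

/-- A bounded function continuous at the origin is controlled by its value there and `√p`. -/
theorem exists_abs_sub_le_add_mul_rpow {φ : ℝ → ℝ} (hφ : ContinuousOn φ (Ici 0)) {M : ℝ}
    (hM : ∀ p, 0 ≤ p → |φ p| ≤ M) {ε : ℝ} (hε : 0 < ε) :
    ∃ K, ∀ p, 0 < p → |φ p - φ 0| ≤ ε + K * p ^ (1 / 2 : ℝ) := by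
  obtain ⟨δ, hδ, hclose⟩ := Metric.continuousWithinAt_iff.1 (hφ 0 self_mem_Ici) ε hε
  have hM0 : 0 ≤ M := (abs_nonneg _).trans (hM 0 le_rfl)
  refine ⟨2 * M / δ ^ (1 / 2 : ℝ), fun p hp => ?_⟩
  have hpos : 0 < δ ^ (1 / 2 : ℝ) := by positivity
  rcases lt_or_ge p δ with h | h
  · have h1 := hclose hp.le (by rwa [Real.dist_eq, sub_zero, abs_of_pos hp])
    rw [Real.dist_eq] at h1
    have : 0 ≤ 2 * M / δ ^ (1 / 2 : ℝ) * p ^ (1 / 2 : ℝ) := by positivity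
    linarith
  · have h1 : |φ p - φ 0| ≤ 2 * M := by
      have := abs_sub (φ p) (φ 0)
      have := hM p hp.le
      have := hM 0 le_rfl
      linarith
    have h2 : 2 * M ≤ 2 * M / δ ^ (1 / 2 : ℝ) * p ^ (1 / 2 : ℝ) := by
      rw [div_mul_eq_mul_div, le_div_iff₀ hpos]
      gcongr
    linarith

theorem tendsto_exp_decay_mul {l : ℝ} (hl : l < 0) (c : ℝ) :
    Tendsto (fun t => Real.exp (l * t) * c) atTop (𝓝 0) := by
  have := (Real.tendsto_exp_atBot.comp (tendsto_id.const_mul_atTop_of_neg hl)).mul_const c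
  simpa using this

/-- Since `|φ - φ(0)| ≤ ε' + K √p` and `A ≥ 0`, the error is at most `ε'` times the conserved mass
plus `K` times the moment of order `3/2`, which decays exponentially. -/
theorem tendsto_integral_isSolution {a b : ℝ} (hab : AdmissibleY a b) {A₀ : ℝ → ℝ}
    {A : ℝ → ℝ → ℝ} (hpos : Nonneg A₀) (hA : IsSolution (normY a b) A₀ A) :
    Integrable A₀ halfLine ∧
      ∀ φ : ℝ → ℝ, ContinuousOn φ (Ici 0) → (∃ M : ℝ, ∀ p, 0 ≤ p → |φ p| ≤ M) →
        (∀ t : ℝ, 0 ≤ t → Integrable (fun p => A t p * φ p) halfLine) ∧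
        Tendsto (fun t : ℝ => ∫ p, A t p * φ p ∂halfLine) atTop
          (𝓝 (φ 0 * ∫ p, A₀ p ∂halfLine)) := by
  obtain ⟨hb, hb', ha, ha'⟩ := id hab
  have hsol : IsSolutionInSomeSpace A₀ A := Or.inr ⟨a, b, hab, hA⟩
  have hmem : MemSpace (normY a b) A₀ := by
    rw [normY_eq] at hA ⊢
    exact (functionNorm_y hab).memSpace_of_isSolution hA
  have hi : Integrable A₀ halfLine := by
    simpa using integrable_mul_rpow_of_memSpace_normY hab (c := 1) (by linarith) (by linarith) hmem
  -- Here `b < -3/4` is exactly what is needed: `2b + 3/2 < 0`.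
  have hi2 := integrable_mul_rpow_of_memSpace_normY hab (c := 3 / 2) (by linarith) (by linarith) hmem
  refine ⟨hi, fun φ hφ ⟨M, hM⟩ => ?_⟩
  have hint : ∀ t : ℝ, 0 ≤ t → Integrable (fun p => A t p * φ p) halfLine := fun t ht => by
    refine (mass_isSolution hsol hi ht).1.mul_bdd (c := M) ?_ ?_
    · exact (hφ.mono Ioi_subset_Ici_self).aestronglyMeasurable measurableSet_Ioi
    · filter_upwards [ae_halfLine_pos] with p hp using hM p hp.le
  refine ⟨hint, ?_⟩
  have hnn : ∀ t, 0 ≤ t → Nonneg (A t) := fun t ht => by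
    filter_upwards [(isSolutionInSomeSpace_ae_eq hsol).2 t ht, nonneg_solution hpos ht] with p h1 h2
    rw [h1]
    exact h2
  have hm0 : 0 ≤ ∫ p, A₀ p ∂halfLine := integral_nonneg_of_ae hpos
  rw [Metric.tendsto_nhds]
  intro ε hε
  set m := ∫ p, A₀ p ∂halfLine with hm
  -- The mass part of the error becomes at most `ε/2`; the `+ 1` allows for zero mass.
  obtain ⟨K, hK⟩ := exists_abs_sub_le_add_mul_rpow hφ hM (ε := ε / (2 * (m + 1))) (by positivity)
  have hdecay := (tendsto_exp_decay_mul (l := gammaN + kernelMoment (3 / 2))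
    (by rw [gammaN_eq_neg_kernelMoment]; linarith [kernelMoment_three_halves_lt_one])
    (∫ p, A₀ p * p ^ ((3 / 2 : ℝ) - 1) ∂halfLine)).const_mul K
  rw [mul_zero] at hdecay
  filter_upwards [eventually_ge_atTop 0, hdecay.eventually (gt_mem_nhds (half_pos hε))]
    with t ht hdt
  obtain ⟨hAi, hAm⟩ := mass_isSolution hsol hi ht
  obtain ⟨hAi2, hAm2⟩ := moment_isSolution hsol (c := 3 / 2) (by norm_num) (by norm_num) hi2 ht
  rw [Real.dist_eq, hm, ← hAm, ← integral_const_mul, ← integral_sub (hint t ht) (hAi.const_mul _)]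
  calc |∫ p, A t p * φ p - φ 0 * A t p ∂halfLine|
      ≤ ∫ p, (ε / (2 * (m + 1)) * A t p + K * (A t p * p ^ ((3 / 2 : ℝ) - 1))) ∂halfLine := by
        rw [← Real.norm_eq_abs]
        refine norm_integral_le_of_norm_le ((hAi.const_mul _).add (hAi2.const_mul _)) ?_
        filter_upwards [ae_halfLine_pos, hnn t ht] with p hp hAp
        rw [show A t p * φ p - φ 0 * A t p = A t p * (φ p - φ 0) by ring, norm_mul,
          Real.norm_of_nonneg hAp, Real.norm_eq_abs]
        have h1 := mul_le_mul_of_nonneg_left (hK p hp) hAp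
        rw [show (3 / 2 : ℝ) - 1 = 1 / 2 by norm_num]
        linarith
    _ = ε / (2 * (m + 1)) * m + K * (Real.exp ((gammaN + kernelMoment (3 / 2)) * t) *
          ∫ p, A₀ p * p ^ ((3 / 2 : ℝ) - 1) ∂halfLine) := by
        rw [integral_add (hAi.const_mul _) (hAi2.const_mul _), integral_const_mul,
          integral_const_mul, hAm, hAm2]
    _ < ε := by
        have : ε / (2 * (m + 1)) * m ≤ ε / 2 := by
          rw [div_mul_eq_mul_div, div_le_div_iff₀ (by positivity) two_pos]
          nlinarith
        linarith

end

end LinearWKE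

/-! ### Assembly. -/

theorem theorem2 :
    -- well-posedness in the spaces `L^q_θ`
    (∀ q θ : ℝ, 1 ≤ q → θ ∈ Ioo (-1 : ℝ) (5 / 2) → WellPosed (normLq q θ)) ∧
    -- the explicit exponential bound for `θ = 0`
    (MemSpace (normLq 1 0) kernelV ∧
      ∀ q : ℝ, 1 ≤ q → ∀ (A₀ : ℝ → ℝ) (A : ℝ → ℝ → ℝ), Nonneg A₀ →
        IsSolution (normLq q 0) A₀ A → ∀ t : ℝ, 0 ≤ t →
          normLq q 0 (A t) ≤
            ENNReal.ofReal (Real.exp (gammaN * t) *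
              (1 + (normLq 1 0 kernelV).toReal *
                (Real.exp ((normLq 1 0 kernelV).toReal * t) - 1))) * normLq q 0 A₀) ∧
    -- well-posedness in the spaces `𝒴_{a,b}`
    (∀ a b : ℝ, AdmissibleY a b → WellPosed (normY a b)) ∧
    -- conservation of the wave action
    (∀ (A₀ : ℝ → ℝ) (A : ℝ → ℝ → ℝ), IsSolutionInSomeSpace A₀ A → Integrable A₀ halfLine →
      ∀ t : ℝ, 0 ≤ t → Integrable (A t) halfLine ∧
        ∫ p, A t p ∂halfLine = ∫ p, A₀ p ∂halfLine) ∧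
    -- exponential growth of the energy
    (∃ κ : ℝ, 0 < κ ∧
      ∀ (A₀ : ℝ → ℝ) (A : ℝ → ℝ → ℝ), IsSolutionInSomeSpace A₀ A →
        Integrable (fun p => A₀ p * p ^ 2) halfLine →
        ∀ t : ℝ, 0 ≤ t → Integrable (fun p => A t p * p ^ 2) halfLine ∧
          ∫ p, A t p * p ^ 2 ∂halfLine =
            Real.exp (κ * t) * ∫ p, A₀ p * p ^ 2 ∂halfLine) ∧
    -- long time behaviour
    (∀ a b : ℝ, AdmissibleY a b → ∀ (A₀ : ℝ → ℝ) (A : ℝ → ℝ → ℝ), Nonneg A₀ →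
      IsSolution (normY a b) A₀ A →
      Integrable A₀ halfLine ∧
      ∀ φ : ℝ → ℝ, ContinuousOn φ (Ici 0) → (∃ M : ℝ, ∀ p, 0 ≤ p → |φ p| ≤ M) →
        (∀ t : ℝ, 0 ≤ t → Integrable (fun p => A t p * φ p) halfLine) ∧
        Tendsto (fun t : ℝ => ∫ p, A t p * φ p ∂halfLine) atTop
          (𝓝 (φ 0 * ∫ p, A₀ p ∂halfLine))) := by
  refine ⟨fun q θ hq hθ => wellPosed_normLq hq hθ, ⟨⟨measurable_kernelV.aestronglyMeasurable, ?_⟩,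
    fun q hq A₀ A _ hA t ht => normLq_zero_le hq hA ht⟩, fun a b hab => wellPosed_normY hab,
    fun A₀ A hA hi t ht => mass_isSolution hA hi ht,
    -- The energy is the moment of order `3`, so its rate is `γ_N + m(3) = m(3) - m(1)`.
    ⟨kernelMoment 3 - kernelMoment 1, sub_pos.2 kernelMoment_one_lt_three,
      fun A₀ A hA hi t ht => ?_⟩,
    fun a b hab A₀ A hpos hA => tendsto_integral_isSolution hab hpos hA⟩
  · rw [normLq_one_zero_kernelV]
    exact ENNReal.ofReal_lt_top
  · have hp : ∀ p : ℝ, p ^ ((3 : ℝ) - 1) = p ^ 2 := fun p => by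
      rw [show (3 : ℝ) - 1 = 2 by norm_num, Real.rpow_ofNat]
    have := moment_isSolution hA (c := 3) (by norm_num) (by norm_num)
      (by simpa only [hp] using hi) ht
    rw [gammaN_eq_neg_kernelMoment, neg_add_eq_sub] at this
    simpa only [hp] using this
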